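/- **Setting.** A *small symmetric monoidal category with initial unit* is a small symmetric monoidal category $(\mathcal M,\oplus,0)$ whose unit $0$ is an initial object. Let $\mathcal B$ be a Grothendieck category and $\mathrm{Fct}(\mathcal M,\mathcal B)$ the category of all functors $\mathcal M\to\mathcal B$. * For $x\in\mathcal M$, let $\tau_x$ be the endofunctor of $\mathrm{Fct}(\mathcal M,\mathcal B)$ given by precomposition with $x\oplus -$. The morphism $0\to x$ induces a natural transformation $i_x:\mathrm{Id}\to\tau_x$. Put $\kappa_x(F)=\ker(i_x(F):F\to\tau_x F)$ and $\kappa(F)=\sum_{x}\kappa_x(F)\subseteq F$. The functor $F$ is *stably null* if $\kappa(F)=F$. The stably null functors form a Serre subcategory, and $\mathbf{St}(\mathcal M,\mathcal B)$ denotes the quotient of $\mathrm{Fct}(\mathcal M,\mathcal B)$ by it. * The functors $\tau_x$ and the transformations $i_x$ pass to $\mathbf{St}(\mathcal M,\mathcal B)$. Let $\delta_x$ be the endofunctor $\mathrm{coker}(i_x:\mathrm{Id}\to\tau_x)$ of $\mathbf{St}(\mathcal M,\mathcal B)$. * Let $\mathcal Pol_n(\mathcal M,\mathcal B)$ be the full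 subcategory of $\mathbf{St}(\mathcal M,\mathcal B)$ consisting of the zero objects for $n=-1$ and, for $n\ge 0$, of the objects $X$ with $\delta_x X\in\mathcal Pol_{n-1}(\mathcal M,\mathcal B)$ for every $x\in\mathcal M$. It is an abelian category in which $\mathcal Pol_{n-1}(\mathcal M,\mathcal B)$ is a Serre subcategory, so that the quotient category $\mathcal Pol_n(\mathcal M,\mathcal B)/\mathcal Pol_{n-1}(\mathcal M,\mathcal B)$ is defined. A small additive category is regarded as symmetric monoidal through the direct sum, with unit its zero object. (In that case the only stably null functor is $0$, so that $\mathbf{St}=\mathrm{Fct}$.) **Hermitian objects.** Let $\mathcal A$ be a small additive category with a duality: a functor $D:\mathcal A^{op}\to\mathcal A$ with natural isomorphisms $\sigma_{X,Y}:\mathcal A(X,DY)\to\mathcal A(Y,DX)$ such that $\sigma_{Y,X}=\sigma_{X,Y}^{-1}$ and such that the unit $\sigma_{DX,X}(\mathrm{id}_{DX}):X\to D^2X$ is an isomorphism for every $X$. Write $\bar a=\sigma_{X,X}(a)$ for $a\in\mathcal A(X,DX)$. Let $TD^2:\mathcal A^{op}\to\mathbf{Ab}$ be $X\mapsto\mathcal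 A(X,DX)$, where $f:X\to Y$ acts by $a\mapsto D(f)\circ a\circ f$. Fix $\varepsilon\in\{-1,1\}$, and let $T:\mathcal A^{op}\to\mathbf{Ab}$ be one of the following two functors, with the indicated natural transformation $T\to TD^2$: * $SD^2_\varepsilon(X)=\mathcal A(X,DX)/\{\bar a-\varepsilon a\}$, with the transformation induced by the norm $a\mapsto a+\varepsilon\bar a$; * $\bar SD^2_\varepsilon(X)=\{a+\varepsilon\bar a\;:\;a\in\mathcal A(X,DX)\}\subseteq\mathcal A(X,DX)$, with the inclusion. The category $\mathbf H(\mathcal A)=\mathbf H^T(\mathcal A)$ of *hermitian objects* has as objects the pairs $(X,u)$ with $X\in\mathcal A$ and $u\in T(X)$ such that the image of $u$ in $\mathcal A(X,DX)$ is invertible. Its morphisms $(X,u)\to(Y,v)$ are the morphisms $f:X\to Y$ of $\mathcal A$ with $T(f)(v)=u$. It is symmetric monoidal through the orthogonal sum: $(X,u)\oplus(Y,v)$ is $X\oplus Y$ with the image of $(u,v)$ under the canonical map $T(X)\oplus T(Y)\to T(X\oplus Y)$. Its unit $(0,0)$ is initial. Let $\pi^T:\mathbf H(\mathcal A)\to\mathcal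 A$ be the forgetful functor $(X,u)\mapsto X$. **Theorem.** For every small additive category with duality $\mathcal A$, every $\varepsilon\in\{-1,1\}$, each of the two choices of $T$, every Grothendieck category $\mathcal B$ and every $n\in\mathbb N$, the functor $\pi^T$ induces an equivalence of categories $$\mathcal Pol_n(\mathcal A,\mathcal B)/\mathcal Pol_{n-1}(\mathcal A,\mathcal B)\xrightarrow{\ \simeq\ }\mathcal Pol_n(\mathbf H(\mathcal A),\mathcal B)/\mathcal Pol_{n-1}(\mathbf H(\mathcal A),\mathcal B).$$ That is, precomposition with $\pi^T$ induces a functor $\mathbf{St}(\mathcal A,\mathcal B)\to\mathbf{St}(\mathbf H(\mathcal A),\mathcal B)$. The latter restricts to a functor $\mathcal Pol_n(\mathcal A,\mathcal B)\to\mathcal Pol_n(\mathbf H(\mathcal A),\mathcal B)$, and this restriction induces a functor between the above quotient categories, which is an equivalence. -/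

import Mathlib

open CategoryTheory CategoryTheory.Limits CategoryTheory.MonoidalCategory Opposite

universe v u

set_option linter.unusedSectionVars false

namespace StablePol

section Abelian

variable {C : Type u} [Category.{v} C] [Abelian C] (P : ObjectProperty C)

instance serreFiniteProducts [P.IsSerreClass] : P.IsClosedUnderFiniteProducts :=
  have : P.IsClosedUnderLimitsOfShape (Discrete WalkingPair) := by
    refine ⟨?_⟩
    rintro X ⟨p⟩
    refine P.prop_of_iso ?_ (P.prop_biprod (p.prop_diag_obj (.mk .left))
      (p.prop_diag_obj (.mk .right)))
    exact IsLimit.conePointUniqueUpToIso (BinaryBiproduct.isLimit _ _)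
      ((IsLimit.postcomposeHomEquiv (diagramIsoPair p.diag) _).2 p.isLimit)
  .mk'

instance serre_ι_limits [P.IsSerreClass] : PreservesFiniteLimits P.ι := by
  have : P.ι.Additive := inferInstance
  rw [((Functor.preservesFiniteLimits_tfae P.ι).out 3 2 :)]
  intro _ _ f
  exact P.preservesKernels_ι f

instance serre_ι_colimits [P.IsSerreClass] : PreservesFiniteColimits P.ι := by
  rw [((Functor.preservesFiniteColimits_tfae P.ι).out 3 2 :)]
  intro _ _ f
  exact P.preservesCokernels_ι f

variable (T : C ⥤ C) (ι : 𝟭 C ⟶ T)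

/-- The cokernel of a natural transformation `Id ⟶ T`. -/
noncomputable def diff : C ⥤ C where
  obj X := cokernel (ι.app X)
  map f := cokernel.map _ _ f (T.map f) (ι.naturality f).symm

lemma π_diff_map {X Y : C} (f : X ⟶ Y) :
    cokernel.π (ι.app X) ≫ (diff T ι).map f = T.map f ≫ cokernel.π (ι.app Y) :=
  cokernel.π_desc _ _ _

lemma diff_shortExact [PreservesFiniteLimits T] [PreservesFiniteColimits T]
    [∀ X, Mono (ι.app X)] {X Y Z : C} {f : X ⟶ Y} {g : Y ⟶ Z} {w : f ≫ g = 0}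
    (h : (ShortComplex.mk f g w).ShortExact)
    (w' : (diff T ι).map f ≫ (diff T ι).map g = 0) :
    (ShortComplex.mk ((diff T ι).map f) ((diff T ι).map g) w').ShortExact := by
  have hT := h.map_of_exact T
  let v : ShortComplex.mk f g w ⟶ (ShortComplex.mk f g w).map T :=
    { τ₁ := ι.app X, τ₂ := ι.app Y, τ₃ := ι.app Z
      comm₁₂ := ι.naturality f |>.symm, comm₂₃ := ι.naturality g |>.symm }
  let π : (ShortComplex.mk f g w).map T ⟶
      ShortComplex.mk ((diff T ι).map f) ((diff T ι).map g) w' :=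
    { τ₁ := cokernel.π (ι.app X), τ₂ := cokernel.π (ι.app Y), τ₃ := cokernel.π (ι.app Z)
      comm₁₂ := π_diff_map T ι f, comm₂₃ := π_diff_map T ι g }
  have wπ : v ≫ π = 0 := by
    ext
    · exact cokernel.condition (ι.app X)
    · exact cokernel.condition (ι.app Y)
    · exact cokernel.condition (ι.app Z)
  let s : ShortComplex.SnakeInput C :=
    { L₀ := kernel v
      L₁ := ShortComplex.mk f g w
      L₂ := (ShortComplex.mk f g w).map T
      L₃ := ShortComplex.mk ((diff T ι).map f) ((diff T ι).map g) w'
      v₀₁ := kernel.ι v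
      v₁₂ := v
      v₂₃ := π
      w₀₂ := kernel.condition v
      w₁₃ := wπ
      h₀ := kernelIsKernel v
      h₃ := ShortComplex.isColimitOfIsColimitπ _
        ((CokernelCofork.isColimitMapCoconeEquiv _ _).symm (cokernelIsCokernel (ι.app X)))
        ((CokernelCofork.isColimitMapCoconeEquiv _ _).symm (cokernelIsCokernel (ι.app Y)))
        ((CokernelCofork.isColimitMapCoconeEquiv _ _).symm (cokernelIsCokernel (ι.app Z)))
      L₁_exact := h.exact
      epi_L₁_g := h.epi_g
      L₂_exact := hT.exact
      mono_L₂_f := hT.mono_f }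
  have hz : IsZero s.L₀.X₃ := by
    rw [IsZero.iff_id_eq_zero]
    apply Fork.IsLimit.hom_ext s.h₀τ₃
    change _ ≫ s.v₀₁.τ₃ = _ ≫ s.v₀₁.τ₃
    rw [← cancel_mono (ι.app Z)]
    change (_ ≫ s.v₀₁.τ₃) ≫ s.v₁₂.τ₃ = (_ ≫ s.v₀₁.τ₃) ≫ s.v₁₂.τ₃
    simp
  refine { exact := s.L₃_exact, mono_f := ?_, epi_g := ?_ }
  · exact s.L₂'_exact.mono_g (hz.eq_of_src _ _)
  · have := hT.epi_g
    have e : Epi (T.map g ≫ cokernel.π (ι.app Z)) := by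
      have : Epi (T.map g) := this
      exact epi_comp _ _
    rw [← π_diff_map T ι g] at e
    exact @epi_of_epi _ _ _ _ _ (cokernel.π (ι.app Y)) ((diff T ι).map g) e

instance [T.PreservesZeroMorphisms] : (diff T ι).PreservesZeroMorphisms where
  map_zero X Y := by
    refine (cancel_epi (cokernel.π (ι.app X))).1 ?_
    refine (π_diff_map T ι 0).trans ?_
    rw [T.map_zero, zero_comp]
    exact comp_zero.symm

lemma mono_app_of_iso {X Y : C} (e : X ≅ Y) (h : Mono (ι.app X)) : Mono (ι.app Y) := by
  have e' : ι.app Y = e.inv ≫ ι.app X ≫ T.map e.hom := by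
    rw [← ι.naturality e.hom]
    exact (e.inv_hom_id_assoc _).symm
  rw [e']
  exact mono_comp' inferInstance (mono_comp' h inferInstance)

lemma diff_map_mono [PreservesFiniteLimits T] [PreservesFiniteColimits T]
    [∀ X, Mono (ι.app X)] {X Y : C} (f : X ⟶ Y) [Mono f] : Mono ((diff T ι).map f) := by
  have h : (ShortComplex.mk f (cokernel.π f) (cokernel.condition f)).ShortExact :=
    { exact := ShortComplex.exact_cokernel f
      mono_f := ‹_›
      epi_g := inferInstanceAs (Epi (cokernel.π f)) }
  exact (diff_shortExact T ι h (by
    rw [← Functor.map_comp, cokernel.condition, Functor.map_zero])).mono_f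

lemma diff_map_epi [PreservesFiniteLimits T] [PreservesFiniteColimits T]
    [∀ X, Mono (ι.app X)] {X Y : C} (f : X ⟶ Y) [Epi f] : Epi ((diff T ι).map f) := by
  have h : (ShortComplex.mk (kernel.ι f) f (kernel.condition f)).ShortExact :=
    { exact := ShortComplex.exact_kernel f
      mono_f := inferInstanceAs (Mono (kernel.ι f))
      epi_g := ‹_› }
  exact (diff_shortExact T ι h (by
    rw [← Functor.map_comp, kernel.condition, Functor.map_zero])).epi_g

end Abelian

section Stable

lemma epi_sigma_pullback {C : Type u} [Category.{v} C] {w : Type v} {X Y : C} [Abelian C]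
    [HasColimitsOfSize.{v, v} C] [AB5OfSize.{v, v} C] [Nonempty w] (K : w → C) (k : ∀ i, K i ⟶ X)
    [∀ i, Mono (k i)]
    (dir : ∀ i j, ∃ l, (∃ a : K i ⟶ K l, a ≫ k l = k i) ∧ (∃ b : K j ⟶ K l, b ≫ k l = k j))
    (hk : Epi (Sigma.desc k)) (f : Y ⟶ X) :
    Epi (Sigma.desc fun i => pullback.fst f (k i)) := by
  let _ : Preorder w :=
    { le := fun i j => ∃ a : K i ⟶ K j, a ≫ k j = k i
      le_refl := fun i => ⟨𝟙 _, by simp⟩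
      le_trans := fun i j l ⟨a, ha⟩ ⟨b, hb⟩ => ⟨a ≫ b, by simp [ha, hb]⟩ }
  have : IsDirectedOrder w := ⟨fun i j => dir i j⟩
  let G : w ⥤ C :=
    { obj := K
      map := fun h => h.le.choose
      map_id := fun i => by
        rw [← cancel_mono (k i), (leOfHom (𝟙 i)).choose_spec, Category.id_comp]
      map_comp := fun {i j l} g h => by
        rw [← cancel_mono (k l), (leOfHom (g ≫ h)).choose_spec, Category.assoc,
          (leOfHom h).choose_spec, (leOfHom g).choose_spec] }
  let α : G ⟶ (Functor.const w).obj X :=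
    { app := k
      naturality := fun i j g => by
        change (leOfHom g).choose ≫ k j = k i ≫ 𝟙 X
        rw [(leOfHom g).choose_spec, Category.comp_id] }
  let β : (Functor.const w).obj Y ⟶ (Functor.const w).obj X := (Functor.const w).map f
  let i₀ : w := Classical.arbitrary w
  have hι : ∀ (Z : C) (i : w), colimit.ι ((Functor.const w).obj Z) i =
      colimit.ι ((Functor.const w).obj Z) i₀ := by
    intro Z i
    obtain ⟨l, h₁, h₂⟩ := dir i i₀
    have e₁ := colimit.w ((Functor.const w).obj Z) (homOfLE (show i ≤ l from h₁))
    have e₂ := colimit.w ((Functor.const w).obj Z) (homOfLE (show i₀ ≤ l from h₂))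
    simp only [Functor.const_obj_map, Functor.const_obj_obj, Category.id_comp] at e₁ e₂
    exact e₁.symm.trans e₂
  have hα : Epi (colim.map α) := by
    constructor
    intro Z g h e
    refine colimit.hom_ext fun i => ?_
    rw [hι]
    rw [← cancel_epi (Sigma.desc k)]
    refine Sigma.hom_ext _ _ fun j => ?_
    have := congrArg (fun t => colimit.ι G j ≫ t) e
    simp only [colim_map, ι_colimMap_assoc, Functor.const_obj_obj] at this
    rw [hι X j] at this
    simpa [α] using this
  have hP := (IsPullback.of_hasPullback β α).map colim
  have hepi : Epi (colim.map (pullback.fst β α)) := by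
    rw [← hP.isoPullback_hom_fst]
    infer_instance
  constructor
  intro Z g h e
  let gg : ∀ t : Y ⟶ Z, colim.obj ((Functor.const w).obj Y) ⟶ Z := fun t =>
    colimit.desc ((Functor.const w).obj Y) ⟨Z, { app := fun _ => t, naturality := by simp }⟩
  have key : gg g = gg h := by
    rw [← cancel_epi (colim.map (pullback.fst β α))]
    refine colimit.hom_ext fun i => ?_
    have hi : pullback.fst f (k i) ≫ g = pullback.fst f (k i) ≫ h := by
      simpa using congrArg (fun t => Sigma.ι _ i ≫ t) e
    have hcond : (pullback.fst β α).app i ≫ f = (pullback.snd β α).app i ≫ k i := by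
      have := congrArg (fun t => NatTrans.app t i) (pullback.condition (f := β) (g := α))
      simpa [α, β] using this
    have := congrArg (fun t => pullback.lift _ _ hcond ≫ t) hi
    simp only [pullback.lift_fst_assoc] at this
    simpa [gg] using this
  have := congrArg (fun t => colimit.ι ((Functor.const w).obj Y) i₀ ≫ t) key
  simpa [gg] using this


/-- A monoidal category whose unit is an initial object. -/
class InitialUnit (M : Type v) [SmallCategory M] [MonoidalCategory M] where
  isInitial : IsInitial (𝟙_ M)

section

variable {M : Type v} [SmallCategory M] [MonoidalCategory M] [InitialUnit M]

/-- The unique morphism `0 ⟶ x`. -/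
def zeroTo (x : M) : 𝟙_ M ⟶ x := InitialUnit.isInitial.to x

lemma zeroTo_ext {x : M} (f g : 𝟙_ M ⟶ x) : f = g := InitialUnit.isInitial.hom_ext f g

/-- The natural morphism `z ≅ 0 ⊕ z ⟶ x ⊕ z`. -/
def incl (x z : M) : z ⟶ x ⊗ z := (λ_ z).inv ≫ zeroTo x ▷ z

lemma incl_naturality (x : M) {y z : M} (f : y ⟶ z) : f ≫ incl x z = incl x y ≫ x ◁ f := by
  simp only [incl, Category.assoc, ← whisker_exchange, leftUnitor_inv_naturality_assoc]

lemma incl_tensor_left (x y z : M) :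
    incl (x ⊗ y) z = incl y z ≫ incl x (y ⊗ z) ≫ (α_ x y z).inv := by
  have : zeroTo (x ⊗ y) = zeroTo y ≫ (λ_ y).inv ≫ zeroTo x ▷ y := zeroTo_ext _ _
  simp [incl, this]

lemma incl_tensor_right (x y z : M) :
    incl (x ⊗ y) z = incl x z ≫ x ◁ incl y z ≫ (α_ x y z).inv := by
  have : zeroTo (x ⊗ y) = zeroTo x ≫ (ρ_ x).inv ≫ x ◁ zeroTo y := zeroTo_ext _ _
  simp [incl, this]

lemma incl_swap [SymmetricCategory M] (x y z : M) :
    x ◁ incl y z ≫ (α_ x y z).inv ≫ (β_ x y).hom ▷ z ≫ (α_ y x z).hom = incl y (x ⊗ z) := by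
  have h₁ : x ◁ (zeroTo y ▷ z) ≫ (α_ x y z).inv = (α_ x (𝟙_ M) z).inv ≫ (x ◁ zeroTo y) ▷ z := by
    simp
  have h₂ : x ◁ zeroTo y ≫ (β_ x y).hom = (ρ_ x).hom ≫ (λ_ x).inv ≫ zeroTo y ▷ x := by
    rw [BraidedCategory.braiding_naturality_right, braiding_tensorUnit_right]
    simp
  rw [incl, whiskerLeft_comp, Category.assoc, reassoc_of% h₁, ← comp_whiskerRight_assoc, h₂]
  simp [incl]

end

variable (M : Type v) [SmallCategory M] [MonoidalCategory M]
variable (B : Type u) [Category.{v} B]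

/-- Translation by `x`: precomposition with `x ⊕ -`. -/
abbrev tau (x : M) : (M ⥤ B) ⥤ (M ⥤ B) :=
  (Functor.whiskeringLeft M M B).obj (tensorLeft x)

variable {M B} in
/-- The morphism `F = τ₀ F ⟶ τₓ F` induced by `0 ⟶ x`. -/
def iotaApp [InitialUnit M] (x : M) (F : M ⥤ B) : F ⟶ (tau M B x).obj F where
  app z := F.map (incl x z)
  naturality y z f := by
    change F.map f ≫ F.map (incl x z) = F.map (incl x y) ≫ F.map (x ◁ f)
    rw [← F.map_comp, ← F.map_comp, incl_naturality]

/-- The natural transformation `Id ⟶ τₓ`. -/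
def iota [InitialUnit M] (x : M) : 𝟭 (M ⥤ B) ⟶ tau M B x where
  app F := iotaApp x F
  naturality F G f := by
    ext z
    exact (f.naturality (incl x z)).symm

variable {M B} in
lemma comp_iota_eq_zero_iff [InitialUnit M] [HasZeroMorphisms B] (x : M) {K F : M ⥤ B}
    (k : K ⟶ F) :
    k ≫ iotaApp x F = 0 ↔ ∀ z, k.app z ≫ F.map (incl x z) = 0 :=
  ⟨fun h z => congrArg (fun t => NatTrans.app t z) h, fun h => by ext z; exact h z⟩

variable [InitialUnit M] [Abelian B] [IsGrothendieckAbelian.{v} B]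

variable {M B} in
/-- `κₓ(F)`, the kernel of `F ⟶ τₓ F`. -/
noncomputable abbrev kap (x : M) (F : M ⥤ B) : M ⥤ B := kernel (iotaApp x F)

variable {M B} in
/-- `κ(F)`, the sum of the subfunctors `κₓ(F)` of `F`. -/
noncomputable def kappa (F : M ⥤ B) : Subobject F :=
  imageSubobject (Sigma.desc fun x : M => kernel.ι (iotaApp x F))

/-- The stably null functors. -/
def stablyNull : ObjectProperty (M ⥤ B) := fun F => kappa F = ⊤

variable {M B}

lemma imageSubobject_eq_top_iff {C : Type*} [Category* C] [Abelian C] {X Y : C} (f : X ⟶ Y) :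
    imageSubobject f = ⊤ ↔ Epi f := by
  unfold imageSubobject
  rw [← Subobject.isIso_iff_mk_eq_top]
  constructor
  · intro h
    rw [← image.fac f]
    exact epi_comp _ _
  · intro h
    have := epi_image_of_epi f
    exact isIso_of_mono_of_epi _

lemma stablyNull_iff (F : M ⥤ B) :
    stablyNull M B F ↔ Epi (Sigma.desc fun x : M => kernel.ι (iotaApp x F)) :=
  imageSubobject_eq_top_iff _

/-- A family of morphisms is jointly epimorphic and each is killed by some `i_x`. -/
lemma stablyNull_of_family {F : M ⥤ B} {I : Type*} (K : I → (M ⥤ B)) (k : ∀ i, K i ⟶ F)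
    (h₁ : ∀ {Z : M ⥤ B} (g h : F ⟶ Z), (∀ i, k i ≫ g = k i ≫ h) → g = h)
    (h₂ : ∀ i, ∃ x : M, k i ≫ iotaApp x F = 0) : stablyNull M B F := by
  rw [stablyNull_iff]
  refine ⟨fun {Z} g h e => h₁ g h fun i => ?_⟩
  obtain ⟨x, hx⟩ := h₂ i
  have e' : kernel.ι (iotaApp x F) ≫ g = kernel.ι (iotaApp x F) ≫ h := by
    simpa using congrArg (fun t => Sigma.ι (fun x : M => kap x F) x ≫ t) e
  rw [← kernel.lift_ι _ _ hx, Category.assoc, Category.assoc, e']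

lemma stablyNull_ext {F Z : M ⥤ B} (hF : stablyNull M B F) (g h : F ⟶ Z)
    (e : ∀ x : M, kernel.ι (iotaApp x F) ≫ g = kernel.ι (iotaApp x F) ≫ h) :
    g = h := by
  rw [stablyNull_iff] at hF
  rw [← cancel_epi (Sigma.desc fun x : M => kernel.ι (iotaApp x F))]
  exact Sigma.hom_ext _ _ fun x => by simpa using e x

lemma directed (F : M ⥤ B) (x y : M) : ∃ l,
    (∃ a : kap x F ⟶ kap l F, a ≫ kernel.ι (iotaApp l F) = kernel.ι (iotaApp x F)) ∧
    (∃ b : kap y F ⟶ kap l F,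
      b ≫ kernel.ι (iotaApp l F) = kernel.ι (iotaApp y F)) := by
  refine ⟨x ⊗ y, ⟨kernel.lift _ (kernel.ι _) ?_, kernel.lift_ι _ _ _⟩,
    ⟨kernel.lift _ (kernel.ι _) ?_, kernel.lift_ι _ _ _⟩⟩
  · rw [comp_iota_eq_zero_iff]
    intro z
    have := (comp_iota_eq_zero_iff x _).1 (kernel.condition (iotaApp x F)) z
    rw [incl_tensor_right, F.map_comp, reassoc_of% this, zero_comp]
  · rw [comp_iota_eq_zero_iff]
    intro z
    have := (comp_iota_eq_zero_iff y _).1 (kernel.condition (iotaApp y F)) z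
    rw [incl_tensor_left, F.map_comp, reassoc_of% this, zero_comp]

/-- Refinement of a morphism to a stably null functor. -/
lemma refine_ext {G F Z : M ⥤ B} (hF : stablyNull M B F) (f : G ⟶ F) (g h : G ⟶ Z)
    (e : ∀ (x : M), kernel.ι (f ≫ iotaApp x F) ≫ g =
      kernel.ι (f ≫ iotaApp x F) ≫ h) : g = h := by
  rw [stablyNull_iff] at hF
  have : HasColimitsOfSize.{v, v} B := inferInstance
  have : AB5OfSize.{v, v} (M ⥤ B) := ⟨fun J _ _ => inferInstance⟩
  have : Nonempty M := ⟨𝟙_ M⟩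
  have := epi_sigma_pullback (fun x : M => kap x F) (fun x => kernel.ι (iotaApp x F))
    (directed F) hF f
  rw [← cancel_epi (Sigma.desc fun x : M => pullback.fst f (kernel.ι (iotaApp x F)))]
  refine Sigma.hom_ext _ _ fun x => ?_
  simp only [Sigma.ι_desc_assoc]
  have hx : pullback.fst f (kernel.ι (iotaApp x F)) ≫ f ≫ iotaApp x F = 0 := by
    rw [pullback.condition_assoc, kernel.condition, comp_zero]
  rw [← kernel.lift_ι _ _ hx, Category.assoc, Category.assoc, e]

variable [SymmetricCategory M]

/-- `τₓ(i_y) : τₓ F ⟶ τₓ τ_y F` and `i_y : τₓ F ⟶ τ_y τₓ F` agree up to the symmetry. -/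
lemma comp_tau_iota_eq_zero {x y : M} {K F : M ⥤ B} (k : K ⟶ (tau M B x).obj F)
    (h : k ≫ (tau M B x).map (iotaApp y F) = 0) : k ≫ iotaApp y ((tau M B x).obj F) = 0 := by
  rw [comp_iota_eq_zero_iff]
  intro z
  have h' : k.app z ≫ F.map (incl y (x ⊗ z)) = 0 := congrArg (fun t => NatTrans.app t z) h
  change k.app z ≫ F.map (x ◁ incl y z) = 0
  have e : x ◁ incl y z =
      incl y (x ⊗ z) ≫ (α_ y x z).inv ≫ (β_ x y).inv ▷ z ≫ (α_ x y z).hom := by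
    simp [← incl_swap]
  rw [e, F.map_comp, reassoc_of% h', zero_comp]

lemma stablyNull_tau (x : M) {F : M ⥤ B} (hF : stablyNull M B F) :
    stablyNull M B ((tau M B x).obj F) := by
  refine stablyNull_of_family (fun y : M => (tau M B x).obj (kap y F))
    (fun y => (tau M B x).map (kernel.ι (iotaApp y F))) ?_ fun y =>
      ⟨y, comp_tau_iota_eq_zero _ (by rw [← Functor.map_comp, kernel.condition, Functor.map_zero])⟩
  intro Z g h e
  rw [stablyNull_iff] at hF
  have := (tau M B x).map_epi (Sigma.desc fun y : M => kernel.ι (iotaApp y F))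
  rw [← cancel_epi ((tau M B x).map (Sigma.desc fun y : M => kernel.ι (iotaApp y F)))]
  refine Cofan.IsColimit.hom_ext (isColimitOfHasCoproductOfPreservesColimit (tau M B x)
    fun y : M => kap y F) _ _ fun y => ?_
  change (tau M B x).map (Sigma.ι (fun y : M => kap y F) y) ≫ _ =
    (tau M B x).map (Sigma.ι (fun y : M => kap y F) y) ≫ _
  simp only [← Functor.map_comp_assoc, Sigma.ι_desc]
  exact e y

instance : (stablyNull M B).IsSerreClass where
  exists_zero := ⟨_, isZero_zero (M ⥤ B), by
    rw [stablyNull_iff]; exact ⟨fun _ _ _ => (isZero_zero _).eq_of_src _ _⟩⟩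
  prop_of_mono {G F} f _ hF := by
    refine stablyNull_of_family (fun x : M => kernel (f ≫ iotaApp x F))
      (fun x => kernel.ι (f ≫ iotaApp x F)) (fun g h e => refine_ext hF f g h e)
      fun x => ⟨x, ?_⟩
    have := (tau M B x).map_mono f
    rw [← cancel_mono ((tau M B x).map f), zero_comp, Category.assoc]
    have e : iotaApp x G ≫ (tau M B x).map f = f ≫ iotaApp x F :=
      ((iota M B x).naturality f).symm
    rw [e, kernel.condition]
  prop_of_epi {F G} f _ hF := by
    refine stablyNull_of_family (fun x : M => kap x F)
      (fun x => kernel.ι (iotaApp x F) ≫ f) (fun g h e => ?_) fun x => ⟨x, ?_⟩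
    · rw [← cancel_epi f]
      exact stablyNull_ext hF _ _ (by simpa using e)
    · have e : iotaApp x F ≫ (tau M B x).map f = f ≫ iotaApp x G :=
        ((iota M B x).naturality f).symm
      rw [Category.assoc, ← e, kernel.condition_assoc, zero_comp]
  prop_X₂_of_shortExact {S} hS h₁ h₃ := by
    have := hS.mono_f
    have hS' : ∀ x : M, (S.map (tau M B x)).ShortExact := fun x => hS.map_of_exact (tau M B x)
    have hφ : ∀ x : M, ∃ φ : kernel (S.g ≫ iotaApp x S.X₃) ⟶ (tau M B x).obj S.X₁,
        φ ≫ (tau M B x).map S.f = kernel.ι (S.g ≫ iotaApp x S.X₃) ≫ iotaApp x S.X₂ := by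
      intro x
      have := (hS' x).mono_f
      refine ⟨(hS' x).exact.lift (kernel.ι (S.g ≫ iotaApp x S.X₃) ≫ iotaApp x S.X₂) ?_,
        (hS' x).exact.lift_f _ _⟩
      have e : iotaApp x S.X₂ ≫ (tau M B x).map S.g = S.g ≫ iotaApp x S.X₃ :=
        ((iota M B x).naturality S.g).symm
      change (_ ≫ _) ≫ (tau M B x).map S.g = 0
      rw [Category.assoc, e, kernel.condition]
    choose φ hφ using hφ
    refine stablyNull_of_family (I := M × M)
      (fun p => kernel (φ p.1 ≫ iotaApp p.2 _))
      (fun p => kernel.ι (φ p.1 ≫ iotaApp p.2 _) ≫ kernel.ι (S.g ≫ iotaApp p.1 S.X₃))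
      (fun g h e => ?_) fun p => ⟨p.1 ⊗ p.2, ?_⟩
    · refine refine_ext h₃ S.g g h fun x => ?_
      refine refine_ext (stablyNull_tau x h₁) (φ x) _ _ fun y => ?_
      simpa using e (x, y)
    · obtain ⟨x, y⟩ := p
      rw [comp_iota_eq_zero_iff]
      intro z
      have e₁ := congrArg (fun t => NatTrans.app t z) (hφ x)
      have e₂ : (kernel.ι (φ x ≫ iotaApp y _)).app z ≫ (φ x).app z ≫
          S.X₁.map (x ◁ incl y z) = 0 :=
        congrArg (fun t => NatTrans.app t z) (kernel.condition (φ x ≫ iotaApp y _))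
      have e₁' : (kernel.ι (S.g ≫ iotaApp x S.X₃)).app z ≫ S.X₂.map (incl x z) =
          (φ x).app z ≫ S.f.app (x ⊗ z) := e₁.symm
      have e₃ : S.f.app (x ⊗ z) ≫ S.X₂.map (x ◁ incl y z) =
          S.X₁.map (x ◁ incl y z) ≫ S.f.app (x ⊗ y ⊗ z) :=
        (S.f.naturality (x ◁ incl y z)).symm
      rw [incl_tensor_right, S.X₂.map_comp, S.X₂.map_comp, NatTrans.comp_app, Category.assoc, reassoc_of% e₁',
        reassoc_of% e₃, reassoc_of% e₂, zero_comp]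

lemma stablyNull_kap (x : M) (F : M ⥤ B) : stablyNull M B (kap x F) := by
  refine stablyNull_of_family (I := Unit) (fun _ => kap x F) (fun _ => 𝟙 _)
    (fun g h e => by simpa using e ()) fun _ => ⟨x, ?_⟩
  have := (tau M B x).map_mono (kernel.ι (iotaApp x F))
  have e : iotaApp x (kap x F) ≫ (tau M B x).map (kernel.ι (iotaApp x F)) =
      kernel.ι (iotaApp x F) ≫ iotaApp x F := ((iota M B x).naturality _).symm
  rw [← cancel_mono ((tau M B x).map (kernel.ι (iotaApp x F))), Category.id_comp, e,
    kernel.condition, zero_comp]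

variable (M B)

/-- The stable category `St(M, B)`: the quotient of `Fct(M, B)` by the stably null functors. -/
abbrev St := (stablyNull M B).isoModSerre.Localization

/-- The quotient functor `Fct(M, B) ⥤ St(M, B)`. -/
noncomputable abbrev toSt : (M ⥤ B) ⥤ St M B := (stablyNull M B).isoModSerre.Q

noncomputable instance : Abelian (St M B) :=
  ObjectProperty.SerreClassLocalization.abelian (toSt M B) (stablyNull M B)

lemma tau_inverts (x : M) : (stablyNull M B).isoModSerre.IsInvertedBy (tau M B x ⋙ toSt M B) := by
  intro F G f hf
  have h₁ : stablyNull M B (kernel ((tau M B x).map f)) :=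
    (stablyNull M B).prop_of_iso (PreservesKernel.iso (tau M B x) f)
      (stablyNull_tau x (F := kernel f) hf.1)
  have h₂ : stablyNull M B (cokernel ((tau M B x).map f)) :=
    (stablyNull M B).prop_of_iso (PreservesCokernel.iso (tau M B x) f)
      (stablyNull_tau x (F := cokernel f) hf.2)
  exact Localization.inverts (toSt M B) (stablyNull M B).isoModSerre ((tau M B x).map f) ⟨h₁, h₂⟩

/-- The endofunctor of `St(M, B)` induced by the translation `τₓ`. -/
noncomputable def stTau (x : M) : St M B ⥤ St M B :=
  Localization.lift (tau M B x ⋙ toSt M B) (tau_inverts M B x) (toSt M B)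

noncomputable instance stTauLifting (x : M) :
    Localization.Lifting (toSt M B) (stablyNull M B).isoModSerre
      (tau M B x ⋙ toSt M B) (stTau M B x) :=
  inferInstanceAs (Localization.Lifting _ _ _ (Localization.lift _ _ _))

/-- The natural transformation `Id ⟶ τₓ` of endofunctors of `St(M, B)` induced by `0 ⟶ x`. -/
noncomputable def stIota (x : M) : 𝟭 (St M B) ⟶ stTau M B x :=
  Localization.liftNatTrans (toSt M B) (stablyNull M B).isoModSerre (toSt M B)
    (tau M B x ⋙ toSt M B) (𝟭 _) (stTau M B x)
    (Functor.whiskerRight (iota M B x) (toSt M B))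

instance stTau_limits (x : M) : PreservesFiniteLimits (stTau M B x) := by
  have := ObjectProperty.SerreClassLocalization.preservesFiniteLimits (toSt M B) (stablyNull M B)
  rw [← ObjectProperty.SerreClassLocalization.preservesFiniteLimits_comp_iff (toSt M B)
    (stablyNull M B)]
  exact preservesFiniteLimits_of_natIso
    (Localization.Lifting.iso (toSt M B) (stablyNull M B).isoModSerre
      (tau M B x ⋙ toSt M B) (stTau M B x)).symm

instance stTau_colimits (x : M) : PreservesFiniteColimits (stTau M B x) := by
  have := ObjectProperty.SerreClassLocalization.preservesFiniteColimits (toSt M B) (stablyNull M B)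
  rw [← ObjectProperty.SerreClassLocalization.preservesFiniteColimits_comp_iff (toSt M B)
    (stablyNull M B)]
  exact preservesFiniteColimits_of_natIso
    (Localization.Lifting.iso (toSt M B) (stablyNull M B).isoModSerre
      (tau M B x ⋙ toSt M B) (stTau M B x)).symm

instance stIota_mono (x : M) (X : St M B) : Mono ((stIota M B x).app X) := by
  have := Localization.essSurj (toSt M B) (stablyNull M B).isoModSerre
  let e := (toSt M B).objObjPreimageIso X
  have hm : Mono ((toSt M B).map (iotaApp x ((toSt M B).objPreimage X))) := by
    rw [ObjectProperty.SerreClassLocalization.mono_map_iff (toSt M B) (stablyNull M B)]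
    exact stablyNull_kap x _
  have h : Mono ((stIota M B x).app ((toSt M B).obj ((toSt M B).objPreimage X))) := by
    rw [stIota, Localization.liftNatTrans_app]
    have : Mono ((Functor.whiskerRight (iota M B x) (toSt M B)).app
      ((toSt M B).objPreimage X)) := hm
    infer_instance
  exact mono_app_of_iso (stTau M B x) (stIota M B x) e h

/-- The difference functor `δₓ` of `St(M, B)`: the cokernel of `Id ⟶ τₓ`. -/
noncomputable abbrev stDelta (x : M) : St M B ⥤ St M B := diff (stTau M B x) (stIota M B x)

/-- The objects of `St(M, B)` that are polynomial of degree `< n`, that is, of degree `≤ n - 1`: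
only the zero objects for `n = 0`, and for `n + 1` the objects `X` such that every `δₓ(X)`
is polynomial of degree `< n`. -/
def polLT : ℕ → ObjectProperty (St M B)
  | 0 => fun X => IsZero X
  | n + 1 => fun X => ∀ x : M, polLT n ((stDelta M B x).obj X)

instance polLT_isSerreClass (n : ℕ) : (polLT M B n).IsSerreClass := by
  induction n with
  | zero => exact inferInstanceAs (ObjectProperty.IsSerreClass (IsZero (C := St M B)))
  | succ n ih =>
    have hδ : ∀ x : M, (stDelta M B x).PreservesZeroMorphisms := fun x => inferInstance
    exact
    { exists_zero := ⟨_, isZero_zero (St M B), fun x =>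
        (polLT M B n).prop_of_isZero ((stDelta M B x).map_isZero (isZero_zero _))⟩
      prop_of_mono := fun f _ h x => by
        have := diff_map_mono (stTau M B x) (stIota M B x) f
        exact (polLT M B n).prop_of_mono ((stDelta M B x).map f) (h x)
      prop_of_epi := fun f _ h x => by
        have := diff_map_epi (stTau M B x) (stIota M B x) f
        exact (polLT M B n).prop_of_epi ((stDelta M B x).map f) (h x)
      prop_X₂_of_shortExact := fun {S} hS h₁ h₃ x =>
        (polLT M B n).prop_X₂_of_shortExact (diff_shortExact (stTau M B x) (stIota M B x) hS
          (by rw [← Functor.map_comp, S.zero, Functor.map_zero])) (h₁ x) (h₃ x) }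

/-- `Pol_n(M, B)`: the full subcategory of `St(M, B)` of the polynomial objects of degree `≤ n`. -/
abbrev Pol (n : ℕ) := (polLT M B (n + 1)).FullSubcategory

/-- `Pol_{n-1}(M, B)` as a class of objects of `Pol_n(M, B)`. -/
abbrev polSub (n : ℕ) : ObjectProperty (Pol M B n) :=
  (polLT M B n).inverseImage (polLT M B (n + 1)).ι

/-- The quotient category `Pol_n(M, B) / Pol_{n-1}(M, B)`. -/
abbrev PolQuot (n : ℕ) := (polSub M B n).isoModSerre.Localization

/-- The quotient functor `Pol_n(M, B) ⥤ Pol_n(M, B) / Pol_{n-1}(M, B)`. -/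
noncomputable abbrev toPolQuot (n : ℕ) : Pol M B n ⥤ PolQuot M B n := (polSub M B n).isoModSerre.Q

lemma polLT_mono (n : ℕ) : polLT M B n ≤ polLT M B (n + 1) := by
  induction n with
  | zero => exact fun X hX x => (stDelta M B x).map_isZero hX
  | succ n ih => exact fun X hX x => ih _ (hX x)

end Stable

section Additive

variable {A : Type v} [SmallCategory A] [Preadditive A] [HasFiniteBiproducts A]

open ZeroObject in
/-- The (cartesian) monoidal structure of an additive category given by the direct sum,
with unit the zero object. -/
noncomputable instance (priority := low) additiveCartesian : CartesianMonoidalCategory A :=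
  letI : HasZeroObject A := hasZeroObject_of_hasFiniteBiproducts A
  letI : HasBinaryBiproducts A := hasBinaryBiproducts_of_finite_biproducts A
  CartesianMonoidalCategory.ofChosenFiniteProducts
    { cone := asEmptyCone (0 : A), isLimit := (isZero_zero A).isTerminal }
    fun X Y => { cone := BinaryBicone.toCone (BinaryBiproduct.bicone X Y)
                 isLimit := BinaryBiproduct.isLimit X Y }

noncomputable instance (priority := low) additiveBraided : BraidedCategory A :=
  .ofCartesianMonoidalCategory

lemma additive_unit_isZero : IsZero (𝟙_ A) := by
  have : HasZeroObject A := hasZeroObject_of_hasFiniteBiproducts A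
  exact (isZero_zero A).of_iso
    (SemiCartesianMonoidalCategory.isTerminalTensorUnit.uniqueUpToIso (isZero_zero A).isTerminal)

noncomputable instance additiveInitialUnit : InitialUnit A where
  isInitial := additive_unit_isZero.isInitial

variable (A) in
/-- A duality on an additive category `A`: a functor `D : Aᵒᵖ ⥤ A` with natural bijections
`σ : A(X, D Y) ≃ A(Y, D X)`, symmetric in `X` and `Y`, such that the unit `X ⟶ D (D X)`,
that is, the image under `σ` of the identity of `D X`, is an isomorphism. -/
structure Duality where
  D : Aᵒᵖ ⥤ A
  σ (X Y : A) : (X ⟶ D.obj (op Y)) ≃ (Y ⟶ D.obj (op X))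
  σ_naturality_left {X X' : A} (Y : A) (f : X' ⟶ X) (a : X ⟶ D.obj (op Y)) :
    σ X' Y (f ≫ a) = σ X Y a ≫ D.map f.op
  σ_naturality_right (X : A) {Y Y' : A} (g : Y' ⟶ Y) (a : X ⟶ D.obj (op Y)) :
    σ X Y' (a ≫ D.map g.op) = g ≫ σ X Y a
  σ_symm (X Y : A) : σ Y X = (σ X Y).symm
  isIso_unit (X : A) : IsIso (σ (D.obj (op X)) X (𝟙 (D.obj (op X))))

namespace Duality

variable (d : Duality A)

/-- The adjunction of `D` with itself. -/
def adj : d.D.rightOp ⊣ d.D :=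
  Adjunction.mkOfHomEquiv
    { homEquiv := fun X Y => (opEquiv _ _).trans (d.σ Y.unop X)
      homEquiv_naturality_left_symm := fun {X' X Y} f g => by
        apply Quiver.Hom.unop_inj
        change (d.σ Y.unop X').symm (f ≫ g) = (d.σ Y.unop X).symm g ≫ d.D.map f.op
        rw [← d.σ_symm, ← d.σ_symm]
        exact d.σ_naturality_left _ f g
      homEquiv_naturality_right := fun {X Y Y'} f g => by
        change d.σ Y'.unop X (g.unop ≫ f.unop) = d.σ Y.unop X f.unop ≫ d.D.map g
        exact d.σ_naturality_left _ g.unop f.unop }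

instance : d.D.IsRightAdjoint := d.adj.isRightAdjoint

instance : d.D.Additive :=
  have : PreservesLimitsOfSize.{0, 0} d.D := d.adj.rightAdjoint_preservesLimits
  Functor.additive_of_preserves_binary_products d.D

lemma D_map_add {X Y : A} (f g : X ⟶ Y) :
    d.D.map (f + g).op = d.D.map f.op + d.D.map g.op :=
  d.D.map_add (f := f.op) (g := g.op)

lemma σ_eq {X Y : A} (a : X ⟶ d.D.obj (op Y)) :
    d.σ X Y a = d.σ _ Y (𝟙 _) ≫ d.D.map a.op := by
  simpa using d.σ_naturality_left Y a (𝟙 _)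

lemma σ_add {X Y : A} (a b : X ⟶ d.D.obj (op Y)) : d.σ X Y (a + b) = d.σ X Y a + d.σ X Y b := by
  rw [σ_eq, σ_eq d a, σ_eq d b, D_map_add, Preadditive.comp_add]

/-- The functor `TD²`, which maps `X` to the group `A(X, D X)`. -/
def tensorSq : Aᵒᵖ ⥤ AddCommGrpCat.{v} where
  obj X := AddCommGrpCat.of (X.unop ⟶ d.D.obj X)
  map f := AddCommGrpCat.ofHom
    { toFun := fun a => f.unop ≫ a ≫ d.D.map f
      map_zero' := by simp
      map_add' := by simp }

/-- The involution `a ↦ ā` of `A(X, D X)`. -/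
def bar (X : A) : (X ⟶ d.D.obj (op X)) →+ (X ⟶ d.D.obj (op X)) :=
  AddMonoidHom.mk' (d.σ X X) (d.σ_add)

@[simp]
lemma bar_bar (X : A) (a : X ⟶ d.D.obj (op X)) : d.bar X (d.bar X a) = a := by
  have h := congrArg (fun e => e (d.σ X X a)) (d.σ_symm X X)
  exact h.trans ((d.σ X X).symm_apply_apply a)

lemma bar_map {X Y : A} (f : X ⟶ Y) (a : Y ⟶ d.D.obj (op Y)) :
    d.bar X (f ≫ a ≫ d.D.map f.op) = f ≫ d.bar Y a ≫ d.D.map f.op := by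
  change d.σ X X _ = f ≫ d.σ Y Y a ≫ _
  rw [d.σ_naturality_left, d.σ_naturality_right, Category.assoc]

variable (ε : ℤˣ)

/-- The norm `a ↦ a + ε ā`, as an endomorphism of `A(X, D X)`. -/
def norm (X : A) : (X ⟶ d.D.obj (op X)) →+ (X ⟶ d.D.obj (op X)) :=
  AddMonoidHom.id _ + (ε : ℤ) • d.bar X

lemma norm_apply (X : A) (a : X ⟶ d.D.obj (op X)) : d.norm ε X a = a + (ε : ℤ) • d.bar X a := rfl

lemma norm_map {X Y : A} (f : X ⟶ Y) (a : Y ⟶ d.D.obj (op Y)) :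
    d.norm ε X (f ≫ a ≫ d.D.map f.op) = f ≫ d.norm ε Y a ≫ d.D.map f.op := by
  simp [norm_apply, bar_map]

/-- The subgroup of `A(X, D X)` of the elements `ā - ε a`. -/
def relations (X : A) : AddSubgroup (X ⟶ d.D.obj (op X)) :=
  (d.bar X - (ε : ℤ) • AddMonoidHom.id _).range

lemma relations_le (X : A) : d.relations ε X ≤ (d.norm ε X).ker := by
  rintro _ ⟨a, rfl⟩
  obtain rfl | rfl := Int.units_eq_one_or ε
  · simp [AddMonoidHom.mem_ker, norm_apply]
  · simp [AddMonoidHom.mem_ker, norm_apply]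

lemma relations_map {X Y : A} (f : X ⟶ Y) :
    d.relations ε Y ≤ (d.relations ε X).comap (d.tensorSq.map f.op).hom := by
  rintro _ ⟨a, rfl⟩
  refine ⟨f ≫ a ≫ d.D.map f.op, ?_⟩
  change _ = f ≫ (d.bar Y a - (ε : ℤ) • a) ≫ d.D.map f.op
  change d.bar X (f ≫ a ≫ d.D.map f.op) - (ε : ℤ) • (f ≫ a ≫ d.D.map f.op) = _
  rw [bar_map]
  simp

/-- The functor `SD²_ε = (ℤ_ε ⊗_{ℤ/2} -) ∘ TD²`, which maps `X` to the quotient of `A(X, D X)`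
by the subgroup of the elements `ā - ε a`. -/
def symSq : Aᵒᵖ ⥤ AddCommGrpCat.{v} where
  obj X := AddCommGrpCat.of ((X.unop ⟶ d.D.obj X) ⧸ d.relations ε X.unop)
  map f := AddCommGrpCat.ofHom
    (QuotientAddGroup.map _ _ (d.tensorSq.map f).hom (d.relations_map ε f.unop))
  map_id X := by
    ext x
    change QuotientAddGroup.mk ((d.tensorSq.map (𝟙 X)).hom x) = QuotientAddGroup.mk x
    rw [d.tensorSq.map_id]
    rfl
  map_comp f g := by
    ext x
    change QuotientAddGroup.mk ((d.tensorSq.map (f ≫ g)).hom x) =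
      QuotientAddGroup.mk ((d.tensorSq.map g).hom ((d.tensorSq.map f).hom x))
    rw [d.tensorSq.map_comp]
    rfl

/-- The natural transformation `SD²_ε ⟶ TD²` given by the norm. -/
def symSqToTensorSq : d.symSq ε ⟶ d.tensorSq where
  app X := AddCommGrpCat.ofHom
    (QuotientAddGroup.lift (d.relations ε X.unop) (d.norm ε X.unop) (d.relations_le ε X.unop))
  naturality X Y f := by
    ext x
    obtain ⟨a, rfl⟩ := QuotientAddGroup.mk_surjective x
    exact d.norm_map ε f.unop a

lemma range_map {X Y : A} (f : X ⟶ Y) :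
    (d.norm ε Y).range ≤ ((d.norm ε X).range).comap (d.tensorSq.map f.op).hom := by
  rintro _ ⟨a, rfl⟩
  exact ⟨f ≫ a ≫ d.D.map f.op, d.norm_map ε f a⟩

/-- The functor `S̄D²_ε`, the image of the norm: it maps `X` to the subgroup of `A(X, D X)` of
the elements `a + ε ā`. -/
def normSq : Aᵒᵖ ⥤ AddCommGrpCat.{v} where
  obj X := AddCommGrpCat.of (d.norm ε X.unop).range
  map {X Y} f := AddCommGrpCat.ofHom
    (((d.tensorSq.map f).hom.comp (d.norm ε X.unop).range.subtype).codRestrict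
      (d.norm ε Y.unop).range fun a => d.range_map ε f.unop a.2)
  map_id X := by
    ext x
    change (d.tensorSq.map (𝟙 X)).hom x.1 = x.1
    rw [d.tensorSq.map_id]
    rfl
  map_comp f g := by
    ext x
    change (d.tensorSq.map (f ≫ g)).hom x.1 =
      (d.tensorSq.map g).hom ((d.tensorSq.map f).hom x.1)
    rw [d.tensorSq.map_comp]
    rfl

/-- The inclusion `S̄D²_ε ⟶ TD²`. -/
def normSqToTensorSq : d.normSq ε ⟶ d.tensorSq where
  app X := AddCommGrpCat.ofHom (d.norm ε X.unop).range.subtype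

end Duality

/-- The two kinds of functors of forms: `sym` stands for `SD²_ε` and `norm` for `S̄D²_ε`. -/
inductive FormKind
  | sym
  | norm

namespace Duality

variable (d : Duality A) (k : FormKind) (ε : ℤˣ)

/-- The functor of forms `T`, either `SD²_ε` or `S̄D²_ε`. -/
def forms : Aᵒᵖ ⥤ AddCommGrpCat.{v} :=
  match k with
  | .sym => d.symSq ε
  | .norm => d.normSq ε

/-- The natural transformation `T ⟶ TD²`. -/
def formsToTensorSq : d.forms k ε ⟶ d.tensorSq :=
  match k with
  | .sym => d.symSqToTensorSq ε
  | .norm => d.normSqToTensorSq ε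

/-- The morphism `X ⟶ D X` associated with a form `u ∈ T(X)`. -/
def toHom {X : A} (u : (d.forms k ε).obj (op X)) : X ⟶ d.D.obj (op X) :=
  ((d.formsToTensorSq k ε).app (op X)).hom u

lemma toHom_map {X Y : A} (f : X ⟶ Y) (u : (d.forms k ε).obj (op Y)) :
    d.toHom k ε ((d.forms k ε).map f.op u) = f ≫ d.toHom k ε u ≫ d.D.map f.op :=
  ConcreteCategory.congr_hom ((d.formsToTensorSq k ε).naturality f.op) u

lemma toHom_add {X : A} (u u' : (d.forms k ε).obj (op X)) :
    d.toHom k ε (u + u') = d.toHom k ε u + d.toHom k ε u' :=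
  map_add ((d.formsToTensorSq k ε).app (op X)).hom u u'

/-- The hermitian objects: an object `X` of `A` with a form `u ∈ T(X)` whose image in `A(X, D X)`
is invertible. -/
structure Herm where
  obj : A
  form : (d.forms k ε).obj (op obj)
  nondegenerate : IsIso (d.toHom k ε form)

variable {d k ε}

namespace Herm

/-- A morphism `(X, u) ⟶ (Y, v)` is a morphism `f : X ⟶ Y` such that `T(f)(v) = u`. -/
@[ext]
structure Hom (X Y : d.Herm k ε) where
  hom : X.obj ⟶ Y.obj
  map_form : (d.forms k ε).map hom.op Y.form = X.form

instance : SmallCategory (d.Herm k ε) where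
  Hom X Y := Hom X Y
  id X := ⟨𝟙 _, by simp⟩
  comp f g := ⟨f.hom ≫ g.hom, by simp [f.map_form, g.map_form]⟩

@[ext]
lemma hom_ext {X Y : d.Herm k ε} {f g : X ⟶ Y} (h : f.hom = g.hom) : f = g := Hom.ext h

@[simp] lemma id_hom (X : d.Herm k ε) : Hom.hom (𝟙 X) = 𝟙 X.obj := rfl

@[simp] lemma comp_hom {X Y Z : d.Herm k ε} (f : X ⟶ Y) (g : Y ⟶ Z) :
    (f ≫ g).hom = f.hom ≫ g.hom := rfl

variable (d k ε) in
/-- The forgetful functor `π^T : H(A) ⥤ A`. -/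
@[simps]
def forget : d.Herm k ε ⥤ A where
  obj X := X.obj
  map f := f.hom

instance : (forget d k ε).Faithful where
  map_injective h := hom_ext h

/-- Isomorphisms of hermitian objects. -/
@[simps]
def mkIso {X Y : d.Herm k ε} (e : X.obj ≅ Y.obj)
    (h : (d.forms k ε).map e.hom.op Y.form = X.form) : X ≅ Y where
  hom := ⟨e.hom, h⟩
  inv := ⟨e.inv, by
    rw [← h, ← ConcreteCategory.comp_apply, ← Functor.map_comp, ← op_comp, e.inv_hom_id]
    simp⟩
  hom_inv_id := by ext; simp
  inv_hom_id := by ext; simp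

open CartesianMonoidalCategory

/-- The image of `(u, v)` under the canonical morphism `T(X) ⊕ T(Y) ⟶ T(X ⊕ Y)`. -/
noncomputable def orthogonalForm {X Y : A} (u : (d.forms k ε).obj (op X))
    (v : (d.forms k ε).obj (op Y)) : (d.forms k ε).obj (op (X ⊗ Y)) :=
  (d.forms k ε).map (fst X Y).op u + (d.forms k ε).map (snd X Y).op v

lemma map_orthogonalForm {X Y Z : A} (f : Z ⟶ X ⊗ Y) (u : (d.forms k ε).obj (op X))
    (v : (d.forms k ε).obj (op Y)) :
    (d.forms k ε).map f.op (orthogonalForm u v) =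
      (d.forms k ε).map (f ≫ fst _ _).op u + (d.forms k ε).map (f ≫ snd _ _).op v := by
  simp [orthogonalForm]

lemma orthogonalForm_eq {X Y : A} (u : (d.forms k ε).obj (op X)) (v : (d.forms k ε).obj (op Y)) :
    orthogonalForm u v = (d.forms k ε).map (fst X Y).op u + (d.forms k ε).map (snd X Y).op v :=
  rfl

lemma map_map_op {X Y Z : A} (f : Z ⟶ X) (g : X ⟶ Y) (u : (d.forms k ε).obj (op Y)) :
    (d.forms k ε).map f.op ((d.forms k ε).map g.op u) = (d.forms k ε).map (f ≫ g).op u := by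
  simp

lemma orthogonal_isIso (X Y : d.Herm k ε) : IsIso (d.toHom k ε (orthogonalForm X.form Y.form)) := by
  have := X.nondegenerate
  have := Y.nondegenerate
  let i : X.obj ⟶ X.obj ⊗ Y.obj := lift (𝟙 _) 0
  let j : Y.obj ⟶ X.obj ⊗ Y.obj := lift 0 (𝟙 _)
  have i₁ : i ≫ fst _ _ = 𝟙 _ := lift_fst _ _
  have i₂ : i ≫ snd _ _ = 0 := lift_snd _ _
  have j₁ : j ≫ fst _ _ = 0 := lift_fst _ _
  have j₂ : j ≫ snd _ _ = 𝟙 _ := lift_snd _ _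
  have ht : fst X.obj Y.obj ≫ i + snd X.obj Y.obj ≫ j = 𝟙 _ := by
    apply CartesianMonoidalCategory.hom_ext <;> simp [i₁, i₂, j₁, j₂]
  have D₁ := congrArg (fun t => d.D.map t.op) i₁
  have D₂ := congrArg (fun t => d.D.map t.op) i₂
  have D₃ := congrArg (fun t => d.D.map t.op) j₁
  have D₄ := congrArg (fun t => d.D.map t.op) j₂
  have D₅ := congrArg (fun t => d.D.map t.op) ht
  simp only [D_map_add, op_comp, Functor.map_comp, op_id, op_zero,
    Functor.map_zero] at D₁ D₂ D₃ D₄ D₅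
  rw [orthogonalForm, toHom_add, toHom_map, toHom_map]
  refine ⟨d.D.map i.op ≫ inv (d.toHom k ε X.form) ≫ i + d.D.map j.op ≫
    inv (d.toHom k ε Y.form) ≫ j, ?_, ?_⟩
  · simp [reassoc_of% D₁, reassoc_of% D₂, reassoc_of% D₃, reassoc_of% D₄, ht]
  · simp [reassoc_of% i₁, reassoc_of% i₂, reassoc_of% j₁, reassoc_of% j₂, D₅]

lemma isIso_of_isZero {X : A} (h : IsZero X) (u : (d.forms k ε).obj (op X)) :
    IsIso (d.toHom k ε u) := by
  have h' : IsZero (d.D.obj (op X)) := d.D.map_isZero h.op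
  exact h.isIso h' _

instance forms_unit_subsingleton : Subsingleton ((d.forms k ε).obj (op (𝟙_ A))) := by
  have h : Subsingleton (𝟙_ A ⟶ d.D.obj (op (𝟙_ A))) :=
    ⟨fun _ _ => additive_unit_isZero.eq_of_src _ _⟩
  cases k
  · exact (QuotientAddGroup.mk_surjective (s := d.relations ε (𝟙_ A))).subsingleton
  · exact inferInstanceAs (Subsingleton (d.norm ε (𝟙_ A)).range)

/-- The monoidal structure on hermitian objects given by the orthogonal sum, with unit `(0, 0)`. -/
noncomputable instance : MonoidalCategoryStruct (d.Herm k ε) where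
  tensorObj X Y := ⟨X.obj ⊗ Y.obj, orthogonalForm X.form Y.form, orthogonal_isIso X Y⟩
  tensorUnit := ⟨𝟙_ A, 0, isIso_of_isZero additive_unit_isZero 0⟩
  tensorHom f g := ⟨f.hom ⊗ₘ g.hom, by
    dsimp only
    rw [map_orthogonalForm, orthogonalForm_eq, ← f.map_form, ← g.map_form, map_map_op, map_map_op,
      tensorHom_fst, tensorHom_snd]⟩
  whiskerLeft X _ _ f := ⟨X.obj ◁ f.hom, by
    dsimp only
    rw [map_orthogonalForm, orthogonalForm_eq, ← f.map_form, map_map_op, whiskerLeft_fst,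
      whiskerLeft_snd]⟩
  whiskerRight f Y := ⟨f.hom ▷ Y.obj, by
    dsimp only
    rw [map_orthogonalForm, orthogonalForm_eq, ← f.map_form, map_map_op, whiskerRight_fst,
      whiskerRight_snd]⟩
  associator X Y Z := mkIso (α_ X.obj Y.obj Z.obj) (by
    dsimp only
    rw [map_orthogonalForm, map_orthogonalForm, orthogonalForm_eq, orthogonalForm_eq, map_add,
      map_map_op, map_map_op, Category.assoc, Category.assoc, associator_hom_fst, associator_hom_snd_fst,
      associator_hom_snd_snd, add_assoc])
  leftUnitor X := mkIso (λ_ X.obj) (by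
    change (d.forms k ε).map (λ_ X.obj).hom.op X.form =
      orthogonalForm (0 : (d.forms k ε).obj (op (𝟙_ A))) X.form
    rw [orthogonalForm_eq, map_zero, zero_add, leftUnitor_hom])
  rightUnitor X := mkIso (ρ_ X.obj) (by
    change (d.forms k ε).map (ρ_ X.obj).hom.op X.form =
      orthogonalForm X.form (0 : (d.forms k ε).obj (op (𝟙_ A)))
    rw [orthogonalForm_eq, map_zero, add_zero, rightUnitor_hom])

variable (d k ε) in
/-- The forgetful functor is strictly compatible with the monoidal structures. -/
noncomputable def inducingData : Monoidal.InducingFunctorData (forget d k ε) where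
  μIso X Y := Iso.refl (X.obj ⊗ Y.obj)
  εIso := Iso.refl (𝟙_ A)
  whiskerLeft_eq X _ _ f := by
    change X.obj ◁ f.hom = 𝟙 _ ≫ X.obj ◁ f.hom ≫ 𝟙 _
    simp
  whiskerRight_eq f Y := by
    change f.hom ▷ Y.obj = 𝟙 _ ≫ f.hom ▷ Y.obj ≫ 𝟙 _
    simp
  tensorHom_eq f g := by
    change (f.hom ⊗ₘ g.hom) = 𝟙 _ ≫ (f.hom ⊗ₘ g.hom) ≫ 𝟙 _
    simp
  associator_eq X Y Z := by
    change (α_ X.obj Y.obj Z.obj).hom = (𝟙 _ ≫ (𝟙 (X.obj ⊗ Y.obj) ⊗ₘ 𝟙 Z.obj)) ≫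
      (α_ X.obj Y.obj Z.obj).hom ≫ (𝟙 X.obj ⊗ₘ 𝟙 (Y.obj ⊗ Z.obj)) ≫ 𝟙 _
    simp
  leftUnitor_eq X := by
    change (λ_ X.obj).hom = (𝟙 _ ≫ (𝟙 (𝟙_ A) ⊗ₘ 𝟙 X.obj)) ≫ (λ_ X.obj).hom
    simp
  rightUnitor_eq X := by
    change (ρ_ X.obj).hom = (𝟙 _ ≫ (𝟙 X.obj ⊗ₘ 𝟙 (𝟙_ A))) ≫ (ρ_ X.obj).hom
    simp

noncomputable instance : MonoidalCategory (d.Herm k ε) :=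
  Monoidal.induced (forget d k ε) (inducingData d k ε)

noncomputable instance : (forget d k ε).Monoidal :=
  Monoidal.fromInducedMonoidal (forget d k ε) (inducingData d k ε)

/-- The symmetry of the orthogonal sum. -/
noncomputable def braid (X Y : d.Herm k ε) : X ⊗ Y ≅ Y ⊗ X :=
  mkIso (β_ X.obj Y.obj) (by
    change (d.forms k ε).map (β_ X.obj Y.obj).hom.op (orthogonalForm Y.form X.form) =
      orthogonalForm X.form Y.form
    rw [map_orthogonalForm, orthogonalForm, braiding_hom_fst, braiding_hom_snd, add_comm])

lemma forget_μ (X Y : d.Herm k ε) :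
    Functor.LaxMonoidal.μ (forget d k ε) X Y = 𝟙 (X.obj ⊗ Y.obj) := rfl

noncomputable instance : BraidedCategory (d.Herm k ε) :=
  BraidedCategory.ofFaithful (forget d k ε) braid (fun X Y => by
    rw [forget_μ, forget_μ]
    exact (Category.id_comp _).trans (Category.comp_id _).symm)

noncomputable instance : (forget d k ε).Braided where
  braided X Y := by
    rw [forget_μ, forget_μ]
    exact (Category.id_comp _).trans (Category.comp_id _).symm

noncomputable instance : SymmetricCategory (d.Herm k ε) :=
  SymmetricCategory.ofFaithful (forget d k ε)

noncomputable instance : InitialUnit (d.Herm k ε) where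
  isInitial := IsInitial.ofUniqueHom
    (fun _ => ⟨additive_unit_isZero.to_ _, (forms_unit_subsingleton (d := d) (k := k) (ε := ε)).elim _ _⟩)
    (fun _ _ => hom_ext (additive_unit_isZero.eq_of_src _ _))

end Herm

end Duality
end Additive
end StablePol

set_option linter.unusedSectionVars false

namespace StablePol

/-! ### Serre classes and exactness of cokernels of `Id ⟶ T`. -/

section SerreGeneral

variable {C : Type*} [Category* C] [Abelian C] {D : Type*} [Category* D] [Abelian D]

/-! The comparison functor `polQuotRes` is exact and reflects zero objects. By
`isEquivalence_of_exact` it is enough to find functors I on A such that, in the quotient categories,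
all morphisms to π^*I come from A, and every object embeds into some I (over A) or some π^*I (over
H(A)). These are the functors of `IsNice`. Such an I has degree ≤ n. Its restriction is local for
the isomorphisms modulo degree < n, so that morphisms to it in the quotient are genuine natural
transformations. It is also rigid: a morphism π^*G ⟶ π^*I with G of degree ≤ n is natural for all
the morphisms of A.

Two facts about hermitian objects carry the argument. Since T is a quotient of TD², every morphism x
⟶ y of A is the first component of a morphism x ⟶ y ⊕ t of H(A), with t hyperbolic (`exists_lift`).
And x ⟶ x ⊕ x ⊕ x⁻ (`diag`), where x⁻ carries the opposite form, replaces the missing diagonal.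

Let F have degree ≤ n + 1 and let K be local for the isomorphisms modulo degree < n. The cokernel of
δ_t F ⟶ δ_{y⊕t} F is τ_t δ_y F, which agrees with δ_y F modulo degree < n. So y ↦ Hom(δ_y F, K)
turns orthogonal sums into products (`extends_delta`). A morphism x ⟶ y ⊕ t then acts by pull-back
Hom(δ_y F, K) ⟶ Hom(δ_x F, K), and by means of `diag` this depends only on the first component
(`pull_congr`). Hence A itself acts, additively (`Extends.act`, `act_add`).

Nice functors are built by induction on n. In degree 0 they are the constants. If J(a, b) is
additive in a and each J(a, -) is nice of degree ≤ n, the diagonal of J is nice of degree ≤ n + 1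
(`isNice_diagonal`): a morphism F ⟶ π^*(diagonal J) is recovered from the family δ_x F ⟶ π^*J(x, -)
of its polarizations, which reduces each property to degree n.

Embeddings are built by the same induction. In degree 0, F/κ(F) is a directed system of
monomorphisms in which parallel arrows coincide, and it embeds into the constant functor at its
colimit. For the step, take θ : δ_y F ⟶ π^*I with kernel of degree < n. The action of A turns θ into
a family δ_x F ⟶ π^*Hom(A(x, y), I), hence into a morphism from F to the restriction of a diagonal.
The kernel N of the resulting morphism to the product over all y has every δ_y N of degree < n
(`exists_embedding_succ`). -/

lemma isoModSerre_inverseImage_iff (F : C ⥤ D) [PreservesFiniteLimits F] [PreservesFiniteColimits F]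
    (P : ObjectProperty D) [P.IsSerreClass] {X Y : C} (f : X ⟶ Y) :
    (P.inverseImage F).isoModSerre f ↔ P.isoModSerre (F.map f) := by
  have : F.Additive := F.additive_of_preserves_binary_products
  rw [ObjectProperty.isoModSerre_iff, ObjectProperty.isoModSerre_iff]
  exact and_congr (P.prop_iff_of_iso (PreservesKernel.iso F f))
    (P.prop_iff_of_iso (PreservesCokernel.iso F f))

lemma isoModSerre_mono {P Q : ObjectProperty C} [P.IsSerreClass] [Q.IsSerreClass] (h : P ≤ Q) {X Y : C}
    {f : X ⟶ Y} (hf : P.isoModSerre f) : Q.isoModSerre f :=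
  ⟨h _ hf.1, h _ hf.2⟩

/-- The projection `T X ⟶ coker (X ⟶ T X)`. -/
noncomputable def diffπ (T : C ⥤ C) (ι : 𝟭 C ⟶ T) (X : C) : T.obj X ⟶ (diff T ι).obj X :=
  cokernel.π (ι.app X)

instance (T : C ⥤ C) (ι : 𝟭 C ⟶ T) (X : C) : Epi (diffπ T ι X) :=
  inferInstanceAs (Epi (cokernel.π _))

lemma diff_condition (T : C ⥤ C) (ι : 𝟭 C ⟶ T) (X : C) : ι.app X ≫ diffπ T ι X = 0 :=
  cokernel.condition _

lemma diffπ_naturality (T : C ⥤ C) (ι : 𝟭 C ⟶ T) {X Y : C} (f : X ⟶ Y) :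
    diffπ T ι X ≫ (diff T ι).map f = T.map f ≫ diffπ T ι Y :=
  π_diff_map T ι f

instance diff_additive (T : C ⥤ C) (ι : 𝟭 C ⟶ T) [T.Additive] : (diff T ι).Additive where
  map_add {X Y f g} := by
    rw [← cancel_epi (diffπ T ι X), Preadditive.comp_add, diffπ_naturality, diffπ_naturality,
      diffπ_naturality, T.map_add, Preadditive.add_comp]

lemma diff_exact (T : C ⥤ C) (ι : 𝟭 C ⟶ T) [PreservesFiniteLimits T] [PreservesFiniteColimits T]
    [∀ X, Mono (ι.app X)] :
    PreservesFiniteLimits (diff T ι) ∧ PreservesFiniteColimits (diff T ι) := by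
  have : T.Additive := Functor.additive_of_preserves_binary_products T
  have h := (Functor.exact_tfae (diff T ι)).out 0 3
  rw [← h]
  intro S hS
  exact diff_shortExact T ι hS _

end SerreGeneral

/-! ### Degree of functors before passing to the stable category. -/

section Difference

variable {M : Type v} [SmallCategory M] [MonoidalCategory M] [InitialUnit M] [SymmetricCategory M]
  {B : Type u} [Category.{v} B] [Abelian B] [IsGrothendieckAbelian.{v} B]

/-- The difference functor on `Fct(M, B)`. -/
noncomputable abbrev delta (x : M) : (M ⥤ B) ⥤ (M ⥤ B) := diff (tau M B x) (iota M B x)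

/-- The projection `τₓ F ⟶ δₓ F`. -/
noncomputable def deltaπ (x : M) (F : M ⥤ B) : (tau M B x).obj F ⟶ (delta x).obj F :=
  diffπ _ _ F

instance (x : M) (F : M ⥤ B) : Epi (deltaπ x F) := inferInstanceAs (Epi (diffπ _ _ _))

lemma iotaApp_deltaπ (x : M) (F : M ⥤ B) : iotaApp x F ≫ deltaπ x F = 0 :=
  diff_condition (tau M B x) (iota M B x) F

lemma deltaπ_naturality (x : M) {F G : M ⥤ B} (f : F ⟶ G) :
    deltaπ x F ≫ (delta x).map f = (tau M B x).map f ≫ deltaπ x G := diffπ_naturality _ _ f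

instance toSt_limits : PreservesFiniteLimits (toSt M B) :=
  ObjectProperty.SerreClassLocalization.preservesFiniteLimits (toSt M B) (stablyNull M B)

instance toSt_colimits : PreservesFiniteColimits (toSt M B) :=
  ObjectProperty.SerreClassLocalization.preservesFiniteColimits (toSt M B) (stablyNull M B)

instance stDelta_limits (x : M) : PreservesFiniteLimits (stDelta M B x) :=
  (diff_exact (stTau M B x) (stIota M B x)).1

instance stDelta_colimits (x : M) : PreservesFiniteColimits (stDelta M B x) :=
  (diff_exact (stTau M B x) (stIota M B x)).2

variable (M B) in
/-- The functors whose image in `St(M, B)` is polynomial of degree `< n`. -/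
abbrev degLT (n : ℕ) : ObjectProperty (M ⥤ B) := (polLT M B n).inverseImage (toSt M B)

variable (M B) in
/-- The isomorphisms modulo functors of degree `< n`. -/
abbrev degIso (n : ℕ) : MorphismProperty (M ⥤ B) := (degLT M B n).isoModSerre

lemma degLT_zero_iff (F : M ⥤ B) : degLT M B 0 F ↔ stablyNull M B F :=
  ObjectProperty.SerreClassLocalization.isZero_obj_iff (toSt M B) (stablyNull M B) F

/-- The difference functors of `St(M, B)` are induced by those of `Fct(M, B)`. -/
noncomputable def stDeltaIsoApp (x : M) (F : M ⥤ B) :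
    (stDelta M B x).obj ((toSt M B).obj F) ≅ (toSt M B).obj ((delta x).obj F) :=
  cokernel.mapIso ((stIota M B x).app ((toSt M B).obj F)) ((toSt M B).map ((iota M B x).app F))
    (Iso.refl _) ((Localization.Lifting.iso (toSt M B) (stablyNull M B).isoModSerre
      (tau M B x ⋙ toSt M B) (stTau M B x)).app F) (by simp [stIota]) ≪≫
    (PreservesCokernel.iso (toSt M B) ((iota M B x).app F)).symm

lemma diffπ_stDeltaIsoApp (x : M) (F : M ⥤ B) :
    diffπ (stTau M B x) (stIota M B x) ((toSt M B).obj F) ≫ (stDeltaIsoApp x F).hom =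
      (Localization.Lifting.iso (toSt M B) (stablyNull M B).isoModSerre
      (tau M B x ⋙ toSt M B) (stTau M B x)).hom.app F ≫ (toSt M B).map (deltaπ x F) := by
  have h := PreservesCokernel.π_iso_hom (toSt M B) ((iota M B x).app F)
  rw [← Iso.eq_comp_inv] at h
  dsimp only [stDeltaIsoApp, Iso.trans_hom, Iso.symm_hom, diffπ, cokernel.mapIso, deltaπ]
  erw [cokernel.π_desc_assoc, h, Category.assoc]
  rfl

lemma stDeltaIsoApp_naturality (x : M) {F G : M ⥤ B} (f : F ⟶ G) :
    (stDelta M B x).map ((toSt M B).map f) ≫ (stDeltaIsoApp x G).hom =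
      (stDeltaIsoApp x F).hom ≫ (toSt M B).map ((delta x).map f) := by
  rw [← cancel_epi (diffπ (stTau M B x) (stIota M B x) ((toSt M B).obj F)),
    reassoc_of% diffπ_naturality (stTau M B x) (stIota M B x) ((toSt M B).map f),
    diffπ_stDeltaIsoApp, reassoc_of% diffπ_stDeltaIsoApp x F, ← Functor.map_comp,
    deltaπ_naturality, Functor.map_comp]
  exact (Localization.Lifting.iso (toSt M B) (stablyNull M B).isoModSerre
      (tau M B x ⋙ toSt M B) (stTau M B x)).hom.naturality_assoc f _

lemma degLT_succ_iff (n : ℕ) (F : M ⥤ B) :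
    degLT M B (n + 1) F ↔ ∀ x : M, degLT M B n ((delta x).obj F) :=
  forall_congr' fun x => (polLT M B n).prop_iff_of_iso (stDeltaIsoApp x F)

/-- On the stable category δₓ is exact and lowers the degree by one. -/
lemma degIso_delta (n : ℕ) (x : M) {F G : M ⥤ B} {f : F ⟶ G} (h : degIso M B (n + 1) f) :
    degIso M B n ((delta x).map f) := by
  rw [degIso, isoModSerre_inverseImage_iff] at h ⊢
  have h' : ((polLT M B n).inverseImage (stDelta M B x)).isoModSerre ((toSt M B).map f) :=
    isoModSerre_mono (fun X hX => hX x) h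
  rw [isoModSerre_inverseImage_iff] at h'
  refine ((polLT M B n).isoModSerre.arrow_mk_iso_iff
    (Arrow.isoMk (stDeltaIsoApp x F) (stDeltaIsoApp x G) ?_)).1 h'
  exact (stDeltaIsoApp_naturality x f).symm

lemma degLT_mono (n : ℕ) : degLT M B n ≤ degLT M B (n + 1) := fun _ h => polLT_mono M B n _ h

lemma degLT_of_stablyNull (n : ℕ) {F : M ⥤ B} (h : stablyNull M B F) : degLT M B n F := by
  induction n with
  | zero => rwa [degLT_zero_iff]
  | succ n ih => exact degLT_mono n _ ih

/-- The kernel κₓ(F) is stably null for every F, and the cokernel is δₓ F. The index is shifted: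
`degLT (n + 1)` means degree ≤ n. -/
lemma degIso_iotaApp (n : ℕ) (x : M) {F : M ⥤ B} (h : degLT M B (n + 1) F) :
    degIso M B n (iotaApp x F) :=
  ⟨degLT_of_stablyNull n (stablyNull_kap x F), (degLT_succ_iff n F).1 h x⟩

lemma degLT_delta_mono (n : ℕ) (x : M) {F : M ⥤ B} (h : degLT M B n F) :
    degLT M B n ((delta x).obj F) := by
  cases n with
  | zero =>
    have := (degLT_succ_iff 0 F).1 (degLT_mono 0 F h) x
    exact this
  | succ n => exact degLT_mono n _ ((degLT_succ_iff n F).1 h x)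

lemma degLT_tau (n : ℕ) (x : M) {F : M ⥤ B} (h : degLT M B n F) :
    degLT M B n ((tau M B x).obj F) := by
  have e : (ShortComplex.mk (iotaApp x F) (deltaπ x F) (iotaApp_deltaπ x F)).Exact :=
    ShortComplex.exact_cokernel _
  exact (degLT M B n).prop_X₂_of_exact e h (degLT_delta_mono n x h)

end Difference
-- Hyperbolic objects, lifts, and retractions up to a summand.
section Forms

variable {A : Type v} [SmallCategory A] [Preadditive A] [HasFiniteBiproducts A]

namespace Duality

open CartesianMonoidalCategory

variable (d : Duality A) (k : FormKind) (ε : ℤˣ)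

/-- The form defined by an element of `A(X, D X)`. -/
def formOf (X : A) : (X ⟶ d.D.obj (op X)) →+ (d.forms k ε).obj (op X) :=
  match k with
  | .sym => QuotientAddGroup.mk' (d.relations ε X)
  | .norm => (d.norm ε X).rangeRestrict

lemma formOf_surjective (X : A) : Function.Surjective (d.formOf k ε X) := by
  cases k
  · exact QuotientAddGroup.mk'_surjective _
  · exact AddMonoidHom.rangeRestrict_surjective _

lemma map_formOf {X Y : A} (f : X ⟶ Y) (a : Y ⟶ d.D.obj (op Y)) :
    (d.forms k ε).map f.op (d.formOf k ε Y a) = d.formOf k ε X (f ≫ a ≫ d.D.map f.op) := by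
  cases k
  · rfl
  · exact Subtype.ext (d.norm_map ε f a).symm

lemma toHom_formOf (X : A) (a : X ⟶ d.D.obj (op X)) :
    d.toHom k ε (d.formOf k ε X a) = d.norm ε X a := by
  cases k <;> rfl

/-- Together with `formOf_surjective`, `map_formOf` and `toHom_formOf`, this is all that the sequel
uses about T; the two choices of T are not distinguished after this point. -/
lemma formOf_bar (X : A) (a : X ⟶ d.D.obj (op X)) :
    d.formOf k ε X (d.bar X a) = (ε : ℤ) • d.formOf k ε X a := by
  cases k
  · rw [← map_zsmul, ← sub_eq_zero, ← map_sub]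
    exact (QuotientAddGroup.eq_zero_iff _).2 ⟨a, rfl⟩
  · rw [← map_zsmul]
    apply Subtype.ext
    change d.norm ε X _ = d.norm ε X _
    obtain rfl | rfl := Int.units_eq_one_or ε <;> simp [norm_apply, add_comm]

lemma bar_bilinear {X Y : A} (f g : X ⟶ Y) (a : Y ⟶ d.D.obj (op Y)) :
    d.bar X (f ≫ a ≫ d.D.map g.op) = g ≫ d.bar Y a ≫ d.D.map f.op := by
  change d.σ X X _ = g ≫ d.σ Y Y a ≫ _
  rw [d.σ_naturality_left, d.σ_naturality_right, Category.assoc]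

/-- Forms are additive on orthogonal morphisms. -/
lemma map_add_of_orthogonal {X Y : A} (f g : X ⟶ Y) (u : (d.forms k ε).obj (op Y))
    (h : f ≫ d.toHom k ε u ≫ d.D.map g.op = 0) :
    (d.forms k ε).map (f + g).op u = (d.forms k ε).map f.op u + (d.forms k ε).map g.op u := by
  obtain ⟨a, rfl⟩ := d.formOf_surjective k ε Y u
  -- The cross terms of the form at f + g. The second one is the conjugate of f ā D(g), so
  -- `formOf_bar` turns their sum into the form of f (a + ε ā) D(g), which vanishes by
  -- orthogonality.
  have e : d.formOf k ε X (f ≫ a ≫ d.D.map g.op) + d.formOf k ε X (g ≫ a ≫ d.D.map f.op) = 0 := by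
    have h' : g ≫ a ≫ d.D.map f.op = d.bar X (f ≫ d.bar Y a ≫ d.D.map g.op) := by
      rw [bar_bilinear, bar_bar]
    rw [h', formOf_bar, ← map_zsmul, ← map_add]
    rw [toHom_formOf, norm_apply] at h
    convert map_zero (d.formOf k ε X)
    simpa using h
  rw [map_formOf, map_formOf, map_formOf, ← add_zero (d.formOf k ε X (f ≫ _) + _), ← e, D_map_add,
    ← map_add, ← map_add, ← map_add]
  congr 1
  simp only [Preadditive.add_comp, Preadditive.comp_add]
  abel

/-- The tautological bilinear form on `X ⊕ D X`. -/
noncomputable def hypForm (X : A) : X ⊗ d.D.obj (op X) ⟶ d.D.obj (op (X ⊗ d.D.obj (op X))) :=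
  snd _ _ ≫ d.D.map (fst X (d.D.obj (op X))).op

lemma bar_hypForm (X : A) : d.bar _ (d.hypForm X) =
    fst _ _ ≫ d.σ (d.D.obj (op X)) X (𝟙 _) ≫ d.D.map (snd X (d.D.obj (op X))).op := by
  change d.σ _ _ (snd _ _ ≫ d.D.map (fst X (d.D.obj (op X))).op) = _
  rw [d.σ_naturality_right, ← d.σ_naturality_left, Category.comp_id]

/-- On X ⊕ D X the norm is antidiagonal, with entries the identity of D X and ε times the unit X ⟶
D² X. The latter is invertible by the definition of a duality. -/
lemma isIso_norm_hypForm (X : A) : IsIso (d.norm ε _ (d.hypForm X)) := by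
  have := d.isIso_unit X
  rw [norm_apply, bar_hypForm, hypForm]
  let i : X ⟶ X ⊗ d.D.obj (op X) := lift (𝟙 _) 0
  let j : d.D.obj (op X) ⟶ X ⊗ d.D.obj (op X) := lift 0 (𝟙 _)
  have i₁ : i ≫ fst _ _ = 𝟙 _ := lift_fst _ _
  have i₂ : i ≫ snd _ _ = 0 := lift_snd _ _
  have j₁ : j ≫ fst _ _ = 0 := lift_fst _ _
  have j₂ : j ≫ snd _ _ = 𝟙 _ := lift_snd _ _
  have ht : fst X (d.D.obj (op X)) ≫ i + snd X (d.D.obj (op X)) ≫ j = 𝟙 _ := by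
    apply CartesianMonoidalCategory.hom_ext <;> simp [i₁, i₂, j₁, j₂]
  have D₁ := congrArg (fun t => d.D.map t.op) i₁
  have D₂ := congrArg (fun t => d.D.map t.op) i₂
  have D₃ := congrArg (fun t => d.D.map t.op) j₁
  have D₄ := congrArg (fun t => d.D.map t.op) j₂
  have D₅ := congrArg (fun t => d.D.map t.op) ht
  simp only [D_map_add, op_comp, Functor.map_comp, op_id, op_zero,
    Functor.map_zero] at D₁ D₂ D₃ D₄ D₅
  refine ⟨d.D.map i.op ≫ j + (ε : ℤ) • d.D.map j.op ≫ inv (d.σ (d.D.obj (op X)) X (𝟙 _)) ≫ i,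
    ?_, ?_⟩
  · obtain rfl | rfl := Int.units_eq_one_or ε <;>
    simp [reassoc_of% D₁, reassoc_of% D₂, reassoc_of% D₃, reassoc_of% D₄, ← ht, add_comm]
  · obtain rfl | rfl := Int.units_eq_one_or ε <;>
    simp [reassoc_of% i₁, reassoc_of% i₂, reassoc_of% j₁, reassoc_of% j₂, add_comm] <;>
    exact D₅.trans (d.D.map_id _)

namespace Herm

variable {d k ε}

lemma map_lift_orthogonalForm {X Y Z : A} (f : Z ⟶ X) (g : Z ⟶ Y) (u : (d.forms k ε).obj (op X))
    (v : (d.forms k ε).obj (op Y)) :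
    (d.forms k ε).map (lift f g).op (orthogonalForm u v) =
      (d.forms k ε).map f.op u + (d.forms k ε).map g.op v := by
  rw [map_orthogonalForm, lift_fst, lift_snd]

/-- A morphism to an orthogonal sum from its components. -/
noncomputable def liftHom {x y z : d.Herm k ε} (f : x.obj ⟶ y.obj) (g : x.obj ⟶ z.obj)
    (h : (d.forms k ε).map f.op y.form + (d.forms k ε).map g.op z.form = x.form) : x ⟶ y ⊗ z :=
  ⟨lift f g, (map_lift_orthogonalForm f g y.form z.form).trans h⟩

/-- The graph of a in X ⊕ D X carries the form of a. Hence every form on X, degenerate or not, is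
restricted from a hyperbolic object. -/
lemma map_lift_hypForm {X : A} (a : X ⟶ d.D.obj (op X)) :
    (d.forms k ε).map (lift (𝟙 _) a).op (d.formOf k ε _ (d.hypForm X)) = d.formOf k ε _ a := by
  have h : d.D.map (fst X (d.D.obj (op X))).op ≫ d.D.map (lift (𝟙 _) a).op = 𝟙 _ := by
    rw [← Functor.map_comp, ← op_comp, lift_fst, op_id, CategoryTheory.Functor.map_id]
  rw [map_formOf, hypForm, Category.assoc, lift_snd_assoc, h, Category.comp_id]

variable (d k ε) in
/-- The hyperbolic object `X ⊕ D X`. -/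
noncomputable def hyperbolic (X : A) : d.Herm k ε where
  obj := X ⊗ d.D.obj (op X)
  form := d.formOf k ε _ (d.hypForm X)
  nondegenerate := by rw [toHom_formOf]; exact d.isIso_norm_hypForm ε X

/-- Every morphism of `A` lifts to a morphism of hermitian objects, up to a summand. -/
lemma exists_lift {x y : d.Herm k ε} (f : x.obj ⟶ y.obj) :
    ∃ (t : d.Herm k ε) (g : x ⟶ y ⊗ t), g.hom ≫ fst y.obj t.obj = f := by
  obtain ⟨a, ha⟩ := d.formOf_surjective k ε _ (x.form - (d.forms k ε).map f.op y.form)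
  -- The second component is the graph of a, chosen to supply the defect between the form of x and
  -- the form pulled back from y.
  refine ⟨hyperbolic d k ε x.obj, liftHom f (lift (𝟙 _) a) ?_, lift_fst _ _⟩
  refine (congrArg _ (map_lift_hypForm a)).trans ?_
  rw [ha]
  abel

lemma toHom_neg {X : A} (u : (d.forms k ε).obj (op X)) : d.toHom k ε (-u) = -d.toHom k ε u :=
  map_neg ((d.formsToTensorSq k ε).app (op X)).hom u

variable (d k ε) in
/-- The hermitian object with the opposite form. -/
def neg : d.Herm k ε ⥤ d.Herm k ε where
  obj x :=
    { obj := x.obj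
      form := -x.form
      nondegenerate := by
        have := x.nondegenerate
        rw [toHom_neg]
        exact ⟨-inv (d.toHom k ε x.form), by simp, by simp⟩ }
  map f := ⟨f.hom, by rw [map_neg, f.map_form]⟩

/-- The morphism `x ⟶ x ⊕ x ⊕ x⁻` with components the identity. -/
noncomputable def diag (x : d.Herm k ε) : x ⟶ x ⊗ (x ⊗ (neg d k ε).obj x) :=
  -- The plain diagonal x ⟶ x ⊕ x would double the form; the third summand cancels the second.
  liftHom (𝟙 x.obj) (lift (𝟙 x.obj) (𝟙 x.obj)) (by
    refine (congrArg _ (map_lift_orthogonalForm (𝟙 x.obj) (𝟙 x.obj) x.form (-x.form))).trans ?_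
    simp)

lemma diag_hom (x : d.Herm k ε) : (diag x).hom = lift (𝟙 x.obj) (lift (𝟙 x.obj) (𝟙 x.obj)) := rfl

lemma diag_naturality {x y : d.Herm k ε} (f : x ⟶ y) :
    f ≫ diag y = diag x ≫ (f ⊗ₘ (f ⊗ₘ (neg d k ε).map f)) := by
  apply hom_ext
  change f.hom ≫ lift (𝟙 y.obj) (lift (𝟙 y.obj) (𝟙 y.obj)) =
    lift (𝟙 x.obj) (lift (𝟙 x.obj) (𝟙 x.obj)) ≫ (f.hom ⊗ₘ (f.hom ⊗ₘ f.hom))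
  simp

/-- The adjoint of a morphism of hermitian objects. -/
noncomputable def adjoint {x y : d.Herm k ε} (g : x ⟶ y) : y.obj ⟶ x.obj :=
  have := x.nondegenerate
  d.toHom k ε y.form ≫ d.D.map g.hom.op ≫ inv (d.toHom k ε x.form)

lemma hom_adjoint {x y : d.Herm k ε} (g : x ⟶ y) : g.hom ≫ adjoint g = 𝟙 _ := by
  have := x.nondegenerate
  rw [adjoint, ← Category.assoc, ← Category.assoc, IsIso.comp_inv_eq, Category.id_comp,
    Category.assoc, ← toHom_map, g.map_form]

lemma adjoint_toHom {x y : d.Herm k ε} (g : x ⟶ y) :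
    adjoint g ≫ d.toHom k ε x.form = d.toHom k ε y.form ≫ d.D.map g.hom.op := by
  simp [adjoint]

/-- A retraction of a morphism of hermitian objects, up to a summand. -/
noncomputable def retraction {x y : d.Herm k ε} (g : x ⟶ y) : y ⟶ x ⊗ y :=
  -- The endomorphism `adjoint g ≫ g.hom` of y is the orthogonal projection onto x. The complement
  -- of x need not exist as an object because idempotents need not split, so the complementary
  -- projection is taken with values in y.
  liftHom (adjoint g) (𝟙 _ - adjoint g ≫ g.hom) (by
    rw [← g.map_form, map_map_op, add_comm,
      ← map_add_of_orthogonal]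
    · simp
    · have h : d.toHom k ε y.form ≫ d.D.map (adjoint g ≫ g.hom).op =
        adjoint g ≫ d.toHom k ε x.form ≫ d.D.map (adjoint g).op := by
        rw [op_comp, Functor.map_comp, ← Category.assoc, ← adjoint_toHom, Category.assoc]
      rw [h, ← Category.assoc]
      simp [hom_adjoint])

/-- Every morphism of H(A) becomes, after composition with a suitable morphism, the inclusion of an
orthogonal summand. This makes restriction along it surjective in `pull_diag` and monic in
`mono_map_of_mono_iotaApp`. -/
lemma hom_retraction {x y : d.Herm k ε} (g : x ⟶ y) :
    (g ≫ retraction g).hom = lift (𝟙 _) 0 := by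
  change g.hom ≫ lift _ _ = _
  apply CartesianMonoidalCategory.hom_ext <;> simp [hom_adjoint, reassoc_of% hom_adjoint]

end Herm
end Duality
end Forms
-- From an additive behaviour on H(A) to an action of A.
section LeftInclusion

variable {M : Type v} [SmallCategory M] [MonoidalCategory M] [InitialUnit M]

/-- The morphism `x ⟶ x ⊕ y`. -/
def inclLeft (x y : M) : x ⟶ x ⊗ y := (ρ_ x).inv ≫ x ◁ zeroTo y

end LeftInclusion

section Extension

variable {A : Type v} [SmallCategory A] [Preadditive A] [HasFiniteBiproducts A]

open CartesianMonoidalCategory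

lemma additive_incl (x y : A) : incl x y = lift 0 (𝟙 y) := by
  apply CartesianMonoidalCategory.hom_ext
  · rw [lift_fst, incl, Category.assoc, whiskerRight_fst]
    have h : zeroTo x = 0 := zeroTo_ext _ _
    rw [h, comp_zero, comp_zero]
  · simp [incl]

namespace Duality
namespace Herm

variable {d : Duality A} {k : FormKind} {ε : ℤˣ}

@[simp] lemma tensor_obj (x y : d.Herm k ε) : (x ⊗ y).obj = x.obj ⊗ y.obj := rfl

@[simp] lemma neg_obj (x : d.Herm k ε) : ((neg d k ε).obj x).obj = x.obj := rfl

@[simp] lemma whiskerLeft_hom (x : d.Herm k ε) {y z : d.Herm k ε} (f : y ⟶ z) :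
    (x ◁ f).hom = x.obj ◁ f.hom := rfl

@[simp] lemma whiskerRight_hom {y z : d.Herm k ε} (f : y ⟶ z) (x : d.Herm k ε) :
    (f ▷ x).hom = f.hom ▷ x.obj := rfl

@[simp] lemma associator_hom_hom (x y z : d.Herm k ε) :
    (α_ x y z).hom.hom = (α_ x.obj y.obj z.obj).hom := rfl

@[simp] lemma associator_inv_hom (x y z : d.Herm k ε) :
    (α_ x y z).inv.hom = (α_ x.obj y.obj z.obj).inv := rfl

@[simp] lemma braiding_hom_hom (x y : d.Herm k ε) : (β_ x y).hom.hom = (β_ x.obj y.obj).hom := rfl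

lemma zeroTo_hom (x : d.Herm k ε) : (zeroTo x).hom = 0 := additive_unit_isZero.eq_of_src _ _

@[simp] lemma incl_hom (x y : d.Herm k ε) : (incl x y).hom = lift 0 (𝟙 y.obj) := by
  rw [← additive_incl]
  change (λ_ y.obj).inv ≫ (zeroTo x).hom ▷ y.obj = (λ_ y.obj).inv ≫ zeroTo x.obj ▷ y.obj
  congr 2

@[simp] lemma inclLeft_hom (x y : d.Herm k ε) : (inclLeft x y).hom = lift (𝟙 x.obj) 0 := by
  change (ρ_ x.obj).inv ≫ x.obj ◁ (zeroTo y).hom = _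
  rw [zeroTo_hom]
  apply CartesianMonoidalCategory.hom_ext
  · simp
  · simp

attribute [simp] diag_hom

lemma inclLeft_whiskerLeft (x : d.Herm k ε) {y z : d.Herm k ε} (f : y ⟶ z) :
    inclLeft x y ≫ x ◁ f = inclLeft x z := by
  apply hom_ext
  apply CartesianMonoidalCategory.hom_ext <;> simp

lemma inclLeft_whiskerRight {x y : d.Herm k ε} (f : x ⟶ y) (z : d.Herm k ε) :
    inclLeft x z ≫ f ▷ z = f ≫ inclLeft y z := by
  apply hom_ext
  apply CartesianMonoidalCategory.hom_ext <;> simp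

lemma incl_whiskerRight {x y : d.Herm k ε} (f : x ⟶ y) (z : d.Herm k ε) :
    incl x z ≫ f ▷ z = incl y z := by
  apply hom_ext
  apply CartesianMonoidalCategory.hom_ext <;> simp

lemma inclLeft_braiding (x y : d.Herm k ε) : inclLeft x y ≫ (β_ x y).hom = incl y x := by
  apply hom_ext
  apply CartesianMonoidalCategory.hom_ext <;> simp

lemma incl_braiding (x y : d.Herm k ε) : incl x y ≫ (β_ x y).hom = inclLeft y x := by
  apply hom_ext
  apply CartesianMonoidalCategory.hom_ext <;> simp

/-- A functor `E` on hermitian objects such that every morphism `E(y) ⟶ K` extends uniquely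
to a morphism `E(y ⊕ t) ⟶ K` which vanishes on `E(t)`. -/
structure Extends {C : Type*} [Category* C] [Preadditive C] (E : d.Herm k ε ⥤ C) (K : C) : Prop where
  eq_zero {y t : d.Herm k ε} (u : E.obj (y ⊗ t) ⟶ K) (h₁ : E.map (inclLeft y t) ≫ u = 0)
    (h₂ : E.map (incl y t) ≫ u = 0) : u = 0
  exists_extension {y : d.Herm k ε} (θ : E.obj y ⟶ K) (t : d.Herm k ε) :
    ∃ u : E.obj (y ⊗ t) ⟶ K, E.map (inclLeft y t) ≫ u = θ ∧ E.map (incl y t) ≫ u = 0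

namespace Extends

variable {C : Type*} [Category* C] [Preadditive C] {E : d.Herm k ε ⥤ C} {K : C} (h : Extends E K)

include h in
lemma ext {y t : d.Herm k ε} {u v : E.obj (y ⊗ t) ⟶ K}
    (h₁ : E.map (inclLeft y t) ≫ u = E.map (inclLeft y t) ≫ v)
    (h₂ : E.map (incl y t) ≫ u = E.map (incl y t) ≫ v) : u = v := by
  rw [← sub_eq_zero]
  apply h.eq_zero
  · rw [Preadditive.comp_sub, h₁, sub_self]
  · rw [Preadditive.comp_sub, h₂, sub_self]

/-- The extension of `θ : E(y) ⟶ K` to `E(y ⊕ t)` by zero. -/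
noncomputable def extension {y : d.Herm k ε} (θ : E.obj y ⟶ K) (t : d.Herm k ε) :
    E.obj (y ⊗ t) ⟶ K := (h.exists_extension θ t).choose

lemma inclLeft_extension {y : d.Herm k ε} (θ : E.obj y ⟶ K) (t : d.Herm k ε) :
    E.map (inclLeft y t) ≫ h.extension θ t = θ := (h.exists_extension θ t).choose_spec.1

lemma incl_extension {y : d.Herm k ε} (θ : E.obj y ⟶ K) (t : d.Herm k ε) :
    E.map (incl y t) ≫ h.extension θ t = 0 := (h.exists_extension θ t).choose_spec.2

/-- The pull-back of `θ : E(y) ⟶ K` along a morphism `x ⟶ y ⊕ t`, regarded as a morphism `x ⟶ y`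
up to a summand. -/
noncomputable def pull {x y t : d.Herm k ε} (g : x ⟶ y ⊗ t) (θ : E.obj y ⟶ K) : E.obj x ⟶ K :=
  E.map g ≫ h.extension θ t

lemma map_comp_pull {x' x y t : d.Herm k ε} (f : x' ⟶ x) (g : x ⟶ y ⊗ t) (θ : E.obj y ⟶ K) :
    E.map f ≫ h.pull g θ = h.pull (f ≫ g) θ := by
  rw [pull, pull, E.map_comp, Category.assoc]

lemma pull_add {x y t : d.Herm k ε} (g : x ⟶ y ⊗ t) (θ θ' : E.obj y ⟶ K) :
    h.pull g (θ + θ') = h.pull g θ + h.pull g θ' := by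
  rw [pull, pull, pull, ← Preadditive.comp_add]
  congr 1
  apply h.ext <;> simp only [Preadditive.comp_add, inclLeft_extension, incl_extension, add_zero]

/-- Extensions by zero are compatible with changes of the auxiliary summand, since they have the
same restrictions to y and to that summand. The later identities between pull-backs are obtained by
finding such a change. -/
lemma pull_whiskerLeft {x y t t' : d.Herm k ε} (g : x ⟶ y ⊗ t) (s : t ⟶ t') (θ : E.obj y ⟶ K) :
    h.pull (g ≫ y ◁ s) θ = h.pull g θ := by
  rw [pull, pull, E.map_comp, Category.assoc]
  congr 1
  apply h.ext
  · rw [← E.map_comp_assoc, inclLeft_whiskerLeft, inclLeft_extension, inclLeft_extension]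
  · rw [← E.map_comp_assoc, ← incl_naturality, E.map_comp_assoc, incl_extension, incl_extension,
      comp_zero]

lemma pull_eq_of_whiskerLeft {x y t t' : d.Herm k ε} (g : x ⟶ y ⊗ t) (g' : x ⟶ y ⊗ t') (s : t ⟶ t')
    (e : g ≫ y ◁ s = g') (θ : E.obj y ⟶ K) : h.pull g' θ = h.pull g θ := by
  rw [← e, pull_whiskerLeft]

/-- Extending by zero over t and then over t' is extending by zero over t ⊕ t', by uniqueness of
extensions. -/
lemma pull_pull {x x' y t t' : d.Herm k ε} (g : x ⟶ y ⊗ t) (g' : x' ⟶ x ⊗ t') (θ : E.obj y ⟶ K) :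
    h.pull g' (h.pull g θ) = h.pull (g' ≫ g ▷ t' ≫ (α_ y t t').hom) θ := by
  have e₁ : h.extension (h.pull g θ) t' = E.map (g ▷ t') ≫ h.extension (h.extension θ t) t' := by
    apply h.ext
    · rw [inclLeft_extension, ← E.map_comp_assoc, inclLeft_whiskerRight, E.map_comp_assoc,
        inclLeft_extension, pull]
    · rw [incl_extension, ← E.map_comp_assoc, incl_whiskerRight, incl_extension]
  have e₂ : h.extension (h.extension θ t) t' =
      E.map (α_ y t t').hom ≫ h.extension θ (t ⊗ t') := by
    apply h.ext
    · have : inclLeft (y ⊗ t) t' ≫ (α_ y t t').hom = y ◁ inclLeft t t' := by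
        apply hom_ext
        refine CartesianMonoidalCategory.hom_ext _ _ ?_
          (CartesianMonoidalCategory.hom_ext _ _ ?_ ?_) <;> simp
      rw [inclLeft_extension, ← E.map_comp_assoc, this]
      have := h.pull_whiskerLeft (𝟙 _) (inclLeft t t') θ
      rw [Category.id_comp] at this
      exact (this.trans (by simp [pull])).symm
    · have : incl (y ⊗ t) t' ≫ (α_ y t t').hom = incl t t' ≫ incl y (t ⊗ t') := by
        apply hom_ext
        refine CartesianMonoidalCategory.hom_ext _ _ ?_
          (CartesianMonoidalCategory.hom_ext _ _ ?_ ?_) <;> simp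
      rw [incl_extension, ← E.map_comp_assoc, this, E.map_comp_assoc, incl_extension, comp_zero]
  rw [pull, e₁, e₂, pull, E.map_comp, E.map_comp, Category.assoc, Category.assoc]

/-- The iterated diagonal arises from the diagonal by a morphism of the auxiliary summand. So the
pull-back along `diag x` is idempotent. -/
lemma pull_diag_pull_diag (x : d.Herm k ε) (θ : E.obj x ⟶ K) :
    h.pull (diag x) (h.pull (diag x) θ) = h.pull (diag x) θ := by
  rw [pull_pull]
  refine h.pull_eq_of_whiskerLeft _ _
    (diag x ▷ _ ≫ (α_ _ _ _).hom ≫ x ◁ (β_ _ _).hom ≫ (α_ _ _ _).inv) ?_ θ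
  apply hom_ext
  apply CartesianMonoidalCategory.hom_ext <;> simp

lemma eq_add {y t : d.Herm k ε} (u : E.obj (y ⊗ t) ⟶ K) :
    u = h.extension (E.map (inclLeft y t) ≫ u) t +
      E.map (β_ y t).hom ≫ h.extension (E.map (incl y t) ≫ u) y := by
  apply h.ext
  · rw [Preadditive.comp_add, inclLeft_extension, ← E.map_comp_assoc, inclLeft_braiding,
      incl_extension, add_zero]
  · rw [Preadditive.comp_add, incl_extension, ← E.map_comp_assoc, incl_braiding,
      inclLeft_extension, zero_add]

/-- The pull-back along the diagonal morphism is the identity. -/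
lemma pull_diag (x : d.Herm k ε) (θ : E.obj x ⟶ K) : h.pull (diag x) θ = θ := by
  -- An idempotent fixes its image, so only surjectivity remains.
  suffices ∃ ξ : E.obj x ⟶ K, θ = h.pull (diag x) ξ by
    obtain ⟨ξ, rfl⟩ := this
    exact h.pull_diag_pull_diag x ξ
  let x' := (neg d k ε).obj x
  -- Since `diag x` has a retraction up to a summand, θ extends along it to some u. The three
  -- components of u are then shown to contribute pull-backs along `diag x`.
  let u : E.obj (x ⊗ (x ⊗ x')) ⟶ K := E.map (retraction (diag x)) ≫ h.extension θ _
  have hu : E.map (diag x) ≫ u = θ := by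
    have : diag x ≫ retraction (diag x) = inclLeft _ _ := by
      apply hom_ext
      rw [hom_retraction, inclLeft_hom]
    rw [← E.map_comp_assoc, this, inclLeft_extension]
  let v : E.obj (x ⊗ x') ⟶ K := E.map (incl x (x ⊗ x')) ≫ u
  let ξ₁ : E.obj x ⟶ K := E.map (inclLeft x (x ⊗ x')) ≫ u
  let ξ₂ : E.obj x ⟶ K := E.map (inclLeft x x') ≫ v
  let ξ₃ : E.obj x' ⟶ K := E.map (incl x x') ≫ v
  have hu' : u = h.extension ξ₁ _ + E.map (β_ _ _).hom ≫ h.extension v _ := h.eq_add u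
  have hv : v = h.pull (𝟙 _) ξ₂ + h.pull (β_ _ _).hom ξ₃ := by
    rw [pull, E.map_id, Category.id_comp]
    exact h.eq_add v
  -- The first two summands of `diag x` are both copies of x and may be exchanged.
  have h₁ : h.pull (diag x ≫ (β_ _ _).hom) (h.pull (𝟙 _) ξ₂) = h.pull (diag x) ξ₂ := by
    rw [pull_pull]
    refine h.pull_eq_of_whiskerLeft _ _ (β_ _ _).hom ?_ ξ₂
    apply hom_ext
    apply CartesianMonoidalCategory.hom_ext <;> simp
  -- The contribution of x⁻ is fixed by the idempotent: one more diagonal only alters the auxiliary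
  -- summand.
  have h₂ : h.pull (diag x ≫ (β_ _ _).hom) (h.pull (β_ x x').hom ξ₃) =
      h.pull (diag x) (h.pull (diag x ≫ (β_ _ _).hom) (h.pull (β_ x x').hom ξ₃)) := by
    rw [pull_pull, pull_pull]
    symm
    refine h.pull_eq_of_whiskerLeft _ _ (x ◁ diag x ≫ (α_ _ _ _).inv) ?_ ξ₃
    apply hom_ext
    apply CartesianMonoidalCategory.hom_ext <;> simp [x']
  refine ⟨ξ₁ + ξ₂ + h.pull (diag x ≫ (β_ _ _).hom) (h.pull (β_ x x').hom ξ₃), ?_⟩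
  rw [pull_add, pull_add, ← h₂, ← h₁, add_assoc, ← pull_add, ← hv, ← hu, hu',
    Preadditive.comp_add, ← E.map_comp_assoc]
  rfl

/-- The pull-back along `g : x ⟶ y ⊕ t` only depends on the first component of `g`. -/
lemma pull_congr {x y t t' : d.Herm k ε} (g : x ⟶ y ⊗ t) (g' : x ⟶ y ⊗ t')
    (e : g.hom ≫ fst y.obj t.obj = g'.hom ≫ fst y.obj t'.obj) (θ : E.obj y ⟶ K) :
    h.pull g θ = h.pull g' θ := by
  let x' := (neg d k ε).obj x
  -- Permutation of summands which exchanges t and t'.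
  let s : t ⊗ ((y ⊗ t') ⊗ x') ⟶ t' ⊗ ((y ⊗ t) ⊗ x') :=
    (α_ _ _ _).inv ≫ ((β_ _ _).hom ≫ (α_ _ _ _).hom ≫ y ◁ (β_ _ _).hom ≫ (α_ _ _ _).inv ≫
      (β_ _ _).hom) ▷ x' ≫ (α_ _ _ _).hom
  -- By `pull_diag` there is a spare copy of x. Apply g to the first copy and g' to the second, or
  -- the other way round: up to the permutation s the results differ only in which of the two first
  -- components comes first, and these are equal.
  rw [← h.pull_diag x (h.pull g θ), ← h.pull_diag x (h.pull g' θ), pull_pull, pull_pull,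
    ← h.pull_whiskerLeft (diag x ≫ g ▷ _ ≫ _) (t ◁ (g' ▷ x') ≫ s),
    ← h.pull_whiskerLeft (diag x ≫ g' ▷ _ ≫ _) (t' ◁ (g ▷ x'))]
  congr 1
  apply hom_ext
  refine CartesianMonoidalCategory.hom_ext _ _ ?_ (CartesianMonoidalCategory.hom_ext _ _ ?_
    (CartesianMonoidalCategory.hom_ext _ _ (CartesianMonoidalCategory.hom_ext _ _ ?_ ?_) ?_)) <;>
  simp [s, e, x']

/-- The action of the morphisms of `A` on the morphisms `E(y) ⟶ K`. -/
noncomputable def act {x y : d.Herm k ε} (f : x.obj ⟶ y.obj) (θ : E.obj y ⟶ K) : E.obj x ⟶ K :=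
  h.pull (exists_lift f).choose_spec.choose θ

lemma act_eq {x y t : d.Herm k ε} (f : x.obj ⟶ y.obj) (g : x ⟶ y ⊗ t)
    (e : g.hom ≫ fst y.obj t.obj = f) (θ : E.obj y ⟶ K) : h.act f θ = h.pull g θ :=
  h.pull_congr _ _ ((exists_lift f).choose_spec.choose_spec.trans e.symm) θ

lemma act_hom {x y : d.Herm k ε} (f : x ⟶ y) (θ : E.obj y ⟶ K) : h.act f.hom θ = E.map f ≫ θ := by
  rw [h.act_eq f.hom (f ≫ inclLeft y y) (by simp), ← map_comp_pull, pull, inclLeft_extension]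

lemma act_id {x : d.Herm k ε} (θ : E.obj x ⟶ K) : h.act (𝟙 x.obj) θ = θ := by
  rw [← id_hom, act_hom, E.map_id, Category.id_comp]

lemma map_comp_act {x' x y : d.Herm k ε} (f : x' ⟶ x) (g : x.obj ⟶ y.obj) (θ : E.obj y ⟶ K) :
    E.map f ≫ h.act g θ = h.act (f.hom ≫ g) θ := by
  obtain ⟨t, g', hg⟩ := exists_lift g
  rw [h.act_eq g g' hg, h.act_eq (f.hom ≫ g) (f ≫ g') (by simp [hg]), map_comp_pull]

lemma act_act {x' x y : d.Herm k ε} (f : x'.obj ⟶ x.obj) (g : x.obj ⟶ y.obj) (θ : E.obj y ⟶ K) :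
    h.act f (h.act g θ) = h.act (f ≫ g) θ := by
  obtain ⟨t, g', rfl⟩ := exists_lift g
  obtain ⟨t', f', rfl⟩ := exists_lift f
  rw [h.act_eq _ g' rfl, h.act_eq _ f' rfl, pull_pull]
  exact (h.act_eq _ _ (by simp) θ).symm

lemma act_add_right {x y : d.Herm k ε} (f : x.obj ⟶ y.obj) (θ θ' : E.obj y ⟶ K) :
    h.act f (θ + θ') = h.act f θ + h.act f θ' := h.pull_add _ _ _

lemma act_zero {x y : d.Herm k ε} (θ : E.obj y ⟶ K) : h.act (0 : x.obj ⟶ y.obj) θ = 0 := by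
  rw [h.act_eq 0 (incl y x) (by simp), pull, incl_extension]

/-- The action is additive. -/
lemma act_add {x y : d.Herm k ε} (f g : x.obj ⟶ y.obj) (θ : E.obj y ⟶ K) :
    h.act (f + g) θ = h.act f θ + h.act g θ := by
  -- The codiagonal, a morphism of A. It reduces additivity to the two projections of y ⊕ y, which
  -- can be tested on the two summands by uniqueness of extensions.
  let c : (y ⊗ y).obj ⟶ y.obj := fst y.obj y.obj + snd y.obj y.obj
  have e : f + g = (lift f g : x.obj ⟶ y.obj ⊗ y.obj) ≫ c := by
    simp [c]
  have hc : h.act c θ = h.act (fst y.obj y.obj) θ + h.act (snd y.obj y.obj) θ := by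
    apply h.ext
    · rw [Preadditive.comp_add, h.map_comp_act (x := y ⊗ y) _ c,
        h.map_comp_act (x := y ⊗ y) _ (fst y.obj y.obj),
        h.map_comp_act (x := y ⊗ y) _ (snd y.obj y.obj)]
      simp [c, act_zero]
    · rw [Preadditive.comp_add, h.map_comp_act (x := y ⊗ y) _ c,
        h.map_comp_act (x := y ⊗ y) _ (fst y.obj y.obj),
        h.map_comp_act (x := y ⊗ y) _ (snd y.obj y.obj)]
      simp [c, act_zero]
  rw [e]
  refine (h.act_act (x := y ⊗ y) (lift f g) c θ).symm.trans ?_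
  rw [hc, act_add_right]
  refine congrArg₂ _ ((h.act_act (x := y ⊗ y) _ _ θ).trans ?_)
    ((h.act_act (x := y ⊗ y) _ _ θ).trans ?_)
  · rw [lift_fst]
  · rw [lift_snd]

end Extends
end Herm
end Duality
end Extension
-- The functor `x ↦ δₓ F` and its behaviour on sums.
section DifferenceFunctoriality

variable {M : Type v} [SmallCategory M] [MonoidalCategory M] [InitialUnit M] [SymmetricCategory M]
  {B : Type u} [Category.{v} B] [Abelian B] [IsGrothendieckAbelian.{v} B]

lemma incl_whiskerRight {x y : M} (g : x ⟶ y) (z : M) : incl x z ≫ g ▷ z = incl y z := by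
  rw [incl, Category.assoc, ← comp_whiskerRight, zeroTo_ext (zeroTo x ≫ g) (zeroTo y), incl]

lemma incl_associator (x y z : M) :
    incl (x ⊗ y) z ≫ (α_ x y z).hom = incl y z ≫ incl x (y ⊗ z) := by
  simp [incl_tensor_left]

lemma incl_whiskerRight_associator (x y z : M) :
    incl x y ▷ z ≫ (α_ x y z).hom = incl x (y ⊗ z) := by
  simp [incl]

lemma inclLeft_whiskerRight_associator (x y z : M) :
    inclLeft x y ▷ z ≫ (α_ x y z).hom = x ◁ incl y z := by
  simp [incl, inclLeft]

/-- The morphism `τₓ F ⟶ τ_y F` induced by a morphism `x ⟶ y`. -/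
def tauMap {x y : M} (g : x ⟶ y) (F : M ⥤ B) : (tau M B x).obj F ⟶ (tau M B y).obj F where
  app z := F.map (g ▷ z)
  naturality z z' f := by
    change F.map (x ◁ f) ≫ F.map (g ▷ z') = F.map (g ▷ z) ≫ F.map (y ◁ f)
    rw [← F.map_comp, ← F.map_comp, whisker_exchange]

lemma iotaApp_tauMap {x y : M} (g : x ⟶ y) (F : M ⥤ B) :
    iotaApp x F ≫ tauMap g F = iotaApp y F := by
  ext z
  change F.map _ ≫ F.map _ = F.map _
  rw [← F.map_comp, incl_whiskerRight]

/-- A morphism from `δₓ F`. -/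
noncomputable def deltaDesc {x : M} {F K : M ⥤ B} (u : (tau M B x).obj F ⟶ K)
    (h : iotaApp x F ≫ u = 0) : (delta x).obj F ⟶ K :=
  cokernel.desc _ u h

lemma deltaπ_deltaDesc {x : M} {F K : M ⥤ B} (u : (tau M B x).obj F ⟶ K)
    (h : iotaApp x F ≫ u = 0) : deltaπ x F ≫ deltaDesc u h = u :=
  cokernel.π_desc _ _ _

/-- The morphism `δₓ F ⟶ δ_y F` induced by a morphism `x ⟶ y`. -/
noncomputable def deltaMap {x y : M} (g : x ⟶ y) (F : M ⥤ B) :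
    (delta x).obj F ⟶ (delta y).obj F :=
  deltaDesc (tauMap g F ≫ deltaπ y F) (by
    rw [← Category.assoc, iotaApp_tauMap, iotaApp_deltaπ])

lemma deltaπ_deltaMap {x y : M} (g : x ⟶ y) (F : M ⥤ B) :
    deltaπ x F ≫ deltaMap g F = tauMap g F ≫ deltaπ y F :=
  deltaπ_deltaDesc _ _

lemma deltaMap_naturality {x y : M} (g : x ⟶ y) {F G : M ⥤ B} (f : F ⟶ G) :
    deltaMap g F ≫ (delta y).map f = (delta x).map f ≫ deltaMap g G := by
  rw [← cancel_epi (deltaπ x F), reassoc_of% deltaπ_deltaMap g F, deltaπ_naturality,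
    reassoc_of% deltaπ_naturality x f, deltaπ_deltaMap, ← Category.assoc, ← Category.assoc]
  congr 1
  ext z
  exact (f.naturality (g ▷ z))

/-- The functor `x ↦ δₓ F`. -/
@[simps]
noncomputable def deltaFunctor (F : M ⥤ B) : M ⥤ M ⥤ B where
  obj x := (delta x).obj F
  map g := deltaMap g F
  map_id x := by
    rw [← cancel_epi (deltaπ x F), deltaπ_deltaMap, Category.comp_id]
    have : tauMap (𝟙 x) F = 𝟙 _ := by
      ext z
      change F.map (𝟙 x ▷ z) = 𝟙 _
      simp
    rw [this, Category.id_comp]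
  map_comp {x y z} g h := by
    rw [← cancel_epi (deltaπ x F), deltaπ_deltaMap, reassoc_of% deltaπ_deltaMap g F,
      deltaπ_deltaMap, ← Category.assoc]
    congr 1
    ext w
    change F.map ((g ≫ h) ▷ w) = F.map (g ▷ w) ≫ F.map (h ▷ w)
    simp

/-- The morphism `τ_{y ⊕ t} F ⟶ τ_t τ_y F`. -/
def tauAssoc (y t : M) (F : M ⥤ B) :
    (tau M B (y ⊗ t)).obj F ≅ (tau M B t).obj ((tau M B y).obj F) :=
  NatIso.ofComponents (fun w => F.mapIso (α_ y t w)) (fun {w w'} f => by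
    change F.map ((y ⊗ t) ◁ f) ≫ F.map _ = F.map _ ≫ F.map (y ◁ (t ◁ f))
    rw [← F.map_comp, ← F.map_comp]
    congr 1
    simp)

lemma iotaApp_tauAssoc (y t : M) (F : M ⥤ B) :
    iotaApp (y ⊗ t) F ≫ (tauAssoc y t F).hom =
      iotaApp t F ≫ (tau M B t).map (iotaApp y F) := by
  ext w
  change F.map _ ≫ F.map _ = F.map _ ≫ F.map _
  rw [← F.map_comp, ← F.map_comp, incl_associator]
  rfl

/-- The morphism `δ_{y ⊕ t} F ⟶ τ_t δ_y F`. -/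
noncomputable def deltaSplit (y t : M) (F : M ⥤ B) :
    (delta (y ⊗ t)).obj F ⟶ (tau M B t).obj ((delta y).obj F) :=
  deltaDesc ((tauAssoc y t F).hom ≫ (tau M B t).map (deltaπ y F)) (by
    rw [← Category.assoc, iotaApp_tauAssoc, Category.assoc, ← Functor.map_comp, iotaApp_deltaπ,
      Functor.map_zero, comp_zero])

lemma deltaπ_deltaSplit (y t : M) (F : M ⥤ B) :
    deltaπ (y ⊗ t) F ≫ deltaSplit y t F =
      (tauAssoc y t F).hom ≫ (tau M B t).map (deltaπ y F) :=
  deltaπ_deltaDesc _ _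

lemma deltaMap_inclLeft_deltaSplit (y t : M) (F : M ⥤ B) :
    deltaMap (inclLeft y t) F ≫ deltaSplit y t F = iotaApp t ((delta y).obj F) := by
  rw [← cancel_epi (deltaπ y F), reassoc_of% deltaπ_deltaMap (inclLeft y t) F, deltaπ_deltaSplit]
  have h : tauMap (inclLeft y t) F ≫ (tauAssoc y t F).hom = iotaApp t ((tau M B y).obj F) := by
    ext w
    change F.map _ ≫ F.map _ = F.map _
    rw [← F.map_comp, inclLeft_whiskerRight_associator]
    rfl
  rw [reassoc_of% h]
  exact ((iota M B t).naturality (deltaπ y F)).symm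

lemma deltaMap_incl_deltaSplit (y t : M) (F : M ⥤ B) :
    deltaMap (incl y t) F ≫ deltaSplit y t F = 0 := by
  rw [← cancel_epi (deltaπ t F), reassoc_of% deltaπ_deltaMap (incl y t) F, deltaπ_deltaSplit,
    comp_zero]
  have h : tauMap (incl y t) F ≫ (tauAssoc y t F).hom = (tau M B t).map (iotaApp y F) := by
    ext w
    change F.map _ ≫ F.map _ = F.map _
    rw [← F.map_comp, incl_whiskerRight_associator]
    rfl
  rw [reassoc_of% h, ← Functor.map_comp, iotaApp_deltaπ, Functor.map_zero]

/-- The sequence δ_t F ⟶ δ_{y⊕t} F ⟶ τ_t δ_y F ⟶ 0 is exact: once u kills δ_t F, it factors through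
the cokernel of τ_t(i_y). -/
lemma exists_deltaSplit_comp (y t : M) (F : M ⥤ B) {K : M ⥤ B} (u : (delta (y ⊗ t)).obj F ⟶ K)
    (h : deltaMap (incl y t) F ≫ u = 0) : ∃ u', u = deltaSplit y t F ≫ u' := by
  have e : (tau M B t).map (iotaApp y F) = tauMap (incl y t) F ≫ (tauAssoc y t F).hom := by
    ext w
    change F.map _ = F.map _ ≫ F.map _
    rw [← F.map_comp, incl_whiskerRight_associator]
    rfl
  have hv : (tau M B t).map (iotaApp y F) ≫ (tauAssoc y t F).inv ≫ deltaπ (y ⊗ t) F ≫ u = 0 := by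
    rw [e, Category.assoc, Iso.hom_inv_id_assoc, ← reassoc_of% deltaπ_deltaMap (incl y t) F, h,
      comp_zero]
  have hc : IsColimit (CokernelCofork.ofπ (f := (tau M B t).map (iotaApp y F))
      ((tau M B t).map (deltaπ y F)) (by
        rw [← Functor.map_comp, iotaApp_deltaπ, Functor.map_zero])) :=
    CokernelCofork.mapIsColimit _ (cokernelIsCokernel (iotaApp y F)) (tau M B t)
  obtain ⟨u', hu'⟩ := CokernelCofork.IsColimit.desc' hc _ hv
  refine ⟨u', ?_⟩
  rw [← cancel_epi (deltaπ (y ⊗ t) F), reassoc_of% deltaπ_deltaSplit y t F]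
  have hu'' : (tau M B t).map (deltaπ y F) ≫ u' =
    (tauAssoc y t F).inv ≫ deltaπ (y ⊗ t) F ≫ u := hu'
  rw [hu'', Iso.hom_inv_id_assoc]

variable {n : ℕ} {F K : M ⥤ B}

/-- The composite δ_y F ⟶ δ_{y⊕t} F ⟶ τ_t δ_y F is i_t, an isomorphism modulo degree < n as δ_y F
has degree ≤ n. Thus it is invisible to the local object K; the same remark gives
`exists_delta_extension`. -/
lemma delta_eq_zero_of_isLocal (hF : degLT M B (n + 2) F) (hK : (degIso M B n).isLocal K) {y t : M}
    (u : (delta (y ⊗ t)).obj F ⟶ K) (h₁ : deltaMap (inclLeft y t) F ≫ u = 0)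
    (h₂ : deltaMap (incl y t) F ≫ u = 0) : u = 0 := by
  obtain ⟨u', rfl⟩ := exists_deltaSplit_comp y t F u h₂
  rw [← Category.assoc, deltaMap_inclLeft_deltaSplit] at h₁
  have := degIso_iotaApp n t ((degLT_succ_iff (n + 1) F).1 hF y)
  rw [(hK _ this).1 (a₁ := u') (a₂ := 0) (by simpa using h₁), comp_zero]

lemma exists_delta_extension (hF : degLT M B (n + 2) F) (hK : (degIso M B n).isLocal K) {y : M}
    (θ : (delta y).obj F ⟶ K) (t : M) : ∃ u : (delta (y ⊗ t)).obj F ⟶ K,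
      deltaMap (inclLeft y t) F ≫ u = θ ∧ deltaMap (incl y t) F ≫ u = 0 := by
  have := degIso_iotaApp n t ((degLT_succ_iff (n + 1) F).1 hF y)
  obtain ⟨u', hu'⟩ := (hK _ this).2 θ
  refine ⟨deltaSplit y t F ≫ u', ?_, ?_⟩
  · rw [reassoc_of% deltaMap_inclLeft_deltaSplit y t F]
    exact hu'
  · rw [reassoc_of% deltaMap_incl_deltaSplit y t F, zero_comp]

/-- If the maps F(z) ⟶ F(x ⊕ z) are split, all the κₓ(F) vanish. The splittings need not be natural.
-/
lemma isZero_of_stablyNull_of_split (h : stablyNull M B F)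
    (hs : ∀ x z : M, ∃ r, F.map (incl x z) ≫ r = 𝟙 _) : IsZero F := by
  rw [stablyNull_iff] at h
  have hm : ∀ x : M, kernel.ι (iotaApp x F) = 0 := fun x => by
    ext z
    obtain ⟨r, hr⟩ := hs x z
    have e := (comp_iota_eq_zero_iff x _).1 (kernel.condition (iotaApp x F)) z
    rw [← Category.comp_id ((kernel.ι (iotaApp x F)).app z), ← hr, reassoc_of% e, zero_comp]
    rfl
  have e : Sigma.desc (fun x : M => kernel.ι (iotaApp x F)) = 0 :=
    Sigma.hom_ext _ _ fun x => by simp [hm]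
  rw [e] at h
  exact IsZero.of_epi_zero (∐ fun x : M => kap x F) F

end DifferenceFunctoriality

/-! ### Restriction along π^T preserves and detects the degree. -/

section Restriction

variable {A : Type v} [SmallCategory A] [Preadditive A] [HasFiniteBiproducts A]
  {B : Type u} [Category.{v} B] [Abelian B] [IsGrothendieckAbelian.{v} B]

open CartesianMonoidalCategory

lemma isZero_of_stablyNull {G : A ⥤ B} (h : stablyNull A B G) : IsZero G := by
  refine isZero_of_stablyNull_of_split h fun x z => ⟨G.map (snd x z), ?_⟩
  rw [← G.map_comp, additive_incl, lift_snd, G.map_id]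

namespace Duality

variable (d : Duality A) (k : FormKind) (ε : ℤˣ)

variable (B) in
/-- The restriction of functors along `π^T`. -/
abbrev res : (A ⥤ B) ⥤ (d.Herm k ε ⥤ B) :=
  (Functor.whiskeringLeft (d.Herm k ε) A B).obj (Herm.forget d k ε)

variable {d k ε}

/-- Translations commute with the restriction. -/
noncomputable def resTau (x : d.Herm k ε) (G : A ⥤ B) :
    (tau _ B x).obj ((res B d k ε).obj G) ≅ (res B d k ε).obj ((tau A B x.obj).obj G) :=
  NatIso.ofComponents (fun _ => Iso.refl _) (fun {w w'} f => by
    change G.map _ ≫ 𝟙 _ = 𝟙 _ ≫ G.map _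
    rw [Category.id_comp, Category.comp_id]
    rfl)

lemma iotaApp_resTau (x : d.Herm k ε) (G : A ⥤ B) :
    iotaApp x ((res B d k ε).obj G) ≫ (resTau x G).hom = (res B d k ε).map (iotaApp x.obj G) := by
  ext w
  refine (Category.comp_id _).trans ?_
  change G.map (incl x w).hom = G.map (incl x.obj w.obj)
  rw [additive_incl, Herm.incl_hom]

/-- Difference functors commute with the restriction. -/
noncomputable def resDelta (x : d.Herm k ε) (G : A ⥤ B) :
    (delta x).obj ((res B d k ε).obj G) ≅ (res B d k ε).obj ((delta x.obj).obj G) :=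
  cokernel.mapIso (iotaApp x ((res B d k ε).obj G)) ((res B d k ε).map (iotaApp x.obj G))
    (Iso.refl _) (resTau x G) (by rw [iotaApp_resTau, Iso.refl_hom, Category.id_comp]) ≪≫
    (PreservesCokernel.iso (res B d k ε) (iotaApp x.obj G)).symm

lemma deltaπ_resDelta (x : d.Herm k ε) (G : A ⥤ B) :
    deltaπ x ((res B d k ε).obj G) ≫ (resDelta x G).hom =
      (resTau x G).hom ≫ (res B d k ε).map (deltaπ x.obj G) := by
  have h := PreservesCokernel.π_iso_hom (res B d k ε) (iotaApp x.obj G)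
  rw [← Iso.eq_comp_inv] at h
  dsimp only [resDelta, Iso.trans_hom, Iso.symm_hom, diffπ, cokernel.mapIso, deltaπ]
  erw [cokernel.π_desc_assoc, h, Category.assoc]
  rfl

lemma degLT_res (n : ℕ) {G : A ⥤ B} (h : degLT A B n G) :
    degLT (d.Herm k ε) B n ((res B d k ε).obj G) := by
  induction n generalizing G with
  | zero =>
    have h' := isZero_of_stablyNull ((degLT_zero_iff G).1 h)
    exact (degLT (d.Herm k ε) B 0).prop_of_isZero ((res B d k ε).map_isZero h')
  | succ n ih =>
    rw [degLT_succ_iff] at h ⊢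
    intro x
    exact (degLT _ B n).prop_of_iso (resDelta x G).symm (ih (h x.obj))

lemma isZero_of_stablyNull_res {G : A ⥤ B} (h : stablyNull (d.Herm k ε) B ((res B d k ε).obj G)) :
    IsZero G := by
  have h' : IsZero ((res B d k ε).obj G) :=
    isZero_of_stablyNull_of_split h fun x z => ⟨G.map (snd x.obj z.obj), by
      have e : (incl x z).hom ≫ snd x.obj z.obj = 𝟙 z.obj := by rw [Herm.incl_hom, lift_snd]
      exact (G.map_comp _ _).symm.trans ((congrArg _ e).trans (G.map_id _))⟩
  rw [Functor.isZero_iff] at h' ⊢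
  intro a
  -- Not every object of A carries a form, but a is a retract of its hyperbolic object a ⊕ D a.
  have e : lift (𝟙 a) (0 : a ⟶ d.D.obj (op a)) ≫ fst a (d.D.obj (op a)) = 𝟙 a := lift_fst _ _
  rw [IsZero.iff_id_eq_zero, ← G.map_id, ← e, G.map_comp]
  have hz : G.map (fst a (d.D.obj (op a))) = 0 :=
    IsZero.eq_zero_of_src (h' (Herm.hyperbolic d k ε a)) _
  rw [hz, comp_zero]

lemma degLT_of_res (n : ℕ) {G : A ⥤ B} (h : degLT (d.Herm k ε) B n ((res B d k ε).obj G)) :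
    degLT A B n G := by
  induction n generalizing G with
  | zero =>
    rw [degLT_zero_iff] at h
    exact (degLT A B 0).prop_of_isZero (isZero_of_stablyNull_res h)
  | succ n ih =>
    rw [degLT_succ_iff] at h ⊢
    intro a
    have := ih ((degLT _ B n).prop_of_iso (resDelta (Herm.hyperbolic d k ε a) G) (h _))
    -- By functoriality in the index, δ_a G is a retract of δ at the hyperbolic object.
    let i : a ⟶ (Herm.hyperbolic d k ε a).obj := lift (𝟙 a) (0 : a ⟶ d.D.obj (op a))
    let r : (Herm.hyperbolic d k ε a).obj ⟶ a := fst a (d.D.obj (op a))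
    have hi : i ≫ r = 𝟙 a := lift_fst _ _
    have e : deltaMap i G ≫ deltaMap r G = 𝟙 _ := by
      refine ((deltaFunctor G).map_comp i r).symm.trans ?_
      rw [hi, CategoryTheory.Functor.map_id]
      rfl
    have := (SplitMono.mk (deltaMap r G) e).mono
    exact (degLT A B n).prop_of_mono (deltaMap i G) ‹_›

end Duality
end Restriction
-- Polarization: morphisms to a diagonal and families on the δₓ.
section Diagonal

variable {A : Type v} [SmallCategory A] [Preadditive A] [HasFiniteBiproducts A]
  {B : Type u} [Category.{v} B] [Abelian B] [IsGrothendieckAbelian.{v} B]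

open CartesianMonoidalCategory

/-- The diagonal of a bifunctor. -/
abbrev diagonal (J : A ⥤ A ⥤ B) : A ⥤ B where
  obj a := (J.obj a).obj a
  map f := (J.map f).app _ ≫ (J.obj _).map f
  map_id a := by simp
  map_comp f g := by simp

namespace Duality

variable {d : Duality A} {k : FormKind} {ε : ℤˣ}

namespace Herm

/-- The projection of `x ⊕ w` to `x`. -/
noncomputable def hfst (x w : d.Herm k ε) : (x ⊗ w).obj ⟶ x.obj := fst x.obj w.obj

/-- The projection of `x ⊕ w` to `w`. -/
noncomputable def hsnd (x w : d.Herm k ε) : (x ⊗ w).obj ⟶ w.obj := snd x.obj w.obj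

section

variable (x y z w : d.Herm k ε)

lemma incl_hfst : (incl x w).hom ≫ hfst x w = 0 := by simp [hfst]

lemma incl_hsnd : (incl x w).hom ≫ hsnd x w = 𝟙 _ := by simp [hsnd]

lemma inclLeft_hfst : (inclLeft x w).hom ≫ hfst x w = 𝟙 _ := by simp [hfst]

lemma whiskerLeft_hfst {w w' : d.Herm k ε} (g : w ⟶ w') : (x ◁ g).hom ≫ hfst x w' = hfst x w := by
  simp [hfst]

lemma whiskerLeft_hsnd {w w' : d.Herm k ε} (g : w ⟶ w') :
    (x ◁ g).hom ≫ hsnd x w' = hsnd x w ≫ g.hom := by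
  simp [hsnd]

lemma whiskerRight_hfst {x x' : d.Herm k ε} (g : x ⟶ x') :
    (g ▷ w).hom ≫ hfst x' w = hfst x w ≫ g.hom := by
  simp [hfst]

lemma whiskerRight_hsnd {x x' : d.Herm k ε} (g : x ⟶ x') :
    (g ▷ w).hom ≫ hsnd x' w = hsnd x w := by
  simp [hsnd]

lemma diag_hfst : (diag x).hom ≫ hfst x _ = 𝟙 _ := by simp [hfst]

lemma diag_hsnd_hfst : (diag x).hom ≫ hsnd x _ ≫ hfst x _ = 𝟙 _ := by simp [hfst, hsnd]

lemma tensorHom_hfst {x x' w w' : d.Herm k ε} (f : x ⟶ x') (g : w ⟶ w') :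
    (f ⊗ₘ g).hom ≫ hfst x' w' = hfst x w ≫ f.hom := tensorHom_fst _ _

/-- The morphism `(a, b, c) ↦ (c, (a, c), (b, c))`. -/
noncomputable def spreadHom (X Y : A) : (X ⊗ X) ⊗ Y ⟶ Y ⊗ ((X ⊗ Y) ⊗ (X ⊗ Y)) :=
  lift (snd (X ⊗ X) Y) (lift (lift (fst (X ⊗ X) Y ≫ fst X X) (snd (X ⊗ X) Y))
    (lift (fst (X ⊗ X) Y ≫ snd X X) (snd (X ⊗ X) Y)))

/-- The form v is counted three times, with signs +, +, −. -/
lemma map_spreadHom {X Y : A} (u : (d.forms k ε).obj (op X)) (v : (d.forms k ε).obj (op Y)) :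
    (d.forms k ε).map (spreadHom X Y).op (orthogonalForm v (orthogonalForm (orthogonalForm u v)
      (-orthogonalForm u v))) = orthogonalForm (orthogonalForm u (-u)) v := by
  have h₁ : spreadHom X Y ≫ fst _ _ = snd _ _ := lift_fst _ _
  have h₂ : (spreadHom X Y ≫ snd _ _) ≫ fst _ _ = lift (fst (X ⊗ X) Y ≫ fst X X) (snd (X ⊗ X) Y) := by
    simp [spreadHom]
  have h₃ : (spreadHom X Y ≫ snd _ _) ≫ snd _ _ = lift (fst (X ⊗ X) Y ≫ snd X X) (snd (X ⊗ X) Y) := by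
    simp [spreadHom]
  rw [map_orthogonalForm, map_orthogonalForm, h₁, h₂, h₃, map_neg, map_orthogonalForm,
    map_orthogonalForm, lift_fst, lift_fst, lift_snd, lift_snd, orthogonalForm_eq,
    orthogonalForm_eq, map_add, map_neg, map_neg, map_map_op, map_map_op]
  abel

/-- The morphism `(a, b, c) ↦ (c, (a, c), (b, c))` of hermitian objects. -/
noncomputable def spread (y w : d.Herm k ε) :
    (y ⊗ (neg d k ε).obj y) ⊗ w ⟶ w ⊗ ((y ⊗ w) ⊗ (neg d k ε).obj (y ⊗ w)) where
  hom := spreadHom y.obj w.obj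
  map_form := map_spreadHom y.form w.form

lemma spread_proj : (spread y w).hom ≫ hsnd w _ ≫ hfst (y ⊗ w) _ ≫ hsnd y w = hsnd _ w := by
  have h : spreadHom y.obj w.obj ≫ snd w.obj ((y.obj ⊗ w.obj) ⊗ (y.obj ⊗ w.obj)) ≫
      fst (y.obj ⊗ w.obj) (y.obj ⊗ w.obj) ≫ snd y.obj w.obj = snd (y.obj ⊗ y.obj) w.obj := by
    simp [spreadHom]
  exact h

/-- Compares the diagonal of y ⊕ w with that of y alone, up to the morphism `spread` of the
auxiliary summand. This is what allows `sharp_flat` to use naturality in the second variable. -/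
lemma diag_associator : diag (y ⊗ w) ≫ (α_ y w _).hom =
    diag y ▷ w ≫ (α_ y _ w).hom ≫ y ◁ spread y w := by
  apply hom_ext
  change lift (𝟙 (y.obj ⊗ w.obj)) (lift (𝟙 (y.obj ⊗ w.obj)) (𝟙 (y.obj ⊗ w.obj))) ≫
    (α_ y.obj w.obj ((y.obj ⊗ w.obj) ⊗ (y.obj ⊗ w.obj))).hom =
    lift (𝟙 y.obj) (lift (𝟙 y.obj) (𝟙 y.obj)) ▷ w.obj ≫ (α_ y.obj (y.obj ⊗ y.obj) w.obj).hom ≫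
    y.obj ◁ spreadHom y.obj w.obj
  refine CartesianMonoidalCategory.hom_ext _ _ ?_ (CartesianMonoidalCategory.hom_ext _ _ ?_
    (CartesianMonoidalCategory.hom_ext _ _ (CartesianMonoidalCategory.hom_ext _ _ ?_ ?_)
      (CartesianMonoidalCategory.hom_ext _ _ ?_ ?_))) <;> simp [spreadHom]

end

end Herm

open Herm

section

variable {F : d.Herm k ε ⥤ B} {I : A ⥤ B}

/-- The value at `z` of a morphism to `π^* I`. -/
def appA (f : F ⟶ (res B d k ε).obj I) (z : d.Herm k ε) : F.obj z ⟶ I.obj z.obj := f.app z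

lemma appA_ext {f g : F ⟶ (res B d k ε).obj I} (h : ∀ z, appA f z = appA g z) : f = g := by
  ext z
  exact h z

lemma map_appA (f : F ⟶ (res B d k ε).obj I) {z z' : d.Herm k ε} (g : z ⟶ z') :
    F.map g ≫ appA f z' = appA f z ≫ I.map g.hom := f.naturality g

lemma appA_comp {F' : d.Herm k ε ⥤ B} (s : F' ⟶ F) (f : F ⟶ (res B d k ε).obj I)
    (z : d.Herm k ε) : appA (s ≫ f) z = s.app z ≫ appA f z := rfl

/-- The morphism to `π^* I` with given values. -/
def toRes (app : ∀ z : d.Herm k ε, F.obj z ⟶ I.obj z.obj)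
    (nat : ∀ {z z' : d.Herm k ε} (g : z ⟶ z'), F.map g ≫ app z' = app z ≫ I.map g.hom) :
    F ⟶ (res B d k ε).obj I where
  app := app
  naturality _ _ g := nat g

variable {x : d.Herm k ε}

/-- The value at `w` of the morphism `τₓ F ⟶ π^* I` defined by a morphism `δₓ F ⟶ π^* I`. -/
noncomputable def raw (ψ : (delta x).obj F ⟶ (res B d k ε).obj I) (w : d.Herm k ε) :
    F.obj (x ⊗ w) ⟶ I.obj w.obj :=
  (deltaπ x F ≫ ψ).app w

lemma raw_ext {ψ ψ' : (delta x).obj F ⟶ (res B d k ε).obj I} (h : ∀ w, raw ψ w = raw ψ' w) :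
    ψ = ψ' := by
  rw [← cancel_epi (deltaπ x F)]
  ext w
  exact h w

lemma raw_comp (ψ : (delta x).obj F ⟶ (res B d k ε).obj I) {I' : A ⥤ B} (f : I ⟶ I')
    (w : d.Herm k ε) : raw (ψ ≫ (res B d k ε).map f) w = raw ψ w ≫ f.app w.obj := by
  rw [raw, ← Category.assoc]
  rfl

lemma map_whiskerLeft_raw (ψ : (delta x).obj F ⟶ (res B d k ε).obj I) {w w' : d.Herm k ε}
    (g : w ⟶ w') : F.map (x ◁ g) ≫ raw ψ w' = raw ψ w ≫ I.map g.hom :=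
  (deltaπ x F ≫ ψ).naturality g

lemma map_incl_raw (ψ : (delta x).obj F ⟶ (res B d k ε).obj I) (w : d.Herm k ε) :
    F.map (incl x w) ≫ raw ψ w = 0 := by
  have : iotaApp x F ≫ deltaπ x F ≫ ψ = 0 := by
    rw [reassoc_of% iotaApp_deltaπ x F, zero_comp]
  exact congrArg (fun t => NatTrans.app t w) this

lemma raw_deltaMap {y : d.Herm k ε} (g : x ⟶ y) (ψ : (delta y).obj F ⟶ (res B d k ε).obj I)
    (w : d.Herm k ε) : raw (deltaMap g F ≫ ψ) w = F.map (g ▷ w) ≫ raw ψ w := by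
  rw [raw, reassoc_of% deltaπ_deltaMap g F]
  rfl

lemma raw_delta_map {F' : d.Herm k ε ⥤ B} (s : F' ⟶ F)
    (ψ : (delta x).obj F ⟶ (res B d k ε).obj I)
    (w : d.Herm k ε) : raw ((delta x).map s ≫ ψ) w = s.app (x ⊗ w) ≫ raw ψ w := by
  rw [raw, reassoc_of% deltaπ_naturality x s]
  rfl

/-- The morphism `δₓ F ⟶ π^* I` with given values. -/
noncomputable def ofRaw (app : ∀ w : d.Herm k ε, F.obj (x ⊗ w) ⟶ I.obj w.obj)
    (nat : ∀ {w w' : d.Herm k ε} (g : w ⟶ w'), F.map (x ◁ g) ≫ app w' = app w ≫ I.map g.hom)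
    (h : ∀ w, F.map (incl x w) ≫ app w = 0) : (delta x).obj F ⟶ (res B d k ε).obj I :=
  deltaDesc (x := x) { app := app, naturality := fun _ _ g => nat g } (by ext w; exact h w)

lemma raw_ofRaw (app : ∀ w : d.Herm k ε, F.obj (x ⊗ w) ⟶ I.obj w.obj)
    (nat : ∀ {w w' : d.Herm k ε} (g : w ⟶ w'), F.map (x ◁ g) ≫ app w' = app w ≫ I.map g.hom)
    (h : ∀ w, F.map (incl x w) ≫ app w = 0) (w : d.Herm k ε) : raw (ofRaw app nat h) w = app w := by
  rw [raw, ofRaw, deltaπ_deltaDesc]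

lemma raw_eq_of_isLocal {n : ℕ} (hF : degLT _ B (n + 2) F)
    (hI : (degIso _ B n).isLocal ((res B d k ε).obj I)) {y t : d.Herm k ε}
    {u v : (delta (y ⊗ t)).obj F ⟶ (res B d k ε).obj I}
    (h₁ : ∀ w, F.map (inclLeft y t ▷ w) ≫ raw u w = F.map (inclLeft y t ▷ w) ≫ raw v w)
    (h₂ : ∀ w, F.map (incl y t ▷ w) ≫ raw u w = F.map (incl y t ▷ w) ≫ raw v w) : u = v := by
  rw [← sub_eq_zero]
  refine delta_eq_zero_of_isLocal hF hI (u - v) ?_ ?_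
  · rw [Preadditive.comp_sub, sub_eq_zero]
    exact raw_ext fun w => by rw [raw_deltaMap, raw_deltaMap, h₁]
  · rw [Preadditive.comp_sub, sub_eq_zero]
    exact raw_ext fun w => by rw [raw_deltaMap, raw_deltaMap, h₂]

end

/-- A natural family of morphisms `δₓ F ⟶ π^* J(x, -)`, in terms of the induced morphisms
`F(x ⊕ w) ⟶ J(x, w)`. -/
@[ext]
structure Family (F : d.Herm k ε ⥤ B) (J : A ⥤ A ⥤ B) where
  app (x w : d.Herm k ε) : F.obj (x ⊗ w) ⟶ (J.obj x.obj).obj w.obj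
  left {x y : d.Herm k ε} (g : x ⟶ y) (w : d.Herm k ε) :
    F.map (g ▷ w) ≫ app y w = app x w ≫ (J.map g.hom).app w.obj
  right (x : d.Herm k ε) {w w' : d.Herm k ε} (g : w ⟶ w') :
    F.map (x ◁ g) ≫ app x w' = app x w ≫ (J.obj x.obj).map g.hom
  map_incl (x w : d.Herm k ε) : F.map (incl x w) ≫ app x w = 0

variable {F : d.Herm k ε ⥤ B} {J : A ⥤ A ⥤ B}

namespace Family

/-- The morphism `δₓ F ⟶ π^* J(x, -)` of a family. -/
noncomputable def comp (ψ : Family F J) (x : d.Herm k ε) :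
    (delta x).obj F ⟶ (res B d k ε).obj (J.obj x.obj) :=
  ofRaw (ψ.app x) (ψ.right x) (ψ.map_incl x)

lemma raw_comp (ψ : Family F J) (x w : d.Herm k ε) : raw (ψ.comp x) w = ψ.app x w :=
  raw_ofRaw _ _ _ _

/-- The family defined by morphisms `δₓ F ⟶ π^* J(x, -)`. -/
noncomputable def mk' (ψ : ∀ x : d.Herm k ε, (delta x).obj F ⟶ (res B d k ε).obj (J.obj x.obj))
    (h : ∀ {x y : d.Herm k ε} (g : x ⟶ y), deltaMap g F ≫ ψ y =
      ψ x ≫ (res B d k ε).map (J.map g.hom)) : Family F J where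
  app x w := raw (ψ x) w
  left g w := by rw [← raw_deltaMap, h, Duality.raw_comp]
  right x _ _ g := map_whiskerLeft_raw (ψ x) g
  map_incl x w := map_incl_raw (ψ x) w

/-- The morphism `F ⟶ π^*(diagonal J)` defined by a family of morphisms `δₓ F ⟶ π^* J(x, -)`. -/
noncomputable def flat (ψ : Family F J) : F ⟶ (res B d k ε).obj (diagonal J) :=
  -- At z this is F(z) ⟶ F(z ⊕ (z ⊕ z⁻)) ⟶ J(z, z ⊕ z⁻) ⟶ J(z, z), with `diag` in the role of the
  -- diagonal z ⟶ z ⊕ z.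
  toRes (fun z => F.map (diag z) ≫ ψ.app z (z ⊗ (neg d k ε).obj z) ≫
    (J.obj z.obj).map (hfst z ((neg d k ε).obj z))) (fun {z z'} g => by
    have e : g ≫ diag z' = diag z ≫ g ▷ _ ≫ z' ◁ (g ⊗ₘ (neg d k ε).map g) := by
      rw [diag_naturality, MonoidalCategory.tensorHom_def]
    rw [← F.map_comp_assoc, e, F.map_comp_assoc, F.map_comp_assoc, reassoc_of% ψ.right z',
      reassoc_of% ψ.left g, ← Functor.map_comp, tensorHom_hfst, Functor.map_comp]
    simp only [Category.assoc]
    rw [← NatTrans.naturality_assoc])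

lemma appA_flat (ψ : Family F J) (z : d.Herm k ε) : appA ψ.flat z =
    F.map (diag z) ≫ ψ.app z (z ⊗ (neg d k ε).obj z) ≫
      (J.obj z.obj).map (hfst z ((neg d k ε).obj z)) := rfl

variable [J.Additive]

lemma map_app_map {a b c : A} (f : a ⟶ b) (g : b ⟶ c) (e : A) :
    (J.map f).app e ≫ (J.map g).app e = (J.map (f ≫ g)).app e := by simp

lemma map_zero_app (a b e : A) : (J.map (0 : a ⟶ b)).app e = 0 := by
  rw [J.map_zero]
  rfl

/-- The family of morphisms `δₓ F ⟶ π^* J(x, -)` defined by a morphism `F ⟶ π^*(diagonal J)`. -/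
noncomputable def sharp (f : F ⟶ (res B d k ε).obj (diagonal J)) : Family F J where
  app x w := appA f (x ⊗ w) ≫ (J.map (hfst x w)).app _ ≫ (J.obj x.obj).map (hsnd x w)
  left {x y} g w := by
    rw [reassoc_of% map_appA f (g ▷ w)]
    simp only [Category.assoc, NatTrans.naturality_assoc, NatTrans.naturality]
    rw [← Functor.map_comp, whiskerRight_hsnd, reassoc_of% map_app_map, reassoc_of% map_app_map,
      whiskerRight_hfst]
  right x w w' g := by
    rw [reassoc_of% map_appA f (x ◁ g)]
    simp only [Category.assoc, NatTrans.naturality_assoc]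
    rw [← Functor.map_comp, whiskerLeft_hsnd, reassoc_of% map_app_map, whiskerLeft_hfst,
      Functor.map_comp]
  -- The projection to x vanishes on w, so additivity of J in its first variable gives zero.
  map_incl x w := by
    rw [reassoc_of% map_appA f (incl x w)]
    simp only [NatTrans.naturality_assoc]
    rw [reassoc_of% map_app_map, incl_hfst, map_zero_app, zero_comp, comp_zero]

lemma sharp_app (f : F ⟶ (res B d k ε).obj (diagonal J)) (x w : d.Herm k ε) : (sharp f).app x w =
    appA f (x ⊗ w) ≫ (J.map (hfst x w)).app _ ≫ (J.obj x.obj).map (hsnd x w) := rfl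

/-- The components of `diag z` are identities, so restricting the polarization along it gives f
back. There is no condition on degrees, which is essential in `isLocal_diagonal`, where F is
arbitrary. -/
lemma flat_sharp (f : F ⟶ (res B d k ε).obj (diagonal J)) : (sharp f).flat = f := by
  apply appA_ext
  intro z
  rw [appA_flat, sharp_app, Category.assoc, reassoc_of% map_appA f (diag z),
    Category.assoc, NatTrans.naturality_assoc, reassoc_of% map_app_map,
    ← Functor.map_comp, ← Functor.map_comp, diag_hfst, diag_hsnd_hfst]
  simp

variable {n : ℕ}

/-- Both sides define morphisms δ_{y⊕t} F ⟶ π^*J(y, -) with the same restriction to δ_y F, and both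
vanish on δ_t F. Uniqueness of extensions thus lets a summand t pass from the first variable to the
second. -/
lemma app_hfst (ψ : Family F J) (hF : degLT _ B (n + 2) F) {y : d.Herm k ε}
    (hJ : (degIso _ B n).isLocal ((res B d k ε).obj (J.obj y.obj))) (t w : d.Herm k ε) :
    ψ.app (y ⊗ t) w ≫ (J.map (hfst y t)).app w.obj =
      F.map (α_ y t w).hom ≫ ψ.app y (t ⊗ w) ≫ (J.obj y.obj).map (hsnd t w) := by
  let v : (delta (y ⊗ t)).obj F ⟶ (res B d k ε).obj (J.obj y.obj) := ofRaw
    (fun w => F.map (α_ y t w).hom ≫ ψ.app y (t ⊗ w) ≫ (J.obj y.obj).map (hsnd t w))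
    (fun {w w'} g => by
      rw [← F.map_comp_assoc, associator_naturality_right, F.map_comp_assoc, reassoc_of% ψ.right y,
        ← Functor.map_comp, whiskerLeft_hsnd, Category.assoc, Category.assoc, ← Functor.map_comp])
    (fun w => by
      rw [← F.map_comp_assoc, incl_associator, F.map_comp_assoc, reassoc_of% ψ.map_incl y,
        zero_comp, comp_zero])
  have e : ψ.comp (y ⊗ t) ≫ (res B d k ε).map (J.map (hfst y t)) = v := by
    refine raw_eq_of_isLocal hF hJ (fun w => ?_) (fun w => ?_)
    · rw [Duality.raw_comp, raw_ofRaw, raw_comp, reassoc_of% ψ.left, map_app_map, inclLeft_hfst,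
        ← F.map_comp_assoc, inclLeft_whiskerRight_associator, reassoc_of% ψ.right y,
        ← Functor.map_comp, incl_hsnd]
      simp
    · rw [Duality.raw_comp, raw_ofRaw, raw_comp, reassoc_of% ψ.left, map_app_map, incl_hfst,
        ← F.map_comp_assoc, incl_whiskerRight_associator, reassoc_of% ψ.map_incl y, map_zero_app,
        comp_zero, zero_comp]
  have := congrArg (fun t => raw t w) e
  simpa only [v, Duality.raw_comp, raw_ofRaw, raw_comp] using this

/-- `app_hfst` moves w to the second variable, `diag_associator` then separates it from the diagonal
of y, and a second use of `app_hfst` removes the auxiliary summands. -/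
lemma sharp_flat (ψ : Family F J) (hF : degLT _ B (n + 2) F)
    (hJ : ∀ y : d.Herm k ε, (degIso _ B n).isLocal ((res B d k ε).obj (J.obj y.obj))) :
    sharp ψ.flat = ψ := by
  ext y w
  rw [sharp_app, appA_flat, Category.assoc, Category.assoc, NatTrans.naturality_assoc,
    reassoc_of% app_hfst ψ hF (hJ y), ← F.map_comp_assoc, diag_associator, F.map_comp_assoc,
    F.map_comp_assoc, reassoc_of% ψ.right y, ← Functor.map_comp, ← Functor.map_comp,
    ← Functor.map_comp, spread_proj, ← app_hfst ψ hF (hJ y), reassoc_of% ψ.left, map_app_map,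
    diag_hfst]
  simp

end Family

end Duality
end Diagonal
-- Degree of functors on A: products and diagonals.
section Pointwise

variable {M : Type v} [SmallCategory M] [MonoidalCategory M] [InitialUnit M] [SymmetricCategory M]
  {B : Type u} [Category.{v} B] [Abelian B] [IsGrothendieckAbelian.{v} B]

/-- The projection `F(x ⊕ w) ⟶ δₓ F(w)`. -/
noncomputable def delπ (x : M) (F : M ⥤ B) (w : M) : F.obj (x ⊗ w) ⟶ ((delta x).obj F).obj w :=
  (deltaπ x F).app w

variable (x : M) (F : M ⥤ B)

/-- `δₓ F(w)` is the cokernel of `F(w) ⟶ F(x ⊕ w)`. -/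
noncomputable def delIsColimit (w : M) :
    IsColimit (CokernelCofork.ofπ (f := F.map (incl x w)) (delπ x F w)
      (congrArg (fun t => NatTrans.app t w) (iotaApp_deltaπ x F))) :=
  CokernelCofork.mapIsColimit _ (cokernelIsCokernel (iotaApp x F)) ((evaluation M B).obj w)

instance (w : M) : Epi (delπ x F w) := by
  have := (inferInstance : Epi (deltaπ x F))
  exact inferInstanceAs (Epi ((deltaπ x F).app w))

lemma map_incl_delπ (w : M) : F.map (incl x w) ≫ delπ x F w = 0 :=
  congrArg (fun t => NatTrans.app t w) (iotaApp_deltaπ x F)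

lemma map_delπ {w w' : M} (g : w ⟶ w') :
    F.map (x ◁ g) ≫ delπ x F w' = delπ x F w ≫ ((delta x).obj F).map g :=
  (deltaπ x F).naturality g

lemma app_delπ {F G : M ⥤ B} (s : F ⟶ G) (w : M) :
    s.app (x ⊗ w) ≫ delπ x G w = delπ x F w ≫ ((delta x).map s).app w :=
  congrArg (fun t => NatTrans.app t w) (deltaπ_naturality x s).symm

variable {F} in
/-- A morphism from `δₓ F(w)`. -/
noncomputable def delDesc {w : M} {Z : B} (u : F.obj (x ⊗ w) ⟶ Z) (h : F.map (incl x w) ≫ u = 0) :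
    ((delta x).obj F).obj w ⟶ Z :=
  (delIsColimit x F w).desc (CokernelCofork.ofπ u h)

variable {F} in
lemma delπ_delDesc {w : M} {Z : B} (u : F.obj (x ⊗ w) ⟶ Z) (h : F.map (incl x w) ≫ u = 0) :
    delπ x F w ≫ delDesc x u h = u :=
  (delIsColimit x F w).fac (CokernelCofork.ofπ u h) WalkingParallelPair.one

end Pointwise

section AdditiveDegree

variable {A : Type v} [SmallCategory A] [Preadditive A] [HasFiniteBiproducts A]
  {B : Type u} [Category.{v} B] [Abelian B] [IsGrothendieckAbelian.{v} B]

open CartesianMonoidalCategory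

lemma isZero_of_degLT_zero {G : A ⥤ B} (h : degLT A B 0 G) : IsZero G :=
  isZero_of_stablyNull ((degLT_zero_iff G).1 h)

lemma incl_snd (x w : A) : incl x w ≫ snd x w = 𝟙 w := by
  rw [additive_incl, lift_snd]

/-- The section of `F(x ⊕ w) ⟶ δₓ F(w)` in the additive case. -/
noncomputable def delSection (x : A) (F : A ⥤ B) (w : A) :
    ((delta x).obj F).obj w ⟶ F.obj (x ⊗ w) :=
  delDesc x (𝟙 _ - F.map (snd x w ≫ incl x w)) (by
    rw [Preadditive.comp_sub, ← F.map_comp, ← Category.assoc, incl_snd]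
    simp)

lemma delπ_delSection (x : A) (F : A ⥤ B) (w : A) :
    delπ x F w ≫ delSection x F w = 𝟙 _ - F.map (snd x w ≫ incl x w) :=
  delπ_delDesc _ _ _

lemma delSection_delπ (x : A) (F : A ⥤ B) (w : A) :
    delSection x F w ≫ delπ x F w = 𝟙 _ := by
  rw [← cancel_epi (delπ x F w), ← Category.assoc, delπ_delSection, Preadditive.sub_comp,
    F.map_comp, Category.assoc, map_incl_delπ]
  simp

lemma delSection_app (x : A) {F G : A ⥤ B} (s : F ⟶ G) (w : A) :
    delSection x F w ≫ s.app (x ⊗ w) = ((delta x).map s).app w ≫ delSection x G w := by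
  rw [← cancel_epi (delπ x F w), ← Category.assoc, delπ_delSection, ← Category.assoc, ← app_delπ,
    Category.assoc, delπ_delSection]
  simp

/-- A family of morphisms of functors is jointly monic at every object. -/
def JointlyMono {F : A ⥤ B} {ι : Type*} {G : ι → A ⥤ B} (f : ∀ i, F ⟶ G i) : Prop :=
  ∀ (a : A) {Z : B} (φ : Z ⟶ F.obj a), (∀ i, φ ≫ (f i).app a = 0) → φ = 0

/-- Over A the projection F(x ⊕ w) ⟶ δₓ F(w) has a section natural in F, so δₓ preserves jointly
monic families. In particular the degree is stable under arbitrary limits. -/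
lemma JointlyMono.degLT {ι : Type*} {n : ℕ} {F : A ⥤ B} {G : ι → A ⥤ B} {f : ∀ i, F ⟶ G i}
    (hf : JointlyMono f) (hG : ∀ i, degLT A B n (G i)) : degLT A B n F := by
  induction n generalizing F G with
  | zero =>
    refine (StablePol.degLT A B 0).prop_of_isZero ?_
    rw [Functor.isZero_iff]
    intro a
    rw [IsZero.iff_id_eq_zero]
    exact hf a _ fun i => ((Functor.isZero_iff _).1 (isZero_of_degLT_zero (hG i)) a).eq_of_tgt _ _
  | succ n ih =>
    rw [degLT_succ_iff]
    intro x
    refine ih (f := fun i => (delta x).map (f i)) (fun w Z φ h => ?_)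
      fun i => (degLT_succ_iff n _).1 (hG i) x
    have : φ ≫ delSection x F w = 0 := hf (x ⊗ w) _ fun i => by
      rw [Category.assoc, delSection_app, reassoc_of% h i, zero_comp]
    rw [← Category.comp_id φ, ← delSection_delπ, reassoc_of% this, zero_comp]

instance additive_comp_delta (J : A ⥤ A ⥤ B) [J.Additive] (x : A) : (J ⋙ delta x).Additive := by
  have : (tau A B x).Additive := Functor.additive_of_preserves_binary_products _
  infer_instance

/-- The morphism from the diagonal of `δₓ J` to `δₓ` of the diagonal of `J`. -/
noncomputable def diagonalDelta (J : A ⥤ A ⥤ B) (x : A) :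
    diagonal (J ⋙ delta x) ⟶ (delta x).obj (diagonal J) where
  app w := delDesc (F := J.obj w) x ((J.map (incl x w)).app (x ⊗ w) ≫ delπ x (diagonal J) w) (by
    have := map_incl_delπ x (diagonal J) w
    rw [NatTrans.naturality_assoc, ← Category.assoc]
    exact this)
  naturality w w' h := by
    have : Epi (delπ x (J.obj w) w) := inferInstance
    change (((delta x).map (J.map h)).app w ≫ ((delta x).obj (J.obj w')).map h) ≫ _ = _
    rw [← cancel_epi (delπ x (J.obj w) w), Category.assoc, ← reassoc_of% app_delπ x (J.map h) w,
      ← reassoc_of% map_delπ x (J.obj w') h, delπ_delDesc, reassoc_of% delπ_delDesc]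
    have e := map_delπ x (diagonal J) h
    rw [Category.assoc, ← e]
    simp only [NatTrans.naturality_assoc, Category.assoc]
    rw [← NatTrans.comp_app_assoc, ← NatTrans.comp_app_assoc, ← J.map_comp, ← J.map_comp,
      incl_naturality]

lemma delπ_diagonalDelta (J : A ⥤ A ⥤ B) (x w : A) :
    delπ x (J.obj w) w ≫ (diagonalDelta J x).app w =
      (J.map (incl x w)).app (x ⊗ w) ≫ delπ x (diagonal J) w :=
  delπ_delDesc _ _ _

/-- The morphism `τₓ J(x, -) ⟶ δₓ (diagonal J)`. -/
noncomputable def tauToDelta (J : A ⥤ A ⥤ B) (x : A) :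
    (tau A B x).obj (J.obj x) ⟶ (delta x).obj (diagonal J) where
  app w := (J.map (lift (𝟙 x) (0 : x ⟶ w))).app (x ⊗ w) ≫ delπ x (diagonal J) w
  naturality w w' h := by
    change (J.obj x).map (x ◁ h) ≫ (J.map (lift (𝟙 x) (0 : x ⟶ w'))).app (x ⊗ w') ≫
      delπ x (diagonal J) w' = _
    have e := map_delπ x (diagonal J) h
    rw [Category.assoc, ← e]
    simp only [NatTrans.naturality_assoc, Category.assoc]
    rw [← NatTrans.comp_app_assoc, ← J.map_comp]
    have e : lift (𝟙 x) (0 : x ⟶ w) ≫ x ◁ h = lift (𝟙 x) 0 := by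
      apply CartesianMonoidalCategory.hom_ext <;> simp
    rw [e]

/-- Splitting the first variable at x ⊕ w presents δₓ of the diagonal as a quotient of τₓ J(x, -) ⊕
diagonal(δₓ J), where δₓ acts on the second variable and induction applies. -/
lemma degLT_diagonal {n : ℕ} (J : A ⥤ A ⥤ B) [J.Additive] (hJ : ∀ a, degLT A B n (J.obj a)) :
    degLT A B (n + 1) (diagonal J) := by
  induction n generalizing J with
  | zero =>
    refine (degLT A B 1).prop_of_isZero ?_
    rw [Functor.isZero_iff]
    intro a
    exact (Functor.isZero_iff _).1 (isZero_of_degLT_zero (hJ a)) a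
  | succ n ih =>
    rw [degLT_succ_iff]
    intro x
    have h₁ := ih (J ⋙ delta x) fun a => (degLT_succ_iff n _).1 (hJ a) x
    have h₂ := degLT_tau (n + 1) x (hJ x)
    -- Tested on J(x ⊕ w, x ⊕ w), the sum of J(x, x ⊕ w) and J(w, x ⊕ w) by additivity.
    have : Epi (biprod.desc (tauToDelta J x) (diagonalDelta J x)) := by
      constructor
      intro Z g g' h
      have e₁ := congrArg (fun t => biprod.inl ≫ t) h
      have e₂ := congrArg (fun t => biprod.inr ≫ t) h
      simp only [biprod.inl_desc_assoc, biprod.inr_desc_assoc] at e₁ e₂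
      ext w
      rw [← cancel_epi (delπ x (diagonal J) w)]
      have ht : fst x w ≫ lift (𝟙 x) (0 : x ⟶ w) + snd x w ≫ incl x w = 𝟙 (x ⊗ w) := by
        rw [additive_incl]
        apply CartesianMonoidalCategory.hom_ext <;> simp
      have hJ : 𝟙 ((J.obj (x ⊗ w)).obj (x ⊗ w)) =
          (J.map (fst x w)).app (x ⊗ w) ≫ (J.map (lift (𝟙 x) (0 : x ⟶ w))).app (x ⊗ w) +
          (J.map (snd x w)).app (x ⊗ w) ≫ (J.map (incl x w)).app (x ⊗ w) := by
        rw [← NatTrans.comp_app, ← NatTrans.comp_app, ← J.map_comp, ← J.map_comp,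
          ← NatTrans.app_add, ← J.map_add, ht, J.map_id]
        rfl
      have e₁' : (J.map (lift (𝟙 x) (0 : x ⟶ w))).app (x ⊗ w) ≫ delπ x (diagonal J) w ≫ g.app w =
          (J.map (lift (𝟙 x) (0 : x ⟶ w))).app (x ⊗ w) ≫ delπ x (diagonal J) w ≫ g'.app w := by
        have := congrArg (fun t => NatTrans.app t w) e₁
        simpa only [NatTrans.comp_app, tauToDelta, Category.assoc] using this
      have e₂' : (J.map (incl x w)).app (x ⊗ w) ≫ delπ x (diagonal J) w ≫ g.app w =
          (J.map (incl x w)).app (x ⊗ w) ≫ delπ x (diagonal J) w ≫ g'.app w := by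
        have h : (diagonalDelta J x).app w ≫ g.app w = (diagonalDelta J x).app w ≫ g'.app w :=
          congrArg (fun t => NatTrans.app t w) e₂
        rw [← reassoc_of% delπ_diagonalDelta, ← reassoc_of% delπ_diagonalDelta, h]
      refine (Category.id_comp _).symm.trans (Eq.trans ?_ (Category.id_comp _))
      change 𝟙 ((J.obj (x ⊗ w)).obj (x ⊗ w)) ≫ _ = 𝟙 ((J.obj (x ⊗ w)).obj (x ⊗ w)) ≫ _
      rw [hJ, Preadditive.add_comp, Preadditive.add_comp]
      simp only [Category.assoc]
      rw [e₁', e₂']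
    exact (degLT A B (n + 1)).prop_of_epi (biprod.desc (tauToDelta J x) (diagonalDelta J x))
      ((degLT A B (n + 1)).prop_biprod h₂ h₁)

end AdditiveDegree

/-! ### Nice functors: locality, rigidity, stability under diagonals and limits. -/

section Nice

variable {A : Type v} [SmallCategory A] [Preadditive A] [HasFiniteBiproducts A]
  {B : Type u} [Category.{v} B] [Abelian B] [IsGrothendieckAbelian.{v} B]

open CartesianMonoidalCategory

namespace Duality

variable {d : Duality A} {k : FormKind} {ε : ℤˣ}

open Herm

namespace Family

variable {F : d.Herm k ε ⥤ B} {J : A ⥤ A ⥤ B}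

lemma comp_left (ψ : Family F J) {x y : d.Herm k ε} (g : x ⟶ y) :
    deltaMap g F ≫ ψ.comp y = ψ.comp x ≫ (res B d k ε).map (J.map g.hom) :=
  raw_ext fun w => by rw [raw_deltaMap, raw_comp, ψ.left, Duality.raw_comp, raw_comp]

lemma comp_flat {F' : d.Herm k ε ⥤ B} (s : F ⟶ F') (ψ : Family F J) (ψ' : Family F' J)
    (h : ∀ x w, s.app (x ⊗ w) ≫ ψ'.app x w = ψ.app x w) : s ≫ ψ'.flat = ψ.flat := by
  apply appA_ext
  intro z
  rw [appA_comp, appA_flat, appA_flat, ← reassoc_of% s.naturality, reassoc_of% h]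

lemma app_comp_sharp {F' : d.Herm k ε ⥤ B} [J.Additive] (s : F ⟶ F')
    (f : F' ⟶ (res B d k ε).obj (diagonal J)) (x : d.Herm k ε) :
    (delta x).map s ≫ (sharp f).comp x = (sharp (s ≫ f)).comp x :=
  raw_ext fun w => by
    rw [raw_delta_map, raw_comp, raw_comp, sharp_app, sharp_app, appA_comp, Category.assoc]

end Family

/-- If s is an isomorphism modulo degree < n + 1, then δₓ s is one modulo degree < n. Polarizations
therefore extend uniquely along δₓ s, and uniqueness makes the extensions a family; `flat` of this
family extends f because `flat_sharp` holds. -/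
lemma isLocal_diagonal (n : ℕ) (J : A ⥤ A ⥤ B) [J.Additive]
    (hJ : ∀ a, (degIso (d.Herm k ε) B n).isLocal ((res B d k ε).obj (J.obj a))) :
    (degIso (d.Herm k ε) B (n + 1)).isLocal ((res B d k ε).obj (diagonal J)) := by
  intro F F' s hs
  have hx : ∀ x : d.Herm k ε, Function.Bijective
      fun g : (delta x).obj F' ⟶ (res B d k ε).obj (J.obj x.obj) => (delta x).map s ≫ g :=
    fun x => hJ x.obj _ (degIso_delta n x hs)
  constructor
  · intro f g h
    have h' : s ≫ f = s ≫ g := h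
    rw [← Family.flat_sharp f, ← Family.flat_sharp g]
    congr 1
    ext x w
    have : (Family.sharp f).comp x = (Family.sharp g).comp x := (hx x).1 (by
      change (delta x).map s ≫ _ = (delta x).map s ≫ _
      rw [Family.app_comp_sharp, Family.app_comp_sharp, h'])
    rw [← Family.raw_comp, this, Family.raw_comp]
  · intro f
    choose ψ hψ using fun x => (hx x).2 ((Family.sharp f).comp x)
    have hψ' : ∀ x, (delta x).map s ≫ ψ x = (Family.sharp f).comp x := hψ
    have hn : ∀ {x y : d.Herm k ε} (g : x ⟶ y), deltaMap g F' ≫ ψ y =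
        ψ x ≫ (res B d k ε).map (J.map g.hom) := fun {x y} g =>
      (hJ y.obj _ (degIso_delta n x hs)).1 (by
        change (delta x).map s ≫ _ = (delta x).map s ≫ _
        rw [← reassoc_of% deltaMap_naturality g s, hψ', reassoc_of% hψ' x, Family.comp_left])
    refine ⟨(Family.mk' ψ hn).flat, ?_⟩
    change s ≫ _ = f
    rw [Family.comp_flat s (Family.sharp f) (Family.mk' ψ hn), Family.flat_sharp]
    intro x w
    rw [← Family.raw_comp (Family.sharp f), ← hψ', raw_delta_map]
    rfl

/-- The values of a morphism `π^* G ⟶ π^* I`. -/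
def appAA {G I : A ⥤ B} (f : (res B d k ε).obj G ⟶ (res B d k ε).obj I) (x : d.Herm k ε) :
    G.obj x.obj ⟶ I.obj x.obj := f.app x

variable (d k ε) in
/-- The functors `I` such that the morphisms `π^* G ⟶ π^* I`, where `G` has degree `≤ n`, are
natural with respect to all the morphisms of `A`. -/
def Rigid (n : ℕ) (I : A ⥤ B) : Prop :=
  ∀ (G : A ⥤ B), degLT A B (n + 1) G → ∀ (f : (res B d k ε).obj G ⟶ (res B d k ε).obj I)
    {x y : d.Herm k ε} (h : x.obj ⟶ y.obj), G.map h ≫ appAA f y = appAA f x ≫ I.map h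

variable (d k ε) in
/-- The functors on `A` whose restriction has good mapping properties modulo functors of
degree `< n`. -/
structure IsNice (n : ℕ) (I : A ⥤ B) : Prop where
  degLT : degLT A B (n + 1) I
  isLocal : (degIso (d.Herm k ε) B n).isLocal ((res B d k ε).obj I)
  rigid : Rigid d k ε n I

section Rigid

variable {n : ℕ} {J : A ⥤ A ⥤ B} {G : A ⥤ B}

namespace Family

/-- The values of a family on a restricted functor. -/
def appA' (ψ : Family ((res B d k ε).obj G) J) (x w : d.Herm k ε) :
    G.obj (x.obj ⊗ w.obj) ⟶ (J.obj x.obj).obj w.obj := ψ.app x w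

/-- For a restricted functor, δₓ π^*G is π^*δₓ G with δₓ G of degree ≤ n, so rigidity of J(x, -)
applies to each member of the family. -/
lemma right_of_rigid (ψ : Family ((res B d k ε).obj G) J) (hG : degLT A B (n + 2) G)
    (hJ : ∀ a, Rigid d k ε n (J.obj a)) (x : d.Herm k ε) {w w' : d.Herm k ε}
    (h : w.obj ⟶ w'.obj) :
    G.map (x.obj ◁ h) ≫ ψ.appA' x w' = ψ.appA' x w ≫ (J.obj x.obj).map h := by
  let f := (resDelta x G).inv ≫ ψ.comp x
  have hf : ∀ w, delπ x.obj G w.obj ≫ appAA f w = ψ.appA' x w := fun w => by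
    have e : (resTau x G).hom ≫ (res B d k ε).map (deltaπ x.obj G) ≫ f =
        deltaπ x ((res B d k ε).obj G) ≫ ψ.comp x := by
      rw [← reassoc_of% deltaπ_resDelta, Iso.hom_inv_id_assoc]
    have := congrArg (fun t => NatTrans.app t w) e
    refine (Category.id_comp _).symm.trans (this.trans ?_)
    exact ψ.raw_comp x w
  rw [← hf, reassoc_of% map_delπ x.obj G h,
    hJ x.obj _ ((degLT_succ_iff (n + 1) G).1 hG x.obj) f h, ← hf, Category.assoc]

variable [J.Additive]

/-- Lift h to g : x ⟶ y ⊕ t. Naturality for g is given, and `app_hfst` replaces the projection of y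
⊕ t in the first variable by one of t ⊕ w in the second, where `right_of_rigid` applies. -/
lemma left_of_rigid (ψ : Family ((res B d k ε).obj G) J) (hG : degLT A B (n + 2) G)
    (hJ : ∀ a, Rigid d k ε n (J.obj a))
    (hJ' : ∀ a, (degIso (d.Herm k ε) B n).isLocal ((res B d k ε).obj (J.obj a)))
    {x y : d.Herm k ε} (h : x.obj ⟶ y.obj) (w : d.Herm k ε) :
    G.map (h ▷ w.obj) ≫ ψ.appA' y w = ψ.appA' x w ≫ (J.map h).app w.obj := by
  obtain ⟨t, g, hg⟩ := exists_lift (d := d) (k := k) (ε := ε) h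
  have e₁ := ψ.app_hfst (degLT_res (n + 2) hG) (hJ' y.obj) t w
  have e₂ := ψ.left g w
  have e₃ : (J.map h).app w.obj = (J.map g.hom).app w.obj ≫ (J.map (hfst y t)).app w.obj := by
    rw [map_app_map]
    exact congrArg (fun t => (J.map t).app w.obj) hg.symm
  rw [e₃]
  have e₆ : G.map (g.hom ▷ w.obj) ≫ ψ.app (y ⊗ t) w ≫ (J.map (hfst y t)).app w.obj =
      ψ.appA' x w ≫ (J.map g.hom).app w.obj ≫ (J.map (hfst y t)).app w.obj := by
    have := congrArg (fun s => s ≫ (J.map (hfst y t)).app w.obj) e₂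
    simp only [Category.assoc] at this
    exact this
  refine Eq.trans ?_ ((congrArg (fun s => G.map (g.hom ▷ w.obj) ≫ s) e₁.symm).trans e₆)
  have e₄ := ψ.right_of_rigid hG hJ y (hsnd t w)
  refine Eq.trans ?_ (congrArg (fun s => G.map (g.hom ▷ w.obj) ≫
    G.map (α_ y.obj t.obj w.obj).hom ≫ s) e₄)
  have e₅ : h ▷ w.obj = g.hom ▷ w.obj ≫ (α_ y.obj t.obj w.obj).hom ≫
      y.obj ◁ snd t.obj w.obj := by
    rw [← hg]
    apply CartesianMonoidalCategory.hom_ext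
    · refine (whiskerRight_fst _ _).trans ?_
      have : g.hom ▷ w.obj ≫ (α_ y.obj t.obj w.obj).hom ≫ fst _ _ =
        fst x.obj w.obj ≫ g.hom ≫ fst y.obj t.obj := by
        rw [associator_hom_fst]
        exact (whiskerRight_fst_assoc _ _ _)
      rw [← this]
      simp
    · refine (whiskerRight_snd _ _).trans ?_
      have : g.hom ▷ w.obj ≫ (α_ y.obj t.obj w.obj).hom ≫ snd _ _ ≫ snd _ _ =
        snd x.obj w.obj := by
        rw [associator_hom_snd_snd]
        exact (whiskerRight_snd _ _)
      rw [← this]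
      simp
  rw [e₅, G.map_comp, G.map_comp]
  simp only [Category.assoc]
  rfl

end Family

/-- With naturality in both variables available, f at z is G of the true diagonal z ⟶ z ⊕ z of A
followed by the polarization, an expression natural over A. -/
lemma rigid_diagonal [J.Additive] (hJ : ∀ a, Rigid d k ε n (J.obj a))
    (hJ' : ∀ a, (degIso (d.Herm k ε) B n).isLocal ((res B d k ε).obj (J.obj a))) :
    Rigid d k ε (n + 1) (diagonal J) := by
  intro G hG f x y h
  let ψ := Family.sharp f
  have hf : ∀ z, appAA f z = G.map (lift (𝟙 z.obj) (𝟙 z.obj)) ≫ ψ.appA' z z := fun z => by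
    have e : f.app z = _ := (congrArg (fun t => appA t z) (Family.flat_sharp f)).symm
    refine e.trans ?_
    rw [Family.appA_flat]
    refine (congrArg (fun s => G.map (lift (𝟙 z.obj) (lift (𝟙 z.obj) (𝟙 z.obj))) ≫ s)
      (ψ.right_of_rigid hG hJ z (w := z ⊗ (neg d k ε).obj z) (fst z.obj z.obj)).symm).trans ?_
    have e' : lift (𝟙 z.obj) (lift (𝟙 z.obj) (𝟙 z.obj)) ≫ z.obj ◁ fst z.obj z.obj =
        lift (𝟙 z.obj) (𝟙 z.obj) := by
      apply CartesianMonoidalCategory.hom_ext <;> simp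
    refine Eq.trans ?_ (congrArg (fun s => G.map s ≫ ψ.appA' z z) e')
    rw [G.map_comp, Category.assoc]
    rfl
  have e : h ≫ lift (𝟙 y.obj) (𝟙 y.obj) =
      lift (𝟙 x.obj) (𝟙 x.obj) ≫ h ▷ x.obj ≫ y.obj ◁ h := by
    apply CartesianMonoidalCategory.hom_ext <;> simp
  rw [hf, hf, ← G.map_comp_assoc, e, G.map_comp, G.map_comp, Category.assoc, Category.assoc,
    ψ.right_of_rigid hG hJ, reassoc_of% ψ.left_of_rigid hG hJ hJ' h x, Category.assoc]

lemma isNice_diagonal [J.Additive] (hJ : ∀ a, IsNice d k ε n (J.obj a)) :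
    IsNice d k ε (n + 1) (diagonal J) where
  degLT := degLT_diagonal J fun a => (hJ a).degLT
  isLocal := isLocal_diagonal n J fun a => (hJ a).isLocal
  rigid := rigid_diagonal (fun a => (hJ a).rigid) fun a => (hJ a).isLocal

end Rigid

lemma appAA_comp_res {G I I' : A ⥤ B} (f : (res B d k ε).obj G ⟶ (res B d k ε).obj I)
    (g : I ⟶ I') (x : d.Herm k ε) : appAA (f ≫ (res B d k ε).map g) x = appAA f x ≫ g.app x.obj :=
  rfl

lemma Rigid.of_jointlyMono {n : ℕ} {ι : Type*} {I : A ⥤ B} {I' : ι → A ⥤ B} {g : ∀ i, I ⟶ I' i}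
    (hg : JointlyMono g) (h : ∀ i, Rigid d k ε n (I' i)) : Rigid d k ε n I := by
  intro G hG f x y t
  rw [← sub_eq_zero]
  refine hg _ _ fun i => ?_
  have := h i G hG (f ≫ (res B d k ε).map (g i)) t
  rw [appAA_comp_res, appAA_comp_res] at this
  rw [Preadditive.sub_comp, Category.assoc, Category.assoc, NatTrans.naturality, this, Category.assoc, sub_self]

lemma jointlyMono_of_isLimit {K : Type*} [Category* K] {D : K ⥤ A ⥤ B} {c : Cone D}
    [∀ a, PreservesLimit D ((evaluation A B).obj a)] (hc : IsLimit c) : JointlyMono c.π.app := by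
  intro a Z φ h
  refine (isLimitOfPreserves ((evaluation A B).obj a) hc).hom_ext fun i => ?_
  rw [zero_comp]
  exact h i

lemma IsNice.of_isLimit {K : Type v} [SmallCategory K] {n : ℕ} {D : K ⥤ A ⥤ B} {c : Cone D}
    (hc : IsLimit c) (h : ∀ i, IsNice d k ε n (D.obj i)) : IsNice d k ε n c.pt := by
  have := IsGrothendieckAbelian.hasLimits (C := B)
  have hj := jointlyMono_of_isLimit hc
  exact
  { degLT := hj.degLT fun i => (h i).degLT
    isLocal := by
      have hc' := isLimitOfPreserves (res B d k ε) hc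
      exact ObjectProperty.prop_of_isLimit _ hc' fun i => (h i).isLocal
    rigid := .of_jointlyMono hj fun i => (h i).rigid }

end Duality
end Nice
-- The object Hom(N, I) of additive maps from a group.
section AddPow

variable {C : Type*} [Category* C] [Preadditive C] [HasProducts.{v} C] [HasKernels C]

/-- The morphism whose kernel is `addPow`. -/
noncomputable def addPowMap (N : Type v) [AddCommGroup N] (I : C) :
    (∏ᶜ fun _ : N => I) ⟶ ∏ᶜ fun _ : N × N => I :=
  Pi.lift fun p => Pi.π (fun _ : N => I) (p.1 + p.2) - Pi.π (fun _ : N => I) p.1 -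
    Pi.π (fun _ : N => I) p.2

lemma addPowMap_π (N : Type v) [AddCommGroup N] (I : C) (m m' : N) :
    addPowMap N I ≫ Pi.π (fun _ : N × N => I) (m, m') = Pi.π (fun _ : N => I) (m + m') -
      Pi.π (fun _ : N => I) m - Pi.π (fun _ : N => I) m' :=
  Limits.Pi.lift_π _ _

/-- The object of the additive maps from a group to an object. -/
noncomputable abbrev addPow (N : Type v) [AddCommGroup N] (I : C) : C := kernel (addPowMap N I)

namespace addPow

variable {N : Type v} [AddCommGroup N] {I : C}

/-- The evaluations. -/
noncomputable def π (m : N) : addPow N I ⟶ I := kernel.ι (addPowMap N I) ≫ Pi.π (fun _ : N => I) m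

lemma π_add (m m' : N) : (π (m + m') : addPow N I ⟶ I) = π m + π m' := by
  have h := congrArg (fun t => t ≫ Pi.π (fun _ : N × N => I) (m, m')) (kernel.condition (addPowMap N I))
  simp only [Category.assoc, addPowMap_π, zero_comp, Preadditive.comp_sub] at h
  rw [sub_sub, sub_eq_zero] at h
  exact h

lemma hom_ext {Z : C} {f g : Z ⟶ addPow N I} (h : ∀ m, f ≫ π m = g ≫ π m) : f = g := by
  apply (cancel_mono (kernel.ι (addPowMap N I))).1
  refine Pi.hom_ext _ _ fun m => ?_
  rw [Category.assoc, Category.assoc]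
  exact h m

/-- The morphism given by an additive map. -/
noncomputable def lift {Z : C} (φ : N →+ (Z ⟶ I)) : Z ⟶ addPow N I :=
  kernel.lift _ (Pi.lift φ) (Pi.hom_ext _ _ fun p => by simp [addPowMap])

@[simp]
lemma lift_π {Z : C} (φ : N →+ (Z ⟶ I)) (m : N) : lift φ ≫ π m = φ m := by
  simp [lift, π]

variable {C' : Type*} [Category* C'] [Preadditive C'] (R : C ⥤ C') [R.Additive] [R.IsRightAdjoint]

/-- An additive right adjoint preserves the universal property of `addPow`; this half is uniqueness,
`exists_map_lift` is existence. It is applied to `res`. -/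
lemma map_hom_ext {Z : C'} {f g : Z ⟶ R.obj (addPow N I)}
    (h : ∀ m : N, f ≫ R.map (π m) = g ≫ R.map (π m)) : f = g := by
  let adj := Adjunction.ofIsRightAdjoint R
  apply (adj.homEquiv _ _).symm.injective
  refine hom_ext fun m => ?_
  rw [← adj.homEquiv_naturality_right_symm, ← adj.homEquiv_naturality_right_symm, h]

lemma exists_map_lift {Z : C'} (φ : N →+ (Z ⟶ R.obj I)) :
    ∃ f : Z ⟶ R.obj (addPow N I), ∀ m, f ≫ R.map (π m) = φ m := by
  let adj := Adjunction.ofIsRightAdjoint R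
  let φ' : N →+ (R.leftAdjoint.obj Z ⟶ I) := AddMonoidHom.mk' (fun m => (adj.homEquiv _ _).symm (φ m)) (by
    intro m m'
    apply (adj.homEquiv _ _).injective
    rw [Equiv.apply_symm_apply, adj.homEquiv_unit, R.map_add, Preadditive.comp_add,
      ← adj.homEquiv_unit, ← adj.homEquiv_unit, Equiv.apply_symm_apply, Equiv.apply_symm_apply,
      map_add])
  refine ⟨adj.homEquiv _ _ (lift φ'), fun m => ?_⟩
  rw [← adj.homEquiv_naturality_right, lift_π]
  exact Equiv.apply_symm_apply _ _

end addPow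

/-- The functor `a ↦ Hom(A(a, p), I)`. -/
noncomputable abbrev powFunctor {A : Type*} [Category.{v} A] [Preadditive A] (p : A) (I : C) : A ⥤ C where
  obj a := addPow (a ⟶ p) I
  map f := addPow.lift (AddMonoidHom.mk' (fun h => addPow.π (f ≫ h)) (by
    intro h h'
    rw [Preadditive.comp_add, addPow.π_add]))
  map_id a := addPow.hom_ext fun h => by simp
  map_comp f g := addPow.hom_ext fun h => by simp

lemma powFunctor_map_π {A : Type*} [Category.{v} A] [Preadditive A] (p : A) (I : C) {a b : A}
    (f : a ⟶ b) (h : b ⟶ p) : (powFunctor p I).map f ≫ addPow.π h = addPow.π (f ≫ h) :=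
  addPow.lift_π _ _

instance {A : Type*} [Category.{v} A] [Preadditive A] (p : A) (I : C) :
    (powFunctor p I).Additive where
  map_add {a b f g} := addPow.hom_ext fun h => by
    rw [Preadditive.add_comp, powFunctor_map_π, powFunctor_map_π, powFunctor_map_π,
      Preadditive.add_comp, addPow.π_add]

end AddPow

/-! ### Embedding functors on H(A): the inductive step. -/

section Embedding

variable {A : Type v} [SmallCategory A] [Preadditive A] [HasFiniteBiproducts A]
  {B : Type u} [Category.{v} B] [Abelian B] [IsGrothendieckAbelian.{v} B]

namespace Duality

variable {d : Duality A} {k : FormKind} {ε : ℤˣ}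

open Herm

instance : (res B d k ε).IsRightAdjoint :=
  (Functor.lanAdjunction (Herm.forget d k ε) B).isRightAdjoint

instance hasLimits_base : HasLimitsOfSize.{v, v} B := IsGrothendieckAbelian.hasLimits B

lemma IsNice.limit {K : Type v} [SmallCategory K] {n : ℕ} {D : K ⥤ A ⥤ B}
    (h : ∀ i, IsNice d k ε n (D.obj i)) : IsNice d k ε n (limit D) :=
  .of_isLimit (limit.isLimit D) h

lemma IsNice.kernel {n : ℕ} {I I' : A ⥤ B} (f : I ⟶ I') (h : IsNice d k ε n I)
    (h' : IsNice d k ε n I') : IsNice d k ε n (kernel f) where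
  degLT := (StablePol.degLT A B (n + 1)).prop_of_mono (kernel.ι f) h.degLT
  isLocal := by
    refine ObjectProperty.prop_of_iso _ (PreservesKernel.iso (res B d k ε) f).symm ?_
    refine ObjectProperty.prop_of_isLimit _ (limit.isLimit _) ?_
    rintro (_ | _)
    exacts [h.isLocal, h'.isLocal]
  rigid := by
    refine .of_jointlyMono (g := fun _ : Unit => kernel.ι f) (fun a Z φ hφ => ?_) fun _ => h.rigid
    have : Mono ((kernel.ι f).app a) := inferInstance
    rw [← cancel_mono ((kernel.ι f).app a), zero_comp]
    exact hφ ()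

lemma IsNice.addPow {n : ℕ} {I : A ⥤ B} (h : IsNice d k ε n I) (N : Type v) [AddCommGroup N] :
    IsNice d k ε n (addPow N I) :=
  .kernel _ (.limit fun _ => h) (.limit fun _ => h)

lemma extends_delta {n : ℕ} {F K : d.Herm k ε ⥤ B} (hF : degLT _ B (n + 2) F)
    (hK : (degIso _ B n).isLocal K) : Extends (deltaFunctor F) K where
  eq_zero u h₁ h₂ := delta_eq_zero_of_isLocal hF hK u h₁ h₂
  exists_extension θ t := exists_delta_extension hF hK θ t

lemma Family.mk'_comp {F : d.Herm k ε ⥤ B} {J : A ⥤ A ⥤ B}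
    (ψ : ∀ x : d.Herm k ε, (delta x).obj F ⟶ (res B d k ε).obj (J.obj x.obj))
    (h : ∀ {x y : d.Herm k ε} (g : x ⟶ y), deltaMap g F ≫ ψ y =
      ψ x ≫ (res B d k ε).map (J.map g.hom)) (x : d.Herm k ε) : (Family.mk' ψ h).comp x = ψ x :=
  raw_ext fun w => Family.raw_comp (Family.mk' ψ h) x w

/-- Over x the family sends f : x ⟶ p to θ acted on by f. Evaluation at the identity of p returns θ.
-/
lemma exists_family {n : ℕ} {F : d.Herm k ε ⥤ B} (hF : degLT _ B (n + 2) F) {I : A ⥤ B}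
    (hI : IsNice d k ε n I) {p : d.Herm k ε} (θ : (delta p).obj F ⟶ (res B d k ε).obj I) :
    ∃ ψ : Family F (powFunctor p.obj I),
      ψ.comp p ≫ (res B d k ε).map (addPow.π (𝟙 p.obj)) = θ := by
  have hE := extends_delta hF hI.isLocal
  let θ' : (deltaFunctor F).obj p ⟶ (res B d k ε).obj I := θ
  let φ (x : d.Herm k ε) : (x.obj ⟶ p.obj) →+ ((delta x).obj F ⟶ (res B d k ε).obj I) :=
    AddMonoidHom.mk' (fun f => hE.act f θ') fun f g => hE.act_add f g θ'
  choose ψ hψ using fun x => addPow.exists_map_lift (res B d k ε) (φ x)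
  refine ⟨Family.mk' ψ fun {x y} g => addPow.map_hom_ext (res B d k ε) fun h => ?_, ?_⟩
  · rw [Category.assoc, Category.assoc, hψ]
    have e : (res B d k ε).map ((powFunctor p.obj I).map g.hom) ≫ (res B d k ε).map (addPow.π h) =
        (res B d k ε).map (addPow.π (g.hom ≫ h)) := by
      rw [← Functor.map_comp, powFunctor_map_π]
    refine Eq.trans ?_ (congrArg (fun t => ψ x ≫ t) e.symm)
    refine Eq.trans ?_ (hψ x _).symm
    exact hE.map_comp_act g h θ'
  · rw [Family.mk'_comp, hψ]
    exact hE.act_id θ'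

end Duality
end Embedding

section MonoDelta

variable {M : Type v} [SmallCategory M] [MonoidalCategory M] [InitialUnit M] [SymmetricCategory M]
  {B : Type u} [Category.{v} B] [Abelian B] [IsGrothendieckAbelian.{v} B]

/-- Exactness of δₓ is only available in the stable category, so monomorphisms survive up to a
stably null kernel. -/
lemma stablyNull_kernel_delta_map (x : M) {F G : M ⥤ B} (f : F ⟶ G) [Mono f] :
    stablyNull M B (kernel ((delta x).map f)) := by
  rw [← (stablyNull M B).monoModSerre_iff,
    ← ObjectProperty.SerreClassLocalization.mono_map_iff (toSt M B) (stablyNull M B)]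
  have h : Mono ((stDelta M B x).map ((toSt M B).map f)) := inferInstance
  have e : (toSt M B).map ((delta x).map f) = (stDeltaIsoApp x F).inv ≫
      (stDelta M B x).map ((toSt M B).map f) ≫ (stDeltaIsoApp x G).hom := by
    rw [stDeltaIsoApp_naturality, Iso.inv_hom_id_assoc]
  rw [e]
  exact mono_comp' inferInstance (mono_comp' h inferInstance)

/-- δₓ F maps to the kernel of θ, and the kernel of this map is stably null by
`stablyNull_kernel_delta_map`. -/
lemma degLT_of_delta_comp_eq_zero {n : ℕ} (x : M) {F G K : M ⥤ B} (f : F ⟶ G) [Mono f]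
    (θ : (delta x).obj G ⟶ K) (hθ : degLT M B n (kernel θ)) (h : (delta x).map f ≫ θ = 0) :
    degLT M B n ((delta x).obj F) := by
  have e : (ShortComplex.mk (kernel.ι (kernel.lift θ ((delta x).map f) h))
      (kernel.lift θ ((delta x).map f) h) (kernel.condition _)).Exact :=
    ShortComplex.exact_kernel _
  refine (degLT M B n).prop_X₂_of_exact e ?_ hθ
  refine (degLT M B n).prop_of_mono (kernel.lift ((delta x).map f)
    (kernel.ι (kernel.lift θ ((delta x).map f) h)) ?_)
    (degLT_of_stablyNull n (stablyNull_kernel_delta_map x f))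
  refine (congrArg (fun t => kernel.ι (kernel.lift θ ((delta x).map f) h) ≫ t)
    (kernel.lift_ι θ ((delta x).map f) h)).symm.trans ?_
  rw [kernel.condition_assoc, zero_comp]

end MonoDelta

section Embedding

variable {A : Type v} [SmallCategory A] [Preadditive A] [HasFiniteBiproducts A]
  {B : Type u} [Category.{v} B] [Abelian B] [IsGrothendieckAbelian.{v} B]

namespace Duality

variable {d : Duality A} {k : FormKind} {ε : ℤˣ}

open Herm

/-- The target is the product over all y of the diagonals of Hom(A(-, y), I_y), where δ_y F ⟶ π^*I_y
comes from the induction hypothesis. -/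
lemma exists_embedding_succ {n : ℕ} (ih : ∀ F : d.Herm k ε ⥤ B, degLT _ B (n + 1) F →
      ∃ (I : A ⥤ B) (_ : IsNice d k ε n I) (η : F ⟶ (res B d k ε).obj I),
        degLT _ B n (kernel η))
    {F : d.Herm k ε ⥤ B} (hF : degLT _ B (n + 2) F) :
    ∃ (I : A ⥤ B) (_ : IsNice d k ε (n + 1) I) (η : F ⟶ (res B d k ε).obj I),
      degLT _ B (n + 1) (kernel η) := by
  choose I hI θ hθ using fun y => ih _ ((degLT_succ_iff (n + 1) F).1 hF y)
  choose ψ hψ using fun y => exists_family hF (hI y) (θ y)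
  have hJ : ∀ y a, IsNice d k ε n ((powFunctor y.obj (I y)).obj a) := fun y a =>
    (hI y).addPow (a ⟶ y.obj)
  let D : d.Herm k ε → A ⥤ B := fun y => diagonal (powFunctor y.obj (I y))
  let adj := Adjunction.ofIsRightAdjoint (res B d k ε)
  let η : F ⟶ (res B d k ε).obj (∏ᶜ D) :=
    adj.homEquiv _ _ (Pi.lift fun y => (adj.homEquiv _ _).symm (ψ y).flat)
  have hη : ∀ y, η ≫ (res B d k ε).map (Pi.π D y) = (ψ y).flat := fun y => by
    rw [← adj.homEquiv_naturality_right, Limits.Pi.lift_π, Equiv.apply_symm_apply]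
  refine ⟨∏ᶜ D, .limit fun y => isNice_diagonal fun a => hJ y.as a, η, ?_⟩
  rw [degLT_succ_iff]
  intro y
  refine degLT_of_delta_comp_eq_zero y (kernel.ι η) (θ y) (hθ y) ?_
  rw [← hψ y, ← Category.assoc]
  have h₁ : kernel.ι η ≫ (ψ y).flat = 0 := by
    rw [← hη, kernel.condition_assoc, zero_comp]
  -- By `sharp_flat`, the family at y is a polarization of a component of η, so it vanishes on δ_y
  -- of the kernel. Hence so does θ y.
  have h₂ : (delta y).map (kernel.ι η) ≫ (ψ y).comp y = 0 := by
    rw [← (ψ y).sharp_flat hF fun x => (hJ y x.obj).isLocal, Family.app_comp_sharp, h₁]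
    refine raw_ext fun w => ?_
    rw [Family.raw_comp, Family.sharp_app]
    refine (congrArg (fun t => t ≫ _) (?_ : appA (0 : kernel η ⟶ _) (y ⊗ w) = 0)).trans ?_
    · rfl
    · rw [zero_comp]
      rw [raw, comp_zero]
      rfl
  rw [h₂, zero_comp]

end Duality
end Embedding
-- Degree zero: torsion-free quotients and constant functors.
section TorsionFree

variable {M : Type v} [SmallCategory M] [MonoidalCategory M] [InitialUnit M] [SymmetricCategory M]
  {B : Type u} [Category.{v} B] [Abelian B] [IsGrothendieckAbelian.{v} B]

lemma comp_iotaApp {F G : M ⥤ B} (f : F ⟶ G) (x : M) :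
    f ≫ iotaApp x G = iotaApp x F ≫ (tau M B x).map f :=
  (iota M B x).naturality f

lemma eq_zero_of_stablyNull {N T : M ⥤ B} (hN : stablyNull M B N) (hT : ∀ x, Mono (iotaApp x T))
    (f : N ⟶ T) : f = 0 := by
  refine stablyNull_ext hN _ _ fun x => ?_
  have := hT x
  rw [← cancel_mono (iotaApp x T), Category.assoc, comp_iotaApp, kernel.condition_assoc,
    zero_comp, comp_zero, zero_comp]

/-- This kernel is κ(F), which is covered by the κₓ(F). -/
lemma stablyNull_kernel_cokernel (F : M ⥤ B) : stablyNull M B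
    (kernel (cokernel.π (Sigma.desc fun x : M => kernel.ι (iotaApp x F)))) := by
  let s := Sigma.desc fun x : M => kernel.ι (iotaApp x F)
  have hs : ∀ x, kernel.ι (iotaApp x F) ≫ cokernel.π s = 0 := fun x => by
    have : Sigma.ι (fun x : M => kap x F) x ≫ s = kernel.ι (iotaApp x F) := Sigma.ι_desc _ _
    rw [← this, Category.assoc, cokernel.condition, comp_zero]
  have he : Epi (Abelian.factorThruImage s) := inferInstance
  refine stablyNull_of_family (fun x : M => kap x F) (fun x => kernel.lift _ _ (hs x))
    (fun {Z} g h e => ?_) fun x => ⟨x, ?_⟩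
  · apply he.left_cancellation
    refine Sigma.hom_ext _ _ fun x => ?_
    have e' : Sigma.ι (fun x : M => kap x F) x ≫ Abelian.factorThruImage s =
        kernel.lift (cokernel.π s) (kernel.ι (iotaApp x F)) (hs x) := by
      rw [← cancel_mono (kernel.ι (cokernel.π s)), kernel.lift_ι, Category.assoc]
      exact (congrArg (fun t => Sigma.ι (fun x : M => kap x F) x ≫ t)
        (kernel.lift_ι (cokernel.π s) s (cokernel.condition s))).trans (Sigma.ι_desc _ _)
    rw [← Category.assoc, ← Category.assoc, e']
    exact e x
  · have := (tau M B x).map_mono (kernel.ι (cokernel.π s))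
    rw [← cancel_mono ((tau M B x).map (kernel.ι (cokernel.π s))), Category.assoc, ← comp_iotaApp,
      kernel.lift_ι_assoc, kernel.condition, zero_comp]

lemma comp_eq_zero_of_stablyNull {P F F' : M ⥤ B} (hP : stablyNull M B P) (j : P ⟶ F) (p : F ⟶ F')
    (hp : ∀ y, kernel.ι (iotaApp y F) ≫ p = 0) : j ≫ p = 0 := by
  refine stablyNull_ext hP _ _ fun y => ?_
  have h : (kernel.ι (iotaApp y P) ≫ j) ≫ iotaApp y F = 0 := by
    rw [Category.assoc, comp_iotaApp, kernel.condition_assoc, zero_comp]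
  rw [comp_zero, ← Category.assoc, ← kernel.lift_ι _ _ h, Category.assoc, hp, comp_zero]

/-- The preimage in F of κₓ(F') is an extension of stably null functors, hence stably null, hence
killed by p. -/
lemma mono_iotaApp_of_epi {F F' : M ⥤ B} (p : F ⟶ F') [Epi p] (hk : stablyNull M B (kernel p))
    (hp : ∀ y, kernel.ι (iotaApp y F) ≫ p = 0) (x : M) : Mono (iotaApp x F') := by
  let j := kernel.ι (p ≫ iotaApp x F')
  have hP : stablyNull M B (kernel (p ≫ iotaApp x F')) :=
    (stablyNull M B).monoModSerre.comp_mem p (iotaApp x F') hk (stablyNull_kap x F')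
  have h0 : j ≫ p = 0 := comp_eq_zero_of_stablyNull hP j p hp
  refine Preadditive.mono_of_cancel_zero _ fun {Z} φ hφ => ?_
  obtain ⟨Z', q, _, φ', h⟩ := surjective_up_to_refinements_of_epi p φ
  have h₁ : φ' ≫ p ≫ iotaApp x F' = 0 := by
    rw [← reassoc_of% h, hφ, comp_zero]
  rw [← cancel_epi q, h, ← kernel.lift_ι _ _ h₁, Category.assoc, comp_zero]
  exact (congrArg _ h0).trans comp_zero

lemma exists_torsionFree_quotient (F : M ⥤ B) : ∃ (F' : M ⥤ B) (p : F ⟶ F'), Epi p ∧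
    stablyNull M B (kernel p) ∧ ∀ x, Mono (iotaApp x F') := by
  let s := Sigma.desc fun x : M => kernel.ι (iotaApp x F)
  refine ⟨cokernel s, cokernel.π s, inferInstance, stablyNull_kernel_cokernel F,
    mono_iotaApp_of_epi (cokernel.π s) (stablyNull_kernel_cokernel F) fun y => ?_⟩
  have : Sigma.ι (fun x : M => kap x F) y ≫ s = kernel.ι (iotaApp y F) := Sigma.ι_desc _ _
  rw [← this, Category.assoc, cokernel.condition, comp_zero]

lemma degLT_zero_eq : degLT M B 0 = stablyNull M B :=
  funext fun F => propext (degLT_zero_iff F)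

/-- If the class of t in T/K is killed by iₓ, then iₓ(t) lies in τₓ K = iₓ(K), so t lies in K since
iₓ is monic on T. -/
lemma comp_cokernel_π_eq_zero {K T P : M ⥤ B} (q : K ⟶ T) [Mono q] {x : M}
    (hK : IsIso (iotaApp x K)) (hT : Mono (iotaApp x T)) (j : P ⟶ T)
    (hj : j ≫ cokernel.π q ≫ iotaApp x (cokernel q) = 0) : j ≫ cokernel.π q = 0 := by
  have hS : (ShortComplex.mk q (cokernel.π q) (cokernel.condition q)).Exact :=
    ShortComplex.exact_cokernel _
  have hS' := hS.map (tau M B x)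
  have hm : Mono ((tau M B x).map q) := inferInstance
  have hl : (j ≫ iotaApp x T) ≫ (tau M B x).map (cokernel.π q) = 0 := by
    rw [Category.assoc, ← comp_iotaApp, hj]
  obtain ⟨l, hl'⟩ : ∃ l, l ≫ (tau M B x).map q = j ≫ iotaApp x T :=
    have : Mono ((ShortComplex.mk q (cokernel.π q) (cokernel.condition q)).map (tau M B x)).f := hm
    ⟨hS'.lift (j ≫ iotaApp x T) hl, hS'.lift_f _ _⟩
  have hj' : j = l ≫ inv (iotaApp x K) ≫ q := by
    rw [← cancel_mono (iotaApp x T), ← hl', Category.assoc, Category.assoc, comp_iotaApp,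
      IsIso.inv_hom_id_assoc]
  rw [hj', Category.assoc, Category.assoc, cokernel.condition, comp_zero, comp_zero]

lemma isLocal_of_isIso_iotaApp {K : M ⥤ B} (hK : ∀ x, IsIso (iotaApp x K)) :
    (degIso M B 0).isLocal K := by
  intro F F' s hs
  have hs' : (stablyNull M B).isoModSerre s := isoModSerre_mono degLT_zero_eq.le hs
  have hK' : ∀ x, Mono (iotaApp x K) := fun x => inferInstance
  constructor
  · intro f g h
    have h' : s ≫ (f - g) = 0 := by
      rw [Preadditive.comp_sub, sub_eq_zero]
      exact h
    have := eq_zero_of_stablyNull hs'.2 hK' (cokernel.desc s (f - g) h')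
    rw [← sub_eq_zero, ← cokernel.π_desc s (f - g) h', this, comp_zero]
  · intro f
    -- To extend f along s, push out and pass to the torsion-free quotient T. Then K ⟶ T is monic
    -- with stably null cokernel, and the cokernel is zero by `comp_cokernel_π_eq_zero`; so K ⟶ T is
    -- invertible.
    have hP := IsPushout.of_hasPushout f s
    set i := pushout.inl f s
    have hi : (stablyNull M B).isoModSerre i :=
      (stablyNull M B).isoModSerre.of_isPushout hP hs'
    obtain ⟨T, p, hp, hkp, hT⟩ := exists_torsionFree_quotient (pushout f s)
    have hq : (stablyNull M B).isoModSerre (i ≫ p) :=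
      (stablyNull M B).isoModSerre.comp_mem _ _ hi ((stablyNull M B).isoModSerre_of_epi p hkp)
    have : Mono (i ≫ p) :=
      Preadditive.mono_of_kernel_zero (eq_zero_of_stablyNull hq.1 hK' _)
    let π := cokernel.π (i ≫ p)
    have hπ : π = 0 := refine_ext hq.2 π _ _ fun x =>
      (comp_cokernel_π_eq_zero (i ≫ p) (hK x) (hT x) _ (kernel.condition _)).trans comp_zero.symm
    have : Epi (i ≫ p) := Preadditive.epi_of_cokernel_zero hπ
    have : IsIso (i ≫ p) := isIso_of_mono_of_epi _
    refine ⟨pushout.inr f s ≫ p ≫ inv (i ≫ p), ?_⟩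
    change s ≫ _ = f
    rw [← reassoc_of% hP.w, ← Category.assoc, ← Category.assoc]
    simp

lemma isZero_delta_of_epi (x : M) {F : M ⥤ B} (h : Epi (iotaApp x F)) :
    IsZero ((delta x).obj F) := by
  have h0 : deltaπ x F = 0 := by
    rw [← cancel_epi (iotaApp x F), iotaApp_deltaπ, comp_zero]
  rw [IsZero.iff_id_eq_zero, ← cancel_epi (deltaπ x F), h0, zero_comp, zero_comp]

/-- The difference of the two maps τ_p F ⟶ τ_q F kills i_p, so it factors through the stably null
δ_p F, while τ_q F is torsion-free. Evaluation at the unit object concludes. -/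
lemma map_eq_of_degLT_one {F : M ⥤ B} (hF : degLT M B 1 F)
    (hm : ∀ {x y : M} (g : x ⟶ y), Mono (F.map g)) {p q : M} (α β : p ⟶ q) :
    F.map α = F.map β := by
  have h₁ : iotaApp p F ≫ (tauMap α F - tauMap β F) = 0 := by
    rw [Preadditive.comp_sub, iotaApp_tauMap, iotaApp_tauMap, sub_self]
  have h₂ : deltaDesc _ h₁ = 0 := by
    refine eq_zero_of_stablyNull ((degLT_zero_iff _).1 ((degLT_succ_iff 0 F).1 hF p)) (fun x => ?_) _
    have : ∀ z, Mono ((iotaApp x ((tau M B q).obj F)).app z) := fun z =>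
      hm (q ◁ incl x z)
    exact NatTrans.mono_of_mono_app _
  have h₃ : tauMap α F = tauMap β F := by
    rw [← sub_eq_zero, ← deltaπ_deltaDesc _ h₁, h₂, comp_zero]
  have h₄ : F.map (α ▷ 𝟙_ M) = F.map (β ▷ 𝟙_ M) := congrArg (fun t => NatTrans.app t (𝟙_ M)) h₃
  have e : ∀ γ : p ⟶ q, γ = (ρ_ p).inv ≫ γ ▷ 𝟙_ M ≫ (ρ_ q).hom := fun γ => by simp
  rw [e α, e β, F.map_comp, F.map_comp, F.map_comp, F.map_comp, h₄]

/-- The objects of a category, preordered by the existence of a morphism. -/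
structure PreObj (M : Type v) where
  obj : M

instance : Preorder (PreObj M) where
  le p q := Nonempty (p.obj ⟶ q.obj)
  le_refl p := ⟨𝟙 _⟩
  le_trans _ _ _ := fun ⟨f⟩ ⟨g⟩ => ⟨f ≫ g⟩

instance : Nonempty (PreObj M) := ⟨⟨𝟙_ M⟩⟩

instance : IsDirectedOrder (PreObj M) :=
  ⟨fun p q => ⟨⟨p.obj ⊗ q.obj⟩, ⟨inclLeft _ _⟩, ⟨incl _ _⟩⟩⟩

/-- F factors through the preorder of objects, which is directed by the monoidal product. By
exactness of filtered colimits the maps to the colimit are monic. -/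
lemma exists_mono_to_const {F : M ⥤ B} (hm : ∀ {x y : M} (g : x ⟶ y), Mono (F.map g))
    (hp : ∀ {x y : M} (α β : x ⟶ y), F.map α = F.map β) :
    ∃ (E : B) (η : F ⟶ (Functor.const M).obj E), Mono η := by
  let G : PreObj M ⥤ B :=
    { obj := fun p => F.obj p.obj
      map := fun h => F.map (leOfHom h).some
      map_id := fun p => (hp _ (𝟙 _)).trans (F.map_id _)
      map_comp := fun f g => (hp _ _).trans (F.map_comp _ _) }
  have : ∀ (p q : PreObj M) (φ : p ⟶ q), Mono (G.map φ) := fun p q φ => hm _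
  have : AB5OfSize.{v, v} B := inferInstance
  let η : F ⟶ (Functor.const M).obj (colimit G) :=
    { app := fun p => colimit.ι G ⟨p⟩
      naturality := fun p q g => by
        have h : F.map g = G.map (homOfLE (show (⟨p⟩ : PreObj M) ≤ ⟨q⟩ from ⟨g⟩)) := hp _ _
        rw [h]
        refine (colimit.w G _).trans (Category.comp_id _).symm }
  refine ⟨colimit G, η, ?_⟩
  have : ∀ p, Mono (η.app p) := fun p =>
    have := HasExactColimitsOfShape.preservesFiniteLimits (J := Under (⟨p⟩ : PreObj M)) (C := B)
    IsColimit.mono_ι_app_of_isFiltered (colimit.isColimit G) ⟨p⟩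
  exact NatTrans.mono_of_mono_app η

end TorsionFree

section Constant

variable {A : Type v} [SmallCategory A] [Preadditive A] [HasFiniteBiproducts A]
  {B : Type u} [Category.{v} B] [Abelian B] [IsGrothendieckAbelian.{v} B]

open CartesianMonoidalCategory

namespace Duality

variable {d : Duality A} {k : FormKind} {ε : ℤˣ}

open Herm

lemma isNice_const (E : B) : IsNice d k ε 0 ((Functor.const A).obj E) where
  degLT := by
    rw [degLT_succ_iff]
    intro x
    refine (degLT A B 0).prop_of_isZero (isZero_delta_of_epi x ?_)
    have : ∀ z, Epi ((iotaApp x ((Functor.const A).obj E)).app z) := fun z =>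
      inferInstanceAs (Epi (𝟙 E))
    exact NatTrans.epi_of_epi_app _
  isLocal := by
    refine isLocal_of_isIso_iotaApp fun x => ?_
    have : ∀ z, IsIso ((iotaApp x ((res B d k ε).obj ((Functor.const A).obj E))).app z) := fun z =>
      inferInstanceAs (IsIso (𝟙 E))
    exact NatIso.isIso_of_isIso_app _
  rigid := by
    intro G hG f x y h
    -- Since δ_t G = 0 over A, G sends y ⟶ y ⊕ t to a split epimorphism inverse to the image of the
    -- projection. Compatibility of f with the inclusion thus gives compatibility with the
    -- projection, hence with g followed by it.
    obtain ⟨t, g, rfl⟩ := exists_lift (d := d) (k := k) (ε := ε) h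
    have h₁ : Epi (G.map (incl t.obj y.obj)) := by
      have hz := isZero_of_degLT_zero ((degLT_succ_iff 0 G).1 hG t.obj)
      have : delπ t.obj G y.obj = 0 := ((Functor.isZero_iff _).1 hz y.obj).eq_of_tgt _ _
      refine Preadditive.epi_of_cancel_zero _ fun {Z} u hu => ?_
      rw [← delπ_delDesc t.obj u hu, this, zero_comp]
    have h₂ : Epi (G.map (lift (𝟙 y.obj) (0 : y.obj ⟶ t.obj))) := by
      have e : lift (𝟙 y.obj) (0 : y.obj ⟶ t.obj) = incl t.obj y.obj ≫ (β_ t.obj y.obj).hom := by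
        rw [additive_incl]
        apply CartesianMonoidalCategory.hom_ext <;> simp
      rw [e, G.map_comp]
      exact epi_comp' h₁ inferInstance
    have h₃ : G.map (fst y.obj t.obj) ≫ G.map (lift (𝟙 y.obj) (0 : y.obj ⟶ t.obj)) = 𝟙 _ := by
      rw [← cancel_epi (G.map (lift (𝟙 y.obj) (0 : y.obj ⟶ t.obj))), ← G.map_comp, ← G.map_comp,
        lift_fst_assoc, Category.comp_id, Category.id_comp]
    have h₄ : ∀ {z z' : d.Herm k ε} (g : z ⟶ z'), G.map g.hom ≫ appAA f z' = appAA f z := fun g =>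
      (f.naturality g).trans (Category.comp_id _)
    have h₅ : G.map (lift (𝟙 y.obj) (0 : y.obj ⟶ t.obj)) ≫ appAA f (y ⊗ t) = appAA f y := by
      rw [← h₄ (inclLeft y t), inclLeft_hom]
    have h₆ : G.map (fst y.obj t.obj) ≫ appAA f y = appAA f (y ⊗ t) := by
      rw [← h₅, ← Category.assoc, h₃]
      exact Category.id_comp _
    refine Eq.trans ?_ (Category.comp_id _).symm
    rw [← h₄ g, G.map_comp, Category.assoc]
    exact congrArg (fun s => G.map g.hom ≫ s) h₆

/-- By `hom_retraction`, g followed by a suitable morphism is the inclusion of a summand, which F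
sends to a monomorphism. -/
lemma mono_map_of_mono_iotaApp {F : d.Herm k ε ⥤ B} (hF : ∀ x, Mono (iotaApp x F))
    {x y : d.Herm k ε} (g : x ⟶ y) : Mono (F.map g) := by
  have e : g ≫ retraction g = incl y x ≫ (β_ y x).hom := by
    rw [incl_braiding]
    apply Herm.hom_ext
    rw [hom_retraction, inclLeft_hom]
  have h₁ : Mono (F.map (incl y x)) := by
    have := hF y
    exact inferInstanceAs (Mono ((iotaApp y F).app x))
  have h₂ : Mono (F.map g ≫ F.map (retraction g)) := by
    rw [← F.map_comp, e, F.map_comp]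
    exact mono_comp' h₁ inferInstance
  exact mono_of_mono _ (F.map (retraction g))

lemma exists_embedding_zero {F : d.Herm k ε ⥤ B} (hF : degLT _ B 1 F) :
    ∃ (I : A ⥤ B) (_ : IsNice d k ε 0 I) (η : F ⟶ (res B d k ε).obj I),
      degLT _ B 0 (kernel η) := by
  obtain ⟨F', p, hp, hk, hF'⟩ := exists_torsionFree_quotient F
  have hm : ∀ {x y : d.Herm k ε} (g : x ⟶ y), Mono (F'.map g) := fun g =>
    mono_map_of_mono_iotaApp hF' g
  obtain ⟨E, η, hη⟩ := exists_mono_to_const hm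
    (map_eq_of_degLT_one ((degLT _ B 1).prop_of_epi p hF) hm)
  let η' : F' ⟶ (res B d k ε).obj ((Functor.const A).obj E) := toRes η.app fun g => η.naturality g
  have : Mono η' := by
    have : ∀ z, Mono (η'.app z) := fun z => inferInstanceAs (Mono (η.app z))
    exact NatTrans.mono_of_mono_app _
  refine ⟨_, isNice_const E, p ≫ η', ?_⟩
  rw [degLT_zero_iff]
  exact (stablyNull _ B).prop_of_iso (kernelCompMono p η').symm hk

lemma exists_embedding (n : ℕ) {F : d.Herm k ε ⥤ B} (hF : degLT _ B (n + 1) F) :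
    ∃ (I : A ⥤ B) (_ : IsNice d k ε n I) (η : F ⟶ (res B d k ε).obj I),
      degLT _ B n (kernel η) := by
  induction n generalizing F with
  | zero => exact exists_embedding_zero hF
  | succ n ih => exact exists_embedding_succ (fun F => ih) hF

end Duality
end Constant
-- A criterion of equivalence for exact functors.
section ExactFunctors

variable {C : Type*} [Category* C] [Abelian C] {D : Type*} [Category* D] [Abelian D]

lemma faithful_of_exact_of_reflects_isZero (E : C ⥤ D) [PreservesFiniteLimits E]
    [PreservesFiniteColimits E] (h₀ : ∀ X, IsZero (E.obj X) → IsZero X) : E.Faithful := by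
  have : E.Additive := E.additive_of_preserves_binary_products
  have key : ∀ {X Y : C} (f : X ⟶ Y), E.map f = 0 → f = 0 := fun {X Y} f hf => by
    have e : E.map (Abelian.factorThruImage f) ≫ E.map (Abelian.image.ι f) = 0 := by
      rw [← E.map_comp, Abelian.image.fac, hf]
    have hz : IsZero (E.obj (Abelian.image f)) := by
      rw [IsZero.iff_id_eq_zero, ← cancel_mono (E.map (Abelian.image.ι f)),
        ← cancel_epi (E.map (Abelian.factorThruImage f))]
      simpa using e
    rw [← Abelian.image.fac f, (h₀ _ hz).eq_of_tgt (Abelian.factorThruImage f) 0, zero_comp]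
  exact ⟨fun {X Y f g} h => by
    rw [← sub_eq_zero]
    exact key _ (by rw [E.map_sub, h, sub_self])⟩

/-- An exact functor `E` which reflects zero objects is an equivalence as soon as there are enough
objects `N` such that all the morphisms to `E N` come from morphisms to `N`. -/
lemma isEquivalence_of_exact (E : C ⥤ D) [PreservesFiniteLimits E] [PreservesFiniteColimits E]
    (h₀ : ∀ X, IsZero (E.obj X) → IsZero X) {ι : Type*} (N : ι → C)
    (h₁ : ∀ X i, Function.Surjective (E.map : (X ⟶ N i) → (E.obj X ⟶ E.obj (N i))))
    (h₂ : ∀ X, ∃ (i : ι) (f : X ⟶ N i), Mono f)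
    (h₃ : ∀ Y, ∃ (i : ι) (f : Y ⟶ E.obj (N i)), Mono f) : E.IsEquivalence := by
  have : E.Additive := E.additive_of_preserves_binary_products
  have hF : E.Faithful := faithful_of_exact_of_reflects_isZero E h₀
  -- Embed Y in N i and the cokernel in N j. The morphism X ⟶ N i that induces g dies in the
  -- cokernel because E is faithful, so it factors through Y.
  have : E.Full := ⟨fun {X Y} g => by
    obtain ⟨i, m, _⟩ := h₂ Y
    obtain ⟨j, c, _⟩ := h₂ (cokernel m)
    obtain ⟨u, hu⟩ := h₁ _ _ (g ≫ E.map m)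
    have e : u ≫ cokernel.π m = 0 := by
      rw [← cancel_mono c, zero_comp, Category.assoc]
      apply E.map_injective
      rw [E.map_comp, hu, Category.assoc, ← E.map_comp, cokernel.condition_assoc, zero_comp,
        E.map_zero, comp_zero, E.map_zero]
    refine ⟨(ShortComplex.exact_cokernel m).lift u e, ?_⟩
    rw [← cancel_mono (E.map m), ← E.map_comp, ← hu]
    exact congrArg _ ((ShortComplex.exact_cokernel m).lift_f u e)⟩
  -- Z is the kernel of a morphism E(N i) ⟶ E(N j), which comes from some u; by exactness Z is the
  -- image of the kernel of u.
  have : E.EssSurj := ⟨fun Z => by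
    obtain ⟨i, m, _⟩ := h₃ Z
    obtain ⟨j, c, _⟩ := h₃ (cokernel m)
    obtain ⟨u, hu⟩ := h₁ _ _ (cokernel.π m ≫ c)
    have hm : m ≫ E.map u = 0 := by rw [hu, cokernel.condition_assoc, zero_comp]
    have e : kernel.ι (E.map u) ≫ cokernel.π m = 0 := by
      rw [← cancel_mono c, zero_comp, Category.assoc, ← hu, kernel.condition]
    have hl : (ShortComplex.exact_cokernel m).lift _ e ≫ m = kernel.ι (E.map u) :=
      (ShortComplex.exact_cokernel m).lift_f _ e
    exact ⟨kernel u, ⟨PreservesKernel.iso E u ≪≫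
      { hom := (ShortComplex.exact_cokernel m).lift _ e
        inv := kernel.lift _ m hm
        hom_inv_id := by
          rw [← cancel_mono (kernel.ι _), Category.assoc, kernel.lift_ι, hl, Category.id_comp]
        inv_hom_id := by
          rw [← cancel_mono m, Category.assoc, hl, kernel.lift_ι, Category.id_comp] }⟩⟩⟩
  exact { }

end ExactFunctors

section Rigid

variable {A : Type v} [SmallCategory A] [Preadditive A] [HasFiniteBiproducts A]
  {B : Type u} [Category.{v} B] [Abelian B] [IsGrothendieckAbelian.{v} B]
  {d : Duality A} {k : FormKind} {ε : ℤˣ}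

open CartesianMonoidalCategory

namespace Duality

/-- At an object a without form, use that a is a retract of its hyperbolic object; rigidity makes
the result natural and compatible with f. -/
lemma Rigid.exists_map_eq {n : ℕ} {G I : A ⥤ B} (hI : Rigid d k ε n I) (hG : degLT A B (n + 1) G)
    (f : (res B d k ε).obj G ⟶ (res B d k ε).obj I) : ∃ f', (res B d k ε).map f' = f := by
  let i (a : A) : a ⟶ (Herm.hyperbolic d k ε a).obj := lift (𝟙 a) (0 : a ⟶ d.D.obj (op a))
  let r (a : A) : (Herm.hyperbolic d k ε a).obj ⟶ a := fst a (d.D.obj (op a))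
  have hi (a : A) : i a ≫ r a = 𝟙 a := lift_fst _ _
  have hn {x y : d.Herm k ε} (h : x.obj ⟶ y.obj) := hI G hG f h
  refine ⟨{ app := fun a => G.map (i a) ≫ appAA f (Herm.hyperbolic d k ε a) ≫ I.map (r a)
            naturality := fun a b g => ?_ }, ?_⟩
  · have h₁ := hn (x := Herm.hyperbolic d k ε a) (y := Herm.hyperbolic d k ε b) (r a ≫ g ≫ i b)
    have e₁ : i a ≫ r a ≫ g ≫ i b = g ≫ i b := by rw [reassoc_of% hi a]
    have e₂ : (r a ≫ g ≫ i b) ≫ r b = r a ≫ g := by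
      rw [Category.assoc, Category.assoc, hi b, Category.comp_id]
    rw [← G.map_comp_assoc, ← e₁, G.map_comp_assoc, reassoc_of% h₁, ← I.map_comp, e₂]
    simp
  · ext x
    have h₁ := hn (x := x) (y := Herm.hyperbolic d k ε x.obj) (i x.obj)
    change G.map (i x.obj) ≫ appAA f (Herm.hyperbolic d k ε x.obj) ≫ I.map (r x.obj) = appAA f x
    rw [reassoc_of% h₁, ← I.map_comp, hi, I.map_id, Category.comp_id]

end Duality

end Rigid

/-! ### Realizing morphisms of the quotients by natural transformations. -/

section Quotient

variable {M : Type v} [SmallCategory M] [MonoidalCategory M] [InitialUnit M] [SymmetricCategory M]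
  {B : Type u} [Category.{v} B] [Abelian B] [IsGrothendieckAbelian.{v} B]

variable (M B) in
/-- The functors of degree `≤ n`. -/
abbrev Deg (n : ℕ) := (degLT M B (n + 1)).FullSubcategory

variable (M B) in
/-- The projection from the functors of degree `≤ n` to `Pol_n(M, B)`. -/
noncomputable def toPol (n : ℕ) : Deg M B n ⥤ Pol M B n :=
  (polLT M B (n + 1)).lift ((degLT M B (n + 1)).ι ⋙ toSt M B) fun F => F.property


variable (M B) in
/-- The projection from the functors of degree `≤ n` to `Pol_n(M, B) / Pol_{n-1}(M, B)`. -/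
noncomputable def toDegQuot (n : ℕ) : Deg M B n ⥤ PolQuot M B n := toPol M B n ⋙ toPolQuot M B n

variable (n : ℕ)

instance toPol_essSurj : (toPol M B n).EssSurj := ⟨fun X => by
  have := Localization.essSurj (toSt M B) (stablyNull M B).isoModSerre
  let e := (toSt M B).objObjPreimageIso X.obj
  exact ⟨⟨(toSt M B).objPreimage X.obj, (polLT M B (n + 1)).prop_of_iso e.symm X.property⟩,
    ⟨ObjectProperty.isoMk _ e⟩⟩⟩

instance toPolQuot_essSurj : (toPolQuot M B n).EssSurj :=
  Localization.essSurj (toPolQuot M B n) (polSub M B n).isoModSerre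

instance toDegQuot_essSurj : (toDegQuot M B n).EssSurj :=
  inferInstanceAs (toPol M B n ⋙ toPolQuot M B n).EssSurj

variable {n}

lemma exists_fraction {C D : Type*} [Category* C] [Category* D] (L : C ⥤ D)
    (W : MorphismProperty C) [L.IsLocalization W] [W.HasRightCalculusOfFractions] {X Y : C}
    (g : L.obj X ⟶ L.obj Y) :
    ∃ (X' : C) (s : X' ⟶ X) (f : X' ⟶ Y), W s ∧ IsIso (L.map s) ∧ L.map s ≫ g = L.map f := by
  obtain ⟨φ, rfl⟩ := Localization.exists_rightFraction L W g
  exact ⟨φ.X', φ.s, φ.f, φ.hs, Localization.inverts L W φ.s φ.hs,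
    MorphismProperty.RightFraction.map_s_comp_map _ _ _⟩

/-- The denominator of a fraction is an isomorphism modulo stably null functors, hence modulo degree
< n, and L is local for it. -/
lemma exists_map_toSt {F L : M ⥤ B} (hL : (degIso M B n).isLocal L)
    (g : (toSt M B).obj F ⟶ (toSt M B).obj L) : ∃ f : F ⟶ L, (toSt M B).map f = g := by
  obtain ⟨F', s, f, hs, hs', e⟩ := exists_fraction (toSt M B) (stablyNull M B).isoModSerre g
  obtain ⟨f', hf⟩ := (hL s (isoModSerre_mono (fun _ => degLT_of_stablyNull n) hs)).2 f
  refine ⟨f', ?_⟩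
  rw [← cancel_epi ((toSt M B).map s), e, ← Functor.map_comp]
  exact congrArg _ hf

lemma degIso_of_isoModSerre {F G : Deg M B n} (f : F ⟶ G)
    (h : (polSub M B n).isoModSerre ((toPol M B n).map f)) : degIso M B n f.hom :=
  (isoModSerre_inverseImage_iff (toSt M B) (polLT M B n) f.hom).2
    ((isoModSerre_inverseImage_iff (polLT M B (n + 1)).ι (polLT M B n) _).1 h)

lemma exists_map_toPolQuot {F L : Deg M B n} (hL : (degIso M B n).isLocal L.obj)
    (g : (toPolQuot M B n).obj ((toPol M B n).obj F) ⟶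
      (toPolQuot M B n).obj ((toPol M B n).obj L)) :
    ∃ f : F ⟶ L, (toPolQuot M B n).map ((toPol M B n).map f) = g := by
  obtain ⟨X, σ, φ, hσ, hσ', hφ⟩ := exists_fraction (toPolQuot M B n)
    (polSub M B n).isoModSerre (X := (toPol M B n).obj F) (Y := (toPol M B n).obj L) g
  -- The denominator σ lives in the stable category. A second fraction replaces it by a natural
  -- transformation s' : X₂ ⟶ F, along which locality of L extends the numerator.
  let e := (toPol M B n).objObjPreimageIso X
  let F₁ := (toPol M B n).objPreimage X
  obtain ⟨X₂, s, s', -, hs, e₁⟩ := exists_fraction (toSt M B) (stablyNull M B).isoModSerre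
    (X := F₁.obj) (Y := F.obj) (e.hom ≫ σ).hom
  let F₂ : Deg M B n := ⟨X₂, (polLT M B (n + 1)).prop_of_iso
    (@asIso _ _ _ _ _ hs).symm F₁.property⟩
  let t : F₂ ⟶ F₁ := ObjectProperty.homMk s
  let t' : F₂ ⟶ F := ObjectProperty.homMk s'
  have ht : IsIso ((toPol M B n).map t) :=
    (ObjectProperty.isoMk (polLT M B (n + 1)) (X := (toPol M B n).obj F₂)
      (Y := (toPol M B n).obj F₁) (@asIso _ _ _ _ _ hs)).isIso_hom
  have e₁' : (toPol M B n).map t ≫ e.hom ≫ σ = (toPol M B n).map t' := ObjectProperty.hom_ext _ e₁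
  have hs' : degIso M B n s' := by
    refine degIso_of_isoModSerre t' ?_
    rw [← e₁', ← Category.assoc]
    exact MorphismProperty.RespectsIso.precomp _ ((toPol M B n).map t ≫ e.hom) σ hσ
  obtain ⟨f₁, hf₁⟩ := exists_map_toSt (F := X₂) (L := L.obj) hL
    ((toPol M B n).map t ≫ e.hom ≫ φ).hom
  obtain ⟨f, hf⟩ := (hL s' hs').2 f₁
  have e₂ : (toPol M B n).map t' ≫ (toPol M B n).map (ObjectProperty.homMk f : F ⟶ L) =
      (toPol M B n).map t ≫ e.hom ≫ φ := by
    apply ObjectProperty.hom_ext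
    refine Eq.trans ?_ hf₁
    refine Eq.trans ?_ (congrArg (toSt M B).map hf)
    exact ((toSt M B).map_comp s' f).symm
  refine ⟨ObjectProperty.homMk f, ?_⟩
  have : IsIso ((toPolQuot M B n).map ((toPol M B n).map t')) := by
    rw [← e₁', Functor.map_comp, Functor.map_comp]
    infer_instance
  rw [← cancel_epi ((toPolQuot M B n).map ((toPol M B n).map t'))]
  refine ((toPolQuot M B n).map_comp _ _).symm.trans ?_
  rw [e₂, ← e₁']
  simp only [Functor.map_comp, Category.assoc]
  rw [hφ]

lemma exists_map_toDegQuot {F L : Deg M B n} (hL : (degIso M B n).isLocal L.obj)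
    (g : (toDegQuot M B n).obj F ⟶ (toDegQuot M B n).obj L) :
    ∃ f : F ⟶ L, (toDegQuot M B n).map f = g :=
  exists_map_toPolQuot hL g

noncomputable instance : Abelian (PolQuot M B n) :=
  ObjectProperty.SerreClassLocalization.abelian (toPolQuot M B n) (polSub M B n)

lemma exact_of_comp_fullyFaithful {C D E : Type*} [Category* C] [Category* D] [Category* E]
    (F : C ⥤ D) (G : D ⥤ E) [G.Full] [G.Faithful] :
    (PreservesFiniteLimits (F ⋙ G) → PreservesFiniteLimits F) ∧
    (PreservesFiniteColimits (F ⋙ G) → PreservesFiniteColimits F) := by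
  refine ⟨fun _ => ⟨fun J _ _ => ?_⟩, fun _ => ⟨fun J _ _ => ?_⟩⟩
  · exact preservesLimitsOfShape_of_reflects_of_preserves F G
  · exact preservesColimitsOfShape_of_reflects_of_preserves F G

instance toPol_limits : PreservesFiniteLimits (toPol M B n) :=
  (exact_of_comp_fullyFaithful (toPol M B n) (polLT M B (n + 1)).ι).1
    (inferInstanceAs (PreservesFiniteLimits ((degLT M B (n + 1)).ι ⋙ toSt M B)))

instance toPolQuot_limits : PreservesFiniteLimits (toPolQuot M B n) :=
  ObjectProperty.SerreClassLocalization.preservesFiniteLimits (toPolQuot M B n) (polSub M B n)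

instance toPolQuot_colimits : PreservesFiniteColimits (toPolQuot M B n) :=
  ObjectProperty.SerreClassLocalization.preservesFiniteColimits (toPolQuot M B n) (polSub M B n)

lemma isZero_toDegQuot_iff (F : Deg M B n) :
    IsZero ((toDegQuot M B n).obj F) ↔ degLT M B n F.obj :=
  ObjectProperty.SerreClassLocalization.isZero_obj_iff (toPolQuot M B n) (polSub M B n) _

lemma mono_toDegQuot_map {F G : Deg M B n} (f : F ⟶ G) (h : degLT M B n (kernel f.hom)) :
    Mono ((toDegQuot M B n).map f) := by
  refine (ObjectProperty.SerreClassLocalization.mono_map_iff (toPolQuot M B n) (polSub M B n)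
    ((toPol M B n).map f)).2 ?_
  exact (polSub M B n).prop_of_iso (PreservesKernel.iso (toPol M B n) f)
    ((degLT M B n).prop_of_iso (PreservesKernel.iso (degLT M B (n + 1)).ι f).symm h)

end Quotient
-- The functors induced by restriction, and the equivalence.
section Comparison

variable {A : Type v} [SmallCategory A] [Preadditive A] [HasFiniteBiproducts A]

namespace Duality

variable (d : Duality A) (k : FormKind) (ε : ℤˣ)
  (B : Type u) [Category.{v} B] [Abelian B] [IsGrothendieckAbelian.{v} B]

/-- Over A stably null functors are zero, so only isomorphisms have to be inverted. -/
lemma res_inverts : (stablyNull A B).isoModSerre.IsInvertedBy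
    (res B d k ε ⋙ toSt (d.Herm k ε) B) := by
  intro F G f hf
  have : Mono f := Preadditive.mono_of_isZero_kernel _ (isZero_of_stablyNull hf.1)
  have : Epi f := Preadditive.epi_of_isZero_cokernel _ (isZero_of_stablyNull hf.2)
  have := isIso_of_mono_of_epi f
  infer_instance

/-- The functor between the stable categories induced by the restriction. -/
noncomputable def stRes : St A B ⥤ St (d.Herm k ε) B :=
  Localization.lift (res B d k ε ⋙ toSt (d.Herm k ε) B) (res_inverts d k ε B) (toSt A B)

/-- `stRes` is induced by the restriction. -/
noncomputable def toStResIso : toSt A B ⋙ stRes d k ε B ≅ res B d k ε ⋙ toSt (d.Herm k ε) B :=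
  Localization.fac _ (res_inverts d k ε B) (toSt A B)

instance stRes_limits : PreservesFiniteLimits (stRes d k ε B) := by
  rw [← ObjectProperty.SerreClassLocalization.preservesFiniteLimits_comp_iff (toSt A B)
    (stablyNull A B)]
  exact preservesFiniteLimits_of_natIso (toStResIso d k ε B).symm

instance stRes_colimits : PreservesFiniteColimits (stRes d k ε B) := by
  rw [← ObjectProperty.SerreClassLocalization.preservesFiniteColimits_comp_iff (toSt A B)
    (stablyNull A B)]
  exact preservesFiniteColimits_of_natIso (toStResIso d k ε B).symm

variable {B} in
lemma polLT_stRes (n : ℕ) {X : St A B} (hX : polLT A B n X) :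
    polLT (d.Herm k ε) B n ((stRes d k ε B).obj X) := by
  have := Localization.essSurj (toSt A B) (stablyNull A B).isoModSerre
  let e := (toSt A B).objObjPreimageIso X
  have h : degLT A B n ((toSt A B).objPreimage X) := (polLT A B n).prop_of_iso e.symm hX
  exact (polLT (d.Herm k ε) B n).prop_of_iso
    (((toStResIso d k ε B).app _).symm ≪≫ (stRes d k ε B).mapIso e) (degLT_res n h)

/-- The functor between the categories of polynomial objects induced by the restriction. -/
noncomputable def polRes (n : ℕ) : Pol A B n ⥤ Pol (d.Herm k ε) B n :=
  (polLT (d.Herm k ε) B (n + 1)).lift ((polLT A B (n + 1)).ι ⋙ stRes d k ε B)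
    fun X => polLT_stRes d k ε (n + 1) X.property

variable (n : ℕ)

instance polRes_limits : PreservesFiniteLimits (polRes d k ε B n) :=
  (exact_of_comp_fullyFaithful (polRes d k ε B n) (polLT (d.Herm k ε) B (n + 1)).ι).1
    (inferInstanceAs (PreservesFiniteLimits ((polLT A B (n + 1)).ι ⋙ stRes d k ε B)))

instance polRes_colimits : PreservesFiniteColimits (polRes d k ε B n) :=
  (exact_of_comp_fullyFaithful (polRes d k ε B n) (polLT (d.Herm k ε) B (n + 1)).ι).2
    (inferInstanceAs (PreservesFiniteColimits ((polLT A B (n + 1)).ι ⋙ stRes d k ε B)))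

lemma polRes_inverts : (polSub A B n).isoModSerre.IsInvertedBy
    (polRes d k ε B n ⋙ toPolQuot (d.Herm k ε) B n) := by
  intro X Y f hf
  refine Localization.inverts (toPolQuot (d.Herm k ε) B n) (polSub (d.Herm k ε) B n).isoModSerre
    ((polRes d k ε B n).map f) ?_
  have h : polSub A B n ≤ (polSub (d.Herm k ε) B n).inverseImage (polRes d k ε B n) :=
    fun X hX => polLT_stRes d k ε n hX
  rw [← isoModSerre_inverseImage_iff (polRes d k ε B n)]
  exact isoModSerre_mono h hf

/-- The functor between the quotients of the categories of polynomial objects induced by the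
restriction. -/
noncomputable def polQuotRes : PolQuot A B n ⥤ PolQuot (d.Herm k ε) B n :=
  Localization.lift (polRes d k ε B n ⋙ toPolQuot (d.Herm k ε) B n) (polRes_inverts d k ε B n)
    (toPolQuot A B n)

/-- `polQuotRes` is induced by `polRes`. -/
noncomputable def toPolQuotResIso : toPolQuot A B n ⋙ polQuotRes d k ε B n ≅
    polRes d k ε B n ⋙ toPolQuot (d.Herm k ε) B n :=
  Localization.fac _ (polRes_inverts d k ε B n) (toPolQuot A B n)

instance polQuotRes_limits : PreservesFiniteLimits (polQuotRes d k ε B n) := by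
  rw [← ObjectProperty.SerreClassLocalization.preservesFiniteLimits_comp_iff (toPolQuot A B n)
    (polSub A B n)]
  exact preservesFiniteLimits_of_natIso (toPolQuotResIso d k ε B n).symm

instance polQuotRes_colimits : PreservesFiniteColimits (polQuotRes d k ε B n) := by
  rw [← ObjectProperty.SerreClassLocalization.preservesFiniteColimits_comp_iff (toPolQuot A B n)
    (polSub A B n)]
  exact preservesFiniteColimits_of_natIso (toPolQuotResIso d k ε B n).symm

/-- The restriction of functors of degree `≤ n`. -/
abbrev degRes : Deg A B n ⥤ Deg (d.Herm k ε) B n :=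
  (degLT (d.Herm k ε) B (n + 1)).lift ((degLT A B (n + 1)).ι ⋙ res B d k ε)
    fun G => degLT_res (n + 1) G.property

/-- The functor `polRes` is induced by the restriction of functors of degree `≤ n`. -/
noncomputable def toPolResIso : toPol A B n ⋙ polRes d k ε B n ≅
    degRes d k ε B n ⋙ toPol (d.Herm k ε) B n :=
  (polLT (d.Herm k ε) B (n + 1)).fullyFaithfulι.whiskeringRight _ |>.preimageIso
    (Functor.isoWhiskerLeft (degLT A B (n + 1)).ι (toStResIso d k ε B))

/-- `polQuotRes` is induced by the restriction of functors of degree `≤ n`. -/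
noncomputable def toDegQuotResIso : toDegQuot A B n ⋙ polQuotRes d k ε B n ≅
    degRes d k ε B n ⋙ toDegQuot (d.Herm k ε) B n :=
  Functor.isoWhiskerLeft (toPol A B n) (toPolQuotResIso d k ε B n) ≪≫
    Functor.isoWhiskerRight (toPolResIso d k ε B n) (toPolQuot (d.Herm k ε) B n)

variable {B} in
-- Locality realizes g by a transformation between restricted functors, and rigidity descends the
-- latter to A.
lemma exists_map_polQuotRes {X : PolQuot A B n} {I : Deg A B n} (hI : IsNice d k ε n I.obj)
    (g : (polQuotRes d k ε B n).obj X ⟶ (polQuotRes d k ε B n).obj ((toDegQuot A B n).obj I)) :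
    ∃ f, (polQuotRes d k ε B n).map f = g := by
  let Q := toDegQuot A B n
  let e := Q.objObjPreimageIso X
  let G : Deg A B n := Q.objPreimage X
  let i := toDegQuotResIso d k ε B n
  obtain ⟨f, hf⟩ := exists_map_toDegQuot (F := (degRes d k ε B n).obj G)
    (L := (degRes d k ε B n).obj I) hI.isLocal
    (i.inv.app G ≫ (polQuotRes d k ε B n).map e.hom ≫ g ≫ i.hom.app I)
  obtain ⟨f', hf'⟩ := hI.rigid.exists_map_eq G.property f.hom
  let φ : G ⟶ I := ObjectProperty.homMk f'
  have hφ : (degRes d k ε B n).map φ = f := ObjectProperty.hom_ext _ hf'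
  refine ⟨e.inv ≫ Q.map φ, ?_⟩
  have hn : (polQuotRes d k ε B n).map (Q.map φ) ≫ i.hom.app I =
      i.hom.app G ≫ (toDegQuot (d.Herm k ε) B n).map f :=
    (i.hom.naturality φ).trans
      (congrArg (fun t => i.hom.app G ≫ (toDegQuot (d.Herm k ε) B n).map t) hφ)
  rw [hf, Iso.hom_inv_id_app_assoc, ← Category.assoc, cancel_mono] at hn
  rw [Functor.map_comp, hn, ← Category.assoc, ← Functor.map_comp, e.inv_hom_id, CategoryTheory.Functor.map_id,
    Category.id_comp]

theorem polQuotRes_isEquivalence : (polQuotRes d k ε B n).IsEquivalence := by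
  refine isEquivalence_of_exact (polQuotRes d k ε B n) (fun X hX => ?_)
    (ι := { I : Deg A B n // IsNice d k ε n I.obj })
    (fun I => (toDegQuot A B n).obj I.1)
    (fun X I g => exists_map_polQuotRes d k ε n I.2 g) (fun X => ?_) (fun Y => ?_)
  · let e := (toDegQuot A B n).objObjPreimageIso X
    let G := (toDegQuot A B n).objPreimage X
    refine IsZero.of_iso ?_ e.symm
    rw [isZero_toDegQuot_iff]
    refine degLT_of_res (d := d) (k := k) (ε := ε) n ?_
    refine (isZero_toDegQuot_iff ((degRes d k ε B n).obj G)).1 ?_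
    exact hX.of_iso (((toDegQuotResIso d k ε B n).app G).symm ≪≫ (polQuotRes d k ε B n).mapIso e)
  · let e := (toDegQuot A B n).objObjPreimageIso X
    let G := (toDegQuot A B n).objPreimage X
    -- Embeddings over A are obtained from those over H(A): η is defined on π^*G, rigidity descends
    -- it to G ⟶ I, and `degLT_of_res` controls its kernel.
    obtain ⟨I, hI, η, hη⟩ := exists_embedding n (degLT_res (d := d) (k := k) (ε := ε) _ G.property)
    obtain ⟨η', rfl⟩ := hI.rigid.exists_map_eq G.property η
    have h := degLT_of_res n ((degLT _ B n).prop_of_iso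
      (PreservesKernel.iso (res B d k ε) η').symm hη)
    let I' : Deg A B n := ⟨I, hI.degLT⟩
    let f : G ⟶ I' := ObjectProperty.homMk η'
    have := mono_toDegQuot_map f h
    exact ⟨⟨I', hI⟩, e.inv ≫ (toDegQuot A B n).map f,
      mono_comp _ _⟩
  · let e := (toDegQuot (d.Herm k ε) B n).objObjPreimageIso Y
    let F := (toDegQuot (d.Herm k ε) B n).objPreimage Y
    obtain ⟨I, hI, η, hη⟩ := exists_embedding n F.property
    let I' : Deg A B n := ⟨I, hI.degLT⟩
    let f : F ⟶ (degRes d k ε B n).obj I' := ObjectProperty.homMk η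
    have := mono_toDegQuot_map f hη
    exact ⟨⟨I', hI⟩, (e.inv ≫ (toDegQuot (d.Herm k ε) B n).map f) ≫
      (toDegQuotResIso d k ε B n).inv.app I', mono_comp _ _⟩

end Duality

end Comparison
end StablePol

theorem mainTheorem1 {A : Type v} [SmallCategory A] [Preadditive A] [HasFiniteBiproducts A]
    (d : StablePol.Duality A) (k : StablePol.FormKind) (ε : ℤˣ)
    (B : Type u) [Category.{v} B] [Abelian B] [IsGrothendieckAbelian.{v} B] (n : ℕ) :
    ∃ S : StablePol.St A B ⥤ StablePol.St (d.Herm k ε) B,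
      Nonempty (StablePol.toSt A B ⋙ S ≅
        (Functor.whiskeringLeft (d.Herm k ε) A B).obj (StablePol.Duality.Herm.forget d k ε) ⋙
          StablePol.toSt (d.Herm k ε) B) ∧
      ∃ P : StablePol.Pol A B n ⥤ StablePol.Pol (d.Herm k ε) B n,
        Nonempty (P ⋙ (StablePol.polLT (d.Herm k ε) B (n + 1)).ι ≅
          (StablePol.polLT A B (n + 1)).ι ⋙ S) ∧
        ∃ E : StablePol.PolQuot A B n ⥤ StablePol.PolQuot (d.Herm k ε) B n,
          Nonempty (StablePol.toPolQuot A B n ⋙ E ≅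
            P ⋙ StablePol.toPolQuot (d.Herm k ε) B n) ∧
          E.IsEquivalence :=
  ⟨d.stRes k ε B, ⟨d.toStResIso k ε B⟩, d.polRes k ε B n,
    ⟨(StablePol.polLT (d.Herm k ε) B (n + 1)).liftCompιIso _ _⟩, d.polQuotRes k ε B n,
    ⟨d.toPolQuotResIso k ε B n⟩, d.polQuotRes_isEquivalence k ε B n⟩
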